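/- Let $k$ be a commutative ring containing $1/2$ and let $X$ be a topological space. An *extended Lie algebroid* over $k$ is $(A,T,\Omega,\partial,\langle\,,\rangle)$ with $A$ a commutative $k$-algebra, $T$ a Lie algebroid over $A$, $\Omega$ an $A$-module that is a module over the Lie algebra $T$, $\partial:A\to\Omega$ a $T$-equivariant derivation, and $\langle\,,\rangle:T\times\Omega\to A$ an $A$-bilinear pairing, such that $\langle\tau,\partial a\rangle=\tau(a)$, $\tau(a\omega)=\tau(a)\omega+a\,\tau(\omega)$, $(a\tau)(\omega)=a\,\tau(\omega)+\langle\tau,\omega\rangle\partial a$ and $\tau\langle\nu,\omega\rangle=\langle[\tau,\nu],\omega\rangle+\langle\nu,\tau(\omega)\rangle$. Let $\mathcal T$ be a sheaf of extended Lie algebroids on $X$ (with $A=\mathcal O_X$, an extended Lie $\mathcal O_X$-algebroid) which is *regular*: every point has an open neighbourhood $U$ such that $\langle\,,\rangle$ identifies $\Omega(V)$ with $\mathrm{Hom}_{A(V)}(T(V),A(V))$ for every open $V\subseteq U$, and $T|_U$ has a finite basis of pairwise commuting sections. Let $\Omega^2$ be the sheaf of $A$-linear maps $\eta:T\to\Omega$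 with $\eta(\tau,\tau'):=\langle\tau',\eta(\tau)\rangle$ skew symmetric, $\Omega^{3,cl}$ the sheaf of closed skew symmetric three-forms, viewed as $A$-bilinear maps $T\times T\to\Omega$ through $\omega(\tau_1,\tau_2,\tau_3)=\langle\tau_3,\omega(\tau_1,\tau_2)\rangle$, and $\Omega^{[2,3\rangle}$ the complex $d:\Omega^2\to\Omega^{3,cl}$ with $\Omega^2$ in degree $0$ and $d$ the usual (Chevalley–de Rham) differential. Its hypercohomology $H^i(X;\Omega^{[2,3\rangle})$ is computed by the Čech complex, in the limit over open covers. A *vertex algebroid* over $(A,T,\Omega,\partial,\langle\,,\rangle)$ consists of $k$-bilinear maps $\gamma:A\times T\to\Omega$, $\langle\,,\rangle:T\times T\to A$ (symmetric) and $c:T\times T\to\Omega$ (skew symmetric) such that, with $\langle\,,\rangle$ extended symmetrically to $T\oplus\Omega$ and equal to zero on $\Omega\times\Omega$, $$\gamma(a,b\tau)=\gamma(ab,\tau)-a\gamma(b,\tau)-\tau(a)\partial b-\tau(b)\partial a,$$ $$\langle a\tau_1,\tau_2\rangle=a\langle\tau_1,\tau_2\rangle+\langle\gamma(a,\tau_1),\tau_2\rangle-\tau_1\tau_2(a),$$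 $$c(a\tau_1,\tau_2)=a\,c(\tau_1,\tau_2)+\gamma(a,[\tau_1,\tau_2])-\gamma(\tau_2(a),\tau_1)+\tau_2\gamma(a,\tau_1)-\tfrac12\langle\tau_1,\tau_2\rangle\partial a+\tfrac12\partial\tau_1\tau_2(a)-\tfrac12\partial\langle\tau_2,\gamma(a,\tau_1)\rangle,$$ $$\langle[\tau_1,\tau_2],\tau_3\rangle+\langle\tau_2,[\tau_1,\tau_3]\rangle=\tau_1\langle\tau_2,\tau_3\rangle-\tfrac12\tau_2\langle\tau_1,\tau_3\rangle-\tfrac12\tau_3\langle\tau_1,\tau_2\rangle+\langle\tau_2,c(\tau_1,\tau_3)\rangle+\langle\tau_3,c(\tau_1,\tau_2)\rangle,$$ $$d_{Lie}c(\tau_1,\tau_2,\tau_3)=-\tfrac12\partial\bigl\{\langle[\tau_1,\tau_2],\tau_3\rangle+\langle[\tau_1,\tau_3],\tau_2\rangle-\langle[\tau_2,\tau_3],\tau_1\rangle-\tau_1\langle\tau_2,\tau_3\rangle+\tau_2\langle\tau_1,\tau_3\rangle-2\langle\tau_3,c(\tau_1,\tau_2)\rangle\bigr\},$$ where $d_{Lie}c(\tau_1,\tau_2,\tau_3)=\tau_1c(\tau_2,\tau_3)-\tau_2c(\tau_1,\tau_3)+\tau_3c(\tau_1,\tau_2)-c([\tau_1,\tau_2],\tau_3)+c([\tau_1,\tau_3],\tau_2)-c([\tau_2,\tau_3],\tau_1)$.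 A morphism $(\gamma,\langle\,,\rangle,c)\to(\gamma',\langle\,,\rangle',c')$ is a $k$-linear $h:T\to\Omega$ with $h(a\tau)=a\,h(\tau)-\gamma'(a,\tau)+\gamma(a,\tau)$, $\langle\tau_1,\tau_2\rangle=\langle\tau_1,\tau_2\rangle'+\langle\tau_1,h(\tau_2)\rangle+\langle\tau_2,h(\tau_1)\rangle$ and $c(\tau_1,\tau_2)=c'(\tau_1,\tau_2)+\tfrac12\partial\langle\tau_1,h(\tau_2)\rangle-\tfrac12\partial\langle\tau_2,h(\tau_1)\rangle-\tau_1h(\tau_2)+\tau_2h(\tau_1)+h([\tau_1,\tau_2])$; composition is addition. For a closed three-form $\omega$ let $\mathcal A\dotplus\omega$ be $\mathcal A$ with $c$ replaced by $c+\omega$. Let $\mathcal Alg_{\mathcal T}$ be the stack associated with the sheaf of groupoids of vertex algebroids over $\mathcal T$; its global sections are vertex algebroids $\mathcal A_i$ over the members of an open cover with isomorphisms $\mathcal A_i\to\mathcal A_j$ over the intersections satisfying the cocycle condition. Its characteristic class $c(\mathcal T)\in H^2(X;\Omega^{[2,3\rangle})$ is the class of $(\omega_{ij},\eta_{ijl})$,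 $\eta_{ijl}=h_{ij}+h_{jl}-h_{il}$, for any vertex algebroids $\mathcal A_i$ over the members of an open cover, closed three-forms $\omega_{ij}$ and isomorphisms $h_{ij}:\mathcal A_j\to\mathcal A_i\dotplus\omega_{ij}$ over the intersections. Choose bases $\tau^{(i)}$ of $T$ over the members of an open cover, with transition matrices $\phi_{ij}$, $\tau^{(j)}_a=\sum_b\phi_{ij}^{ab}\tau^{(i)}_b$. Let $$\beta_{ij}(\tau_1,\tau_2,\tau_3)=\tfrac12\mathrm{tr}(ABC-BAC),\qquad A,B,C=\phi_{ij}^{-1}\tau_s(\phi_{ij})\quad(s=1,2,3),$$ $$\alpha_{ijl}(\tau,\tau')=\tfrac12\mathrm{tr}\bigl\{\phi_{jl}^{-1}\tau(\phi_{jl})\,\tau'(\phi_{ij})\phi_{ij}^{-1}-\phi_{jl}^{-1}\tau'(\phi_{jl})\,\tau(\phi_{ij})\phi_{ij}^{-1}\bigr\}.$$ **Theorem.** The class $c(\mathcal T)$ is well defined. The pair $(\alpha,\beta)$ is a Čech two-cocycle of $\Omega^{[2,3\rangle}$, and its class does not depend on the trivializations; write it as $2ch_2(\mathcal T)$, where $ch_2(\mathcal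 T)$ is the Atiyah–Chern–Simons class. Then $$c(\mathcal T)=2\,ch_2(\mathcal T)\quad\text{in }H^2(X;\Omega^{[2,3\rangle}).$$ Hence $\mathcal Alg_{\mathcal T}$ has a global section if and only if $ch_2(\mathcal T)=0$. In that case: 1. the groupoid $\mathcal Alg_{\mathcal T}(X)$ of global sections is equivalent to the groupoid of $\Omega^{[2,3\rangle}$-torsors (pairs of an $\Omega^2$-torsor $P$ and a map of sheaves $w:P\to\Omega^{3,cl}$ with $w(\eta+p)=d\eta+w(p)$); 2. the set of isomorphism classes of global sections is a torsor under $H^1(X;\Omega^{[2,3\rangle})$, where the class of a one-cocycle $(\omega_i,\eta_{ij})$ acts on $(\mathcal A_i,h_{ij}:\mathcal A_i\to\mathcal A_j)$ by sending it to $(\mathcal A_i\dotplus\omega_i,\ h_{ij}+\eta_{ij})$; 3. the automorphism group of each global section is isomorphic to $H^0(X;\Omega^{[2,3\rangle})$, the group of global closed two-forms, with $\eta$ acting by $h=\eta$. -/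

import Mathlib

open CategoryTheory TopologicalSpace Opposite

universe u v

/-- An extended Lie algebroid `(A, T, Ω, ∂, ⟨ , ⟩)` over `k`: a commutative `k`-algebra `A`, a Lie
`A`-algebroid `T` (Mathlib: a Lie–Rinehart algebra), an `A`-module `Ω` which is a module over the
Lie algebra `T`, a `T`-equivariant derivation `∂ : A → Ω` and an `A`-bilinear pairing. -/
structure ExtLieAlgebroid (k : Type v) [CommRing k] where
  /-- the algebra of functions -/
  A : Type u
  /-- the Lie algebroid -/
  T : Type u
  /-- the module of one-forms -/
  Ω : Type u
  [commRing : CommRing A]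
  [algebra : Algebra k A]
  [lieRing : LieRing T]
  [lieAlgebra : LieAlgebra k T]
  [moduleT : Module A T]
  [anchor : LieRingModule T A]
  [lieRinehartRing : LieRinehartRing A T]
  [lieRinehartAlgebra : LieRinehartAlgebra k A T]
  [addCommGroup : AddCommGroup Ω]
  [moduleΩ : Module A Ω]
  [modulekΩ : Module k Ω]
  [scalarTower : IsScalarTower k A Ω]
  [lieRingModule : LieRingModule T Ω]
  [lieModule : LieModule k T Ω]
  /-- the derivation `∂` -/
  del : Derivation k A Ω
  /-- the pairing `⟨τ, ω⟩` -/
  pair : T →ₗ[A] Ω →ₗ[A] A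
  del_lie : ∀ (τ : T) (a : A), del ⁅τ, a⁆ = ⁅τ, del a⁆
  pair_del : ∀ (τ : T) (a : A), pair τ (del a) = ⁅τ, a⁆
  lie_smul_form : ∀ (τ : T) (a : A) (ω : Ω), ⁅τ, a • ω⁆ = ⁅τ, a⁆ • ω + a • ⁅τ, ω⁆
  smul_lie_form : ∀ (a : A) (τ : T) (ω : Ω), ⁅a • τ, ω⁆ = a • ⁅τ, ω⁆ + pair τ ω • del a
  lie_pair : ∀ (τ ν : T) (ω : Ω), ⁅τ, pair ν ω⁆ = pair ⁅τ, ν⁆ ω + pair ν ⁅τ, ω⁆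

namespace ExtLieAlgebroid

attribute [instance] commRing algebra lieRing lieAlgebra moduleT anchor lieRinehartRing
  lieRinehartAlgebra addCommGroup moduleΩ modulekΩ scalarTower lieRingModule lieModule

variable {k : Type v} [CommRing k]

/-- A morphism `(g_A, g_T, g_Ω)` of extended Lie algebroids. -/
@[ext]
structure Hom (E F : ExtLieAlgebroid.{u, v} k) where
  onA : E.A →ₐ[k] F.A
  onT : E.T →ₗ⁅k⁆ F.T
  onΩ : E.Ω →ₗ[k] F.Ω
  map_smul_T : ∀ (a : E.A) (τ : E.T), onT (a • τ) = onA a • onT τ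
  map_smul_Ω : ∀ (a : E.A) (ω : E.Ω), onΩ (a • ω) = onA a • onΩ ω
  map_lie_A : ∀ (τ : E.T) (a : E.A), onA ⁅τ, a⁆ = ⁅onT τ, onA a⁆
  map_lie_Ω : ∀ (τ : E.T) (ω : E.Ω), onΩ ⁅τ, ω⁆ = ⁅onT τ, onΩ ω⁆
  map_del : ∀ a : E.A, onΩ (E.del a) = F.del (onA a)
  map_pair : ∀ (τ : E.T) (ω : E.Ω), onA (E.pair τ ω) = F.pair (onT τ) (onΩ ω)

instance : Category (ExtLieAlgebroid.{u, v} k) where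
  Hom := Hom
  id E :=
    { onA := AlgHom.id k E.A
      onT := LieHom.id
      onΩ := LinearMap.id
      map_smul_T := fun _ _ => rfl
      map_smul_Ω := fun _ _ => rfl
      map_lie_A := fun _ _ => rfl
      map_lie_Ω := fun _ _ => rfl
      map_del := fun _ => rfl
      map_pair := fun _ _ => rfl }
  comp f g :=
    { onA := g.onA.comp f.onA
      onT := g.onT.comp f.onT
      onΩ := g.onΩ.comp f.onΩ
      map_smul_T := fun a τ => by simp [f.map_smul_T, g.map_smul_T]
      map_smul_Ω := fun a τ => by simp [f.map_smul_Ω, g.map_smul_Ω]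
      map_lie_A := fun a τ => by simp [f.map_lie_A, g.map_lie_A]
      map_lie_Ω := fun a τ => by simp [f.map_lie_Ω, g.map_lie_Ω]
      map_del := fun a => by simp [f.map_del, g.map_del]
      map_pair := fun a τ => by simp [f.map_pair, g.map_pair] }

/-- The underlying set of functions. -/
def forgetA : ExtLieAlgebroid.{u, v} k ⥤ Type u where
  obj E := E.A
  map f := ↾(fun a => Hom.onA f a)

/-- The underlying set of the Lie algebroid. -/
def forgetT : ExtLieAlgebroid.{u, v} k ⥤ Type u where
  obj E := E.T
  map f := ↾(fun a => Hom.onT f a)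

/-- The underlying set of one-forms. -/
def forgetΩ : ExtLieAlgebroid.{u, v} k ⥤ Type u where
  obj E := E.Ω
  map f := ↾(fun a => Hom.onΩ f a)

variable (E : ExtLieAlgebroid.{u, v} k)

/-- Perfectness: the pairing identifies `Ω` with `Hom_A(T, A)`. -/
def IsPerfect : Prop := Function.Bijective fun ω : E.Ω => E.pair.flip ω

/-- `Ω²`: the `A`-linear maps `h : T → Ω` for which `⟨τ, h σ⟩` is skew symmetric. -/
def twoFormSubmodule : Submodule k (E.T →ₗ[E.A] E.Ω) where
  carrier := {h | ∀ τ σ, E.pair τ (h σ) = -E.pair σ (h τ)}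
  add_mem' := by
    intro a b ha hb τ σ
    simp only [LinearMap.add_apply, map_add, ha τ σ, hb τ σ]
    ring
  zero_mem' := by intro τ σ; simp
  smul_mem' := by
    intro c a ha τ σ
    simp only [LinearMap.smul_apply, ← algebraMap_smul E.A c, map_smul, ha τ σ, smul_neg]

/-- The Chevalley differential `d_Lie` of a bilinear `c : T × T → Ω`. -/
def dLie (c : E.T → E.T → E.Ω) (τ₁ τ₂ τ₃ : E.T) : E.Ω :=
  ⁅τ₁, c τ₂ τ₃⁆ - ⁅τ₂, c τ₁ τ₃⁆ + ⁅τ₃, c τ₁ τ₂⁆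
    - c ⁅τ₁, τ₂⁆ τ₃ + c ⁅τ₁, τ₃⁆ τ₂ - c ⁅τ₂, τ₃⁆ τ₁

/-- `Ω^{3,cl}`: the `A`-bilinear maps `h : T × T → Ω` for which `⟨τ₁, h(τ₂, τ₃)⟩` is skew symmetric
in its three arguments and whose de Rham–Chevalley differential vanishes. (The condition that `h`
itself be skew symmetric follows from that on `⟨τ₁, h(τ₂, τ₃)⟩` if the algebroid is perfect.) -/
def closedThreeFormSubmodule : Submodule k (E.T →ₗ[E.A] E.T →ₗ[E.A] E.Ω) where
  carrier := {h | (∀ τ₂ τ₃, h τ₂ τ₃ = -h τ₃ τ₂) ∧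
    (∀ τ₁ τ₂ τ₃, E.pair τ₁ (h τ₂ τ₃) = -E.pair τ₂ (h τ₁ τ₃)) ∧
    ∀ τ₁ τ₂ τ₃, E.dLie (fun τ σ => h τ σ) τ₁ τ₂ τ₃ - E.del (E.pair τ₁ (h τ₂ τ₃)) = 0}
  add_mem' := by
    rintro a b ⟨ha, ha', ha''⟩ ⟨hb, hb', hb''⟩
    refine ⟨fun τ₂ τ₃ => ?_, fun τ₁ τ₂ τ₃ => ?_, fun τ₁ τ₂ τ₃ => ?_⟩
    · simp only [LinearMap.add_apply, ha τ₂ τ₃, hb τ₂ τ₃]; abel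
    · simp only [LinearMap.add_apply, map_add, ha' τ₁ τ₂ τ₃, hb' τ₁ τ₂ τ₃]; ring
    · have h := congrArg₂ (· + ·) (ha'' τ₁ τ₂ τ₃) (hb'' τ₁ τ₂ τ₃)
      simp only [dLie, LinearMap.add_apply, map_add, lie_add, add_zero] at h ⊢
      rw [← h]; abel
  zero_mem' := by
    refine ⟨fun τ₂ τ₃ => ?_, fun τ₁ τ₂ τ₃ => ?_, fun τ₁ τ₂ τ₃ => ?_⟩ <;> simp [dLie]
  smul_mem' := by
    rintro c a ⟨ha, ha', ha''⟩
    refine ⟨fun τ₂ τ₃ => ?_, fun τ₁ τ₂ τ₃ => ?_, fun τ₁ τ₂ τ₃ => ?_⟩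
    · simp only [LinearMap.smul_apply]; rw [ha τ₂ τ₃, smul_neg]
    · simp only [LinearMap.smul_apply, ← algebraMap_smul E.A c, map_smul]
      rw [ha' τ₁ τ₂ τ₃, smul_neg]
    · have h := congrArg (c • ·) (ha'' τ₁ τ₂ τ₃)
      have e : E.pair τ₁ (c • a τ₂ τ₃) = c • E.pair τ₁ (a τ₂ τ₃) := by
        rw [← algebraMap_smul E.A c, map_smul, algebraMap_smul]
      simp only [dLie, LinearMap.smul_apply, lie_smul, smul_sub, smul_add, smul_zero,
        e, Derivation.map_smul] at h ⊢
      exact h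

/-- The module `Ω²` of two-forms. -/
def TwoForm : Type u := E.twoFormSubmodule

instance : AddCommGroup E.TwoForm := inferInstanceAs (AddCommGroup E.twoFormSubmodule)

instance : Module k E.TwoForm := inferInstanceAs (Module k E.twoFormSubmodule)

/-- The module `Ω^{3,cl}` of closed three-forms. -/
def ClosedThreeForm : Type u := E.closedThreeFormSubmodule

instance : AddCommGroup E.ClosedThreeForm :=
  inferInstanceAs (AddCommGroup E.closedThreeFormSubmodule)

instance : Module k E.ClosedThreeForm := inferInstanceAs (Module k E.closedThreeFormSubmodule)

section

variable {E}

/-- A two-form as a map `T → Ω`. -/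
def TwoForm.val (h : E.TwoForm) : E.T →ₗ[E.A] E.Ω := Subtype.val h

/-- A three-form as a map `T × T → Ω`. -/
def ClosedThreeForm.val (h : E.ClosedThreeForm) : E.T →ₗ[E.A] E.T →ₗ[E.A] E.Ω := Subtype.val h

theorem TwoForm.add_val (a b : E.TwoForm) : (a + b).val = a.val + b.val := rfl

theorem TwoForm.smul_val (c : k) (a : E.TwoForm) : (c • a).val = c • a.val := rfl

theorem ClosedThreeForm.add_val (a b : E.ClosedThreeForm) : (a + b).val = a.val + b.val := rfl

theorem ClosedThreeForm.smul_val (c : k) (a : E.ClosedThreeForm) :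
    (c • a).val = c • a.val := rfl

theorem TwoForm.ext {a b : E.TwoForm} (h : ∀ τ, a.val τ = b.val τ) : a = b :=
  Subtype.ext (LinearMap.ext h)

theorem ClosedThreeForm.ext {a b : E.ClosedThreeForm} (h : ∀ τ σ, a.val τ σ = b.val τ σ) :
    a = b :=
  Subtype.ext (LinearMap.ext fun τ => LinearMap.ext fun σ => h τ σ)

theorem ClosedThreeForm.skew (h : E.ClosedThreeForm) (τ σ : E.T) : h.val τ σ = -h.val σ τ :=
  h.2.1 τ σ

theorem ClosedThreeForm.skew' (h : E.ClosedThreeForm) (τ₁ τ₂ τ₃ : E.T) :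
    E.pair τ₁ (h.val τ₂ τ₃) = -E.pair τ₂ (h.val τ₁ τ₃) :=
  h.2.2.1 τ₁ τ₂ τ₃

theorem ClosedThreeForm.closed (h : E.ClosedThreeForm) (τ₁ τ₂ τ₃ : E.T) :
    E.dLie (fun τ σ => h.val τ σ) τ₁ τ₂ τ₃ - E.del (E.pair τ₁ (h.val τ₂ τ₃)) = 0 :=
  h.2.2.2 τ₁ τ₂ τ₃

theorem TwoForm.skew (h : E.TwoForm) (τ σ : E.T) :
    E.pair τ (h.val σ) = -E.pair σ (h.val τ) := h.2 τ σ

end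

/-- `(d h)(τ₁, τ₂) = -h[τ₁, τ₂] + τ₁(h τ₂) - τ₂(h τ₁) - ∂⟨τ₁, h τ₂⟩`. -/
def dTwo : E.TwoForm →ₗ[k] E.ClosedThreeForm where
  toFun h :=
    ⟨LinearMap.mk₂ E.A
      (fun τ₁ τ₂ => -h.val ⁅τ₁, τ₂⁆ + ⁅τ₁, h.val τ₂⁆ - ⁅τ₂, h.val τ₁⁆ - E.del (E.pair τ₁ (h.val τ₂)))
      (by intro a b c; simp only [add_lie, map_add, LinearMap.add_apply, lie_add]; abel)
      (by
        intro a τ σ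
        have e : ⁅a • τ, σ⁆ = a • ⁅τ, σ⁆ - ⁅σ, a⁆ • τ := by
          rw [← lie_skew, LieRinehartRing.leibniz_smul_right, ← lie_skew τ σ, smul_neg]
          abel
        simp only [e, map_sub, map_smul, smul_lie_form, lie_smul_form, LinearMap.smul_apply,
          smul_eq_mul, Derivation.leibniz, smul_sub, smul_add, smul_neg]
        abel)
      (by intro a b c; simp only [lie_add, map_add, add_lie]; abel)
      (by
        intro a τ σ
        have e : E.pair τ (h.val σ) = -E.pair σ (h.val τ) := h.skew τ σ
        simp only [LieRinehartRing.leibniz_smul_right, map_add, map_smul, smul_lie_form,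
          lie_smul_form, e, smul_eq_mul, Derivation.leibniz, smul_sub, smul_add, smul_neg,
          map_neg, mul_neg]
        abel),
    by
      refine ⟨fun τ₂ τ₃ => ?_, fun τ₁ τ₂ τ₃ => ?_, fun τ₁ τ₂ τ₃ => ?_⟩
      · simp only [LinearMap.mk₂_apply]
        rw [TwoForm.skew h τ₃ τ₂, ← lie_skew τ₃ τ₂]
        simp only [map_neg]
        abel
      · have e₁ := E.lie_pair τ₂ τ₁ (h.val τ₃)
        have e₂ := E.lie_pair τ₁ τ₂ (h.val τ₃)
        have e₃ := E.lie_pair τ₃ τ₁ (h.val τ₂)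
        have e₄ := E.lie_pair τ₃ τ₂ (h.val τ₁)
        have s₁ := TwoForm.skew h τ₁ ⁅τ₂, τ₃⁆
        have s₂ := TwoForm.skew h τ₂ ⁅τ₁, τ₃⁆
        have s₃ := congrArg (fun a => ⁅τ₃, a⁆) (TwoForm.skew h τ₁ τ₂)
        rw [← lie_skew τ₃ τ₁, map_neg, LinearMap.neg_apply] at e₃
        rw [← lie_skew τ₃ τ₂, map_neg, LinearMap.neg_apply] at e₄
        rw [← lie_skew τ₁ τ₂, map_neg, LinearMap.neg_apply] at e₂
        simp only [lie_neg] at s₃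
        simp only [LinearMap.mk₂_apply, map_sub, map_add, map_neg, pair_del]
        linear_combination -e₁ - e₂ + e₃ + e₄ - s₁ - s₂ - s₃
      · have p : ⁅τ₁, E.pair τ₂ (h.val τ₃)⁆ - ⁅τ₂, E.pair τ₁ (h.val τ₃)⁆ + ⁅τ₃, E.pair τ₁ (h.val τ₂)⁆
            - E.pair ⁅τ₁, τ₂⁆ (h.val τ₃) + E.pair ⁅τ₁, τ₃⁆ (h.val τ₂) - E.pair ⁅τ₂, τ₃⁆ (h.val τ₁)
            + E.pair τ₁ (-h.val ⁅τ₂, τ₃⁆ + ⁅τ₂, h.val τ₃⁆ - ⁅τ₃, h.val τ₂⁆ - E.del (E.pair τ₂ (h.val τ₃)))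
            = 0 := by
          have e₁ := E.lie_pair τ₂ τ₁ (h.val τ₃)
          have e₃ := E.lie_pair τ₃ τ₁ (h.val τ₂)
          have s₁ := TwoForm.skew h τ₁ ⁅τ₂, τ₃⁆
          rw [← lie_skew τ₂ τ₁, map_neg, LinearMap.neg_apply] at e₁
          rw [← lie_skew τ₃ τ₁, map_neg, LinearMap.neg_apply] at e₃
          simp only [map_sub, map_add, map_neg, pair_del]
          linear_combination -e₁ + e₃ - s₁
        have j : h.val ⁅⁅τ₁, τ₂⁆, τ₃⁆ - h.val ⁅⁅τ₁, τ₃⁆, τ₂⁆ + h.val ⁅⁅τ₂, τ₃⁆, τ₁⁆ = 0 := by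
          have e := lie_jacobi τ₁ τ₂ τ₃
          rw [← lie_skew τ₃ τ₁, lie_neg] at e
          rw [← map_sub, ← map_add, ← map_zero h.val, ← neg_zero, ← e, ← lie_skew ⁅τ₁, τ₂⁆ τ₃,
            ← lie_skew ⁅τ₁, τ₃⁆ τ₂, ← lie_skew ⁅τ₂, τ₃⁆ τ₁]
          congr 1
          abel
        have l : ∀ (x y : E.T) (w : E.Ω), ⁅⁅x, y⁆, w⁆ = ⁅x, ⁅y, w⁆⁆ - ⁅y, ⁅x, w⁆⁆ :=
          fun x y w => lie_lie x y w
        have p' := congrArg E.del p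
        simp only [map_add, map_sub, map_neg, map_zero] at p'
        rw [← neg_zero, ← p', ← add_zero (-_), ← j]
        simp only [dLie, LinearMap.mk₂_apply, lie_add, lie_sub, lie_neg, ← del_lie, l,
          map_add, map_sub, map_neg]
        abel⟩
  map_add' a b := by
    refine ClosedThreeForm.ext fun τ σ => ?_
    change -(a + b).val ⁅τ, σ⁆ + ⁅τ, (a + b).val σ⁆ - ⁅σ, (a + b).val τ⁆ - E.del (E.pair τ ((a + b).val σ)) =
      (-a.val ⁅τ, σ⁆ + ⁅τ, a.val σ⁆ - ⁅σ, a.val τ⁆ - E.del (E.pair τ (a.val σ)))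
        + (-b.val ⁅τ, σ⁆ + ⁅τ, b.val σ⁆ - ⁅σ, b.val τ⁆ - E.del (E.pair τ (b.val σ)))
    simp only [TwoForm.add_val, LinearMap.add_apply, lie_add, map_add]
    abel
  map_smul' c a := by
    refine ClosedThreeForm.ext fun τ σ => ?_
    have e : ∀ x, E.pair τ (c • x) = c • E.pair τ x := fun x => by
      rw [← algebraMap_smul E.A c, map_smul, algebraMap_smul]
    change -(c • a).val ⁅τ, σ⁆ + ⁅τ, (c • a).val σ⁆ - ⁅σ, (c • a).val τ⁆ - E.del (E.pair τ ((c • a).val σ)) =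
      c • (-a.val ⁅τ, σ⁆ + ⁅τ, a.val σ⁆ - ⁅σ, a.val τ⁆ - E.del (E.pair τ (a.val σ)))
    simp only [TwoForm.smul_val, LinearMap.smul_apply, lie_smul, e,
      Derivation.map_smul, smul_sub, smul_add, smul_neg]

/-- A vertex algebroid with underlying extended Lie algebroid `E`. The symmetric pairing on `T ⊕ Ω`
is given by its component `ip` on `T × T`, by `E.pair` on `T × Ω`, and by zero on `Ω × Ω`. -/
structure VertexAlgebroid [Invertible (2 : k)] where
  /-- the map `γ(a, τ)` -/
  gam : E.A →ₗ[k] E.T →ₗ[k] E.Ω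
  /-- the pairing `⟨τ₁, τ₂⟩` -/
  ip : E.T →ₗ[k] E.T →ₗ[k] E.A
  /-- the map `c(τ₁, τ₂)` -/
  c : E.T →ₗ[k] E.T →ₗ[k] E.Ω
  ip_symm : ∀ τ₁ τ₂, ip τ₁ τ₂ = ip τ₂ τ₁
  c_skew : ∀ τ₁ τ₂, c τ₁ τ₂ = -c τ₂ τ₁
  A1 : ∀ (a b : E.A) (τ : E.T),
    gam a (b • τ) = gam (a * b) τ - a • gam b τ - ⁅τ, a⁆ • E.del b - ⁅τ, b⁆ • E.del a
  A2 : ∀ (a : E.A) (τ₁ τ₂ : E.T),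
    ip (a • τ₁) τ₂ = a * ip τ₁ τ₂ + E.pair τ₂ (gam a τ₁) - ⁅τ₁, ⁅τ₂, a⁆⁆
  A3 : ∀ (a : E.A) (τ₁ τ₂ : E.T),
    c (a • τ₁) τ₂ = a • c τ₁ τ₂ + gam a ⁅τ₁, τ₂⁆ - gam ⁅τ₂, a⁆ τ₁ + ⁅τ₂, gam a τ₁⁆
      - (⅟2 : k) • ip τ₁ τ₂ • E.del a + (⅟2 : k) • E.del ⁅τ₁, ⁅τ₂, a⁆⁆
      - (⅟2 : k) • E.del (E.pair τ₂ (gam a τ₁))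
  A4 : ∀ τ₁ τ₂ τ₃ : E.T,
    ip ⁅τ₁, τ₂⁆ τ₃ + ip τ₂ ⁅τ₁, τ₃⁆ =
      ⁅τ₁, ip τ₂ τ₃⁆ - (⅟2 : k) • ⁅τ₂, ip τ₁ τ₃⁆ - (⅟2 : k) • ⁅τ₃, ip τ₁ τ₂⁆
        + E.pair τ₂ (c τ₁ τ₃) + E.pair τ₃ (c τ₁ τ₂)
  A5 : ∀ τ₁ τ₂ τ₃ : E.T,
    E.dLie (fun τ σ => c τ σ) τ₁ τ₂ τ₃ =
      -((⅟2 : k) • E.del (ip ⁅τ₁, τ₂⁆ τ₃ + ip ⁅τ₁, τ₃⁆ τ₂ - ip ⁅τ₂, τ₃⁆ τ₁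
        - ⁅τ₁, ip τ₂ τ₃⁆ + ⁅τ₂, ip τ₁ τ₃⁆ - (2 : k) • E.pair τ₃ (c τ₁ τ₂)))

namespace VertexAlgebroid

variable {E} [Invertible (2 : k)]

/-- `h : T → Ω` is a morphism `𝒜 → ℬ` of vertex algebroids over the identity of `E`, that is,
`(id, id, id, h)` is a morphism. -/
structure IsMor (𝒜 ℬ : E.VertexAlgebroid) (h : E.T →ₗ[k] E.Ω) : Prop where
  gam : ∀ (a : E.A) (τ : E.T), h (a • τ) = a • h τ - ℬ.gam a τ + 𝒜.gam a τ
  ip : ∀ τ₁ τ₂ : E.T,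
    𝒜.ip τ₁ τ₂ = ℬ.ip τ₁ τ₂ + E.pair τ₁ (h τ₂) + E.pair τ₂ (h τ₁)
  c : ∀ τ₁ τ₂ : E.T,
    𝒜.c τ₁ τ₂ = ℬ.c τ₁ τ₂ + (⅟2 : k) • E.del (E.pair τ₁ (h τ₂))
      - (⅟2 : k) • E.del (E.pair τ₂ (h τ₁)) - ⁅τ₁, h τ₂⁆ + ⁅τ₂, h τ₁⁆ + h ⁅τ₁, τ₂⁆

theorem IsMor.comp {𝒜 ℬ 𝒞 : E.VertexAlgebroid} {h h' : E.T →ₗ[k] E.Ω}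
    (H : IsMor 𝒜 ℬ h) (H' : IsMor ℬ 𝒞 h') : IsMor 𝒜 𝒞 (h + h') where
  gam a τ := by
    simp only [LinearMap.add_apply, H.gam, H'.gam, smul_add]; abel
  ip τ₁ τ₂ := by
    simp only [LinearMap.add_apply, H.ip, H'.ip, map_add]; abel
  c τ₁ τ₂ := by
    simp only [LinearMap.add_apply, H.c, H'.c, map_add, lie_add, smul_add]; abel

/-- `𝒜 ∔ ω`: the vertex algebroid with `c` replaced by `c + ω`, for a closed three-form `ω`. -/
def twist (𝒜 : E.VertexAlgebroid) (ω : E.ClosedThreeForm) : E.VertexAlgebroid where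
  gam := 𝒜.gam
  ip := 𝒜.ip
  c := 𝒜.c + LinearMap.mk₂ k (fun τ σ => ω.val τ σ) (by simp) (by
      intro c τ σ
      rw [← algebraMap_smul E.A c τ, map_smul, LinearMap.smul_apply, algebraMap_smul]) (by simp)
      (by
        intro c τ σ
        rw [← algebraMap_smul E.A c σ, map_smul, algebraMap_smul])
  ip_symm := 𝒜.ip_symm
  c_skew τ₁ τ₂ := by
    simp only [LinearMap.add_apply, LinearMap.mk₂_apply, 𝒜.c_skew τ₁ τ₂, ω.skew τ₁ τ₂]
    abel
  A1 := 𝒜.A1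
  A2 := 𝒜.A2
  A3 a τ₁ τ₂ := by
    simp only [LinearMap.add_apply, LinearMap.mk₂_apply, 𝒜.A3 a τ₁ τ₂, map_smul,
      LinearMap.smul_apply, smul_add]
    abel
  A4 τ₁ τ₂ τ₃ := by
    have e₁ := ω.skew' τ₃ τ₁ τ₂
    have e₂ := ω.skew' τ₂ τ₁ τ₃
    have e₃ := congrArg (E.pair τ₁) (ω.skew τ₃ τ₂)
    rw [map_neg] at e₃
    simp only [LinearMap.add_apply, LinearMap.mk₂_apply, 𝒜.A4 τ₁ τ₂ τ₃, map_add]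
    linear_combination -e₁ - e₂ + e₃
  A5 τ₁ τ₂ τ₃ := by
    have e := 𝒜.A5 τ₁ τ₂ τ₃
    have e' := ω.closed τ₁ τ₂ τ₃
    have e₁ : E.pair τ₁ (ω.val τ₂ τ₃) = E.pair τ₃ (ω.val τ₁ τ₂) := by
      rw [ω.skew τ₂ τ₃, map_neg, ω.skew' τ₁ τ₃ τ₂, neg_neg]
    rw [e₁, sub_eq_zero] at e'
    have e'' := congrArg₂ (· + ·) e e'
    simp only [dLie, LinearMap.add_apply, LinearMap.mk₂_apply, lie_add, map_add, map_sub, smul_add,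
      smul_sub, Derivation.map_smul, invOf_smul_smul] at e'' ⊢
    refine Eq.trans ?_ (e''.trans ?_) <;> abel

/-- The action of two-forms on morphisms, compatible with twisting. -/
theorem IsMor.twist {𝒜 ℬ : E.VertexAlgebroid} {h : E.T →ₗ[k] E.Ω} (H : IsMor 𝒜 ℬ h)
    {ω ω' : E.ClosedThreeForm} {η : E.TwoForm} (hη : E.dTwo η = ω' - ω) :
    IsMor (𝒜.twist ω) (ℬ.twist ω') (h + η.val.restrictScalars k) where
  gam a τ := by
    simp only [LinearMap.add_apply, LinearMap.restrictScalars_apply, map_smul, H.gam, smul_add,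
      VertexAlgebroid.twist]
    abel
  ip τ₁ τ₂ := by
    have e : E.pair τ₁ (η.val τ₂) = -E.pair τ₂ (η.val τ₁) := η.skew τ₁ τ₂
    simp only [LinearMap.add_apply, LinearMap.restrictScalars_apply, VertexAlgebroid.twist, H.ip,
      map_add, e]
    abel
  c τ₁ τ₂ := by
    have e : E.pair τ₁ (η.val τ₂) = -E.pair τ₂ (η.val τ₁) := η.skew τ₁ τ₂
    have e' : -η.val ⁅τ₁, τ₂⁆ + ⁅τ₁, η.val τ₂⁆ - ⁅τ₂, η.val τ₁⁆ - E.del (E.pair τ₁ (η.val τ₂))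
      = ω'.val τ₁ τ₂ - ω.val τ₁ τ₂ := congrArg (fun w : E.ClosedThreeForm => w.val τ₁ τ₂) hη
    have half : ∀ x : E.Ω, (⅟2 : k) • x + (⅟2 : k) • x = x := fun x => by
      rw [← add_smul, invOf_two_add_invOf_two, one_smul]
    rw [e, ← half (E.del _)] at e'
    rw [eq_sub_iff_add_eq] at e'
    simp only [LinearMap.add_apply, LinearMap.restrictScalars_apply, VertexAlgebroid.twist, H.c,
      LinearMap.mk₂_apply, map_add, lie_add, smul_add, e, ← e', map_neg, smul_neg]
    abel

end VertexAlgebroid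

end ExtLieAlgebroid

/-- A sheaf of extended Lie algebroids on a space `X`: with `A = 𝒪_X`, an extended Lie
`𝒪_X`-algebroid. -/
structure ExtLieSheaf (k : Type v) [CommRing k] (X : TopCat.{u}) where
  presheaf : TopCat.Presheaf (ExtLieAlgebroid.{u, v} k) X
  isSheaf_A : TopCat.Presheaf.IsSheaf (presheaf ⋙ ExtLieAlgebroid.forgetA)
  isSheaf_T : TopCat.Presheaf.IsSheaf (presheaf ⋙ ExtLieAlgebroid.forgetT)
  isSheaf_Ω : TopCat.Presheaf.IsSheaf (presheaf ⋙ ExtLieAlgebroid.forgetΩ)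

namespace ExtLieSheaf

variable {k : Type v} [CommRing k] {X : TopCat.{u}} (𝒯 : ExtLieSheaf.{u, v} k X)

/-- The extended Lie algebroid of sections over `U`. -/
abbrev sec (U : Opens X) : ExtLieAlgebroid.{u, v} k := 𝒯.presheaf.obj (op U)

/-- Restriction of sections. -/
def res {U V : Opens X} (h : V ≤ U) : ExtLieAlgebroid.Hom (𝒯.sec U) (𝒯.sec V) :=
  𝒯.presheaf.map (homOfLE h).op

section restriction

variable {U V W : Opens X}

theorem res_comp (hVU : V ≤ U) (hWV : W ≤ V) :
    𝒯.res (hWV.trans hVU) = (𝒯.presheaf.map (homOfLE hVU).op ≫ 𝒯.presheaf.map (homOfLE hWV).op :) := by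
  rw [← Functor.map_comp]; rfl

theorem res_res_A (hVU : V ≤ U) (hWV : W ≤ V) (a : (𝒯.sec U).A) :
    (𝒯.res hWV).onA ((𝒯.res hVU).onA a) = (𝒯.res (hWV.trans hVU)).onA a := by
  rw [res_comp 𝒯 hVU hWV]; rfl

theorem res_res_T (hVU : V ≤ U) (hWV : W ≤ V) (a : (𝒯.sec U).T) :
    (𝒯.res hWV).onT ((𝒯.res hVU).onT a) = (𝒯.res (hWV.trans hVU)).onT a := by
  rw [res_comp 𝒯 hVU hWV]; rfl

theorem res_res_Ω (hVU : V ≤ U) (hWV : W ≤ V) (a : (𝒯.sec U).Ω) :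
    (𝒯.res hWV).onΩ ((𝒯.res hVU).onΩ a) = (𝒯.res (hWV.trans hVU)).onΩ a := by
  rw [res_comp 𝒯 hVU hWV]; rfl

theorem res_self_T (h : U ≤ U) (a : (𝒯.sec U).T) : (𝒯.res h).onT a = a := by
  have : 𝒯.res h = 𝟙 (𝒯.sec U) := 𝒯.presheaf.map_id _
  rw [this]; rfl

theorem le_iSup_of_cover {κ : Type u} (W : κ → Opens X) (hcov : ∀ x ∈ V, ∃ j, x ∈ W j) :
    V ≤ iSup W := fun x hx => by
  obtain ⟨j, hj⟩ := hcov x hx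
  exact Opens.mem_iSup.2 ⟨j, hj⟩

theorem ext_Ω {κ : Type u} (W : κ → Opens X) (hW : ∀ j, W j ≤ V) (hcov : ∀ x ∈ V, ∃ j, x ∈ W j)
    (s t : (𝒯.sec V).Ω) (hst : ∀ j, (𝒯.res (hW j)).onΩ s = (𝒯.res (hW j)).onΩ t) : s = t :=
  TopCat.Sheaf.eq_of_locally_eq' ⟨_, 𝒯.isSheaf_Ω⟩ W V (fun j => homOfLE (hW j))
    (le_iSup_of_cover W hcov) s t hst

theorem ext_A {κ : Type u} (W : κ → Opens X) (hW : ∀ j, W j ≤ V) (hcov : ∀ x ∈ V, ∃ j, x ∈ W j)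
    (s t : (𝒯.sec V).A) (hst : ∀ j, (𝒯.res (hW j)).onA s = (𝒯.res (hW j)).onA t) : s = t :=
  TopCat.Sheaf.eq_of_locally_eq' ⟨_, 𝒯.isSheaf_A⟩ W V (fun j => homOfLE (hW j))
    (le_iSup_of_cover W hcov) s t hst

theorem glue_Ω {κ : Type u} (W : κ → Opens X) (hW : ∀ j, W j ≤ V) (hcov : ∀ x ∈ V, ∃ j, x ∈ W j)
    (s : ∀ j, (𝒯.sec (W j)).Ω)
    (hs : ∀ i j, (𝒯.res (inf_le_left : W i ⊓ W j ≤ W i)).onΩ (s i) =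
      (𝒯.res (inf_le_right : W i ⊓ W j ≤ W j)).onΩ (s j)) :
    ∃! t : (𝒯.sec V).Ω, ∀ j, (𝒯.res (hW j)).onΩ t = s j := by
  let F : TopCat.Sheaf (Type u) X := ⟨𝒯.presheaf ⋙ ExtLieAlgebroid.forgetΩ, 𝒯.isSheaf_Ω⟩
  have key := F.existsUnique_gluing' W V (fun j => homOfLE (hW j)) (le_iSup_of_cover W hcov)
    (sf := s) (fun i j => hs i j)
  exact key

end restriction

/-! ### Sheaves of forms and of homomorphisms -/

/-- `Hom_k(T, Ω)(U)`: the `k`-linear sheaf homomorphisms `T|_U → Ω|_U`. -/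
def locHomSubmodule (U : Opens X) :
    Submodule k (∀ V : Set.Iic U, (𝒯.sec V.1).T →ₗ[k] (𝒯.sec V.1).Ω) where
  carrier := {h | ∀ (V W : Set.Iic U) (hWV : W.1 ≤ V.1) (τ : (𝒯.sec V.1).T),
    (𝒯.res hWV).onΩ (h V τ) = h W ((𝒯.res hWV).onT τ)}
  add_mem' := by
    intro a b ha hb V W hWV τ
    simp only [Pi.add_apply, LinearMap.add_apply, map_add, ha V W hWV τ, hb V W hWV τ]
  zero_mem' := by intro V W hWV τ; simp
  smul_mem' := by
    intro c a ha V W hWV τ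
    simp only [Pi.smul_apply, LinearMap.smul_apply, map_smul, ha V W hWV τ]

/-- `Ω²(U)`: the sections over `U` of the sheaf of two-forms. -/
def form2Submodule (U : Opens X) : Submodule k (∀ V : Set.Iic U, (𝒯.sec V.1).TwoForm) where
  carrier := {h | ∀ (V W : Set.Iic U) (hWV : W.1 ≤ V.1) (τ : (𝒯.sec V.1).T),
    (𝒯.res hWV).onΩ ((h V).val τ) = (h W).val ((𝒯.res hWV).onT τ)}
  add_mem' := by
    intro a b ha hb V W hWV τ
    simp only [Pi.add_apply, ExtLieAlgebroid.TwoForm.add_val, LinearMap.add_apply, map_add, ha V W hWV τ,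
      hb V W hWV τ]
  zero_mem' := fun _ _ hWV _ => map_zero (𝒯.res hWV).onΩ
  smul_mem' := by
    intro c a ha V W hWV τ
    simp only [Pi.smul_apply, ExtLieAlgebroid.TwoForm.smul_val, LinearMap.smul_apply, map_smul, ha V W hWV τ]

/-- `Ω^{3,cl}(U)`: the sections over `U` of the sheaf of closed three-forms. -/
def form3Submodule (U : Opens X) : Submodule k (∀ V : Set.Iic U, (𝒯.sec V.1).ClosedThreeForm) where
  carrier := {h | ∀ (V W : Set.Iic U) (hWV : W.1 ≤ V.1) (τ σ : (𝒯.sec V.1).T),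
    (𝒯.res hWV).onΩ ((h V).val τ σ) = (h W).val ((𝒯.res hWV).onT τ) ((𝒯.res hWV).onT σ)}
  add_mem' := by
    intro a b ha hb V W hWV τ σ
    simp only [Pi.add_apply, ExtLieAlgebroid.ClosedThreeForm.add_val, LinearMap.add_apply, map_add, ha V W hWV τ σ,
      hb V W hWV τ σ]
  zero_mem' := fun _ _ hWV _ _ => map_zero (𝒯.res hWV).onΩ
  smul_mem' := by
    intro c a ha V W hWV τ σ
    simp only [Pi.smul_apply, ExtLieAlgebroid.ClosedThreeForm.smul_val, LinearMap.smul_apply, map_smul, ha V W hWV τ σ]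

/-- `Hom_k(T, Ω)(U)`: the `k`-linear sheaf homomorphisms `T|_U → Ω|_U`. -/
def LocHom (U : Opens X) : Type u := 𝒯.locHomSubmodule U

instance (U : Opens X) : AddCommGroup (𝒯.LocHom U) :=
  (𝒯.locHomSubmodule U).addCommGroup

instance (U : Opens X) : Module k (𝒯.LocHom U) :=
  (𝒯.locHomSubmodule U).module

/-- `Ω²(U)`: the sections over `U` of the sheaf of two-forms. -/
def Form2 (U : Opens X) : Type u := 𝒯.form2Submodule U

instance (U : Opens X) : AddCommGroup (𝒯.Form2 U) :=
  (𝒯.form2Submodule U).addCommGroup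

instance (U : Opens X) : Module k (𝒯.Form2 U) :=
  (𝒯.form2Submodule U).module

/-- `Ω^{3,cl}(U)`: the sections over `U` of the sheaf of closed three-forms. -/
def Form3 (U : Opens X) : Type u := 𝒯.form3Submodule U

instance (U : Opens X) : AddCommGroup (𝒯.Form3 U) :=
  (𝒯.form3Submodule U).addCommGroup

instance (U : Opens X) : Module k (𝒯.Form3 U) :=
  (𝒯.form3Submodule U).module

variable {𝒯} {U V W : Opens X}

/-- The homomorphism over `W ⊆ U`. -/
def LocHom.app (f : 𝒯.LocHom U) (W : Opens X) (h : W ≤ U) : (𝒯.sec W).T →ₗ[k] (𝒯.sec W).Ω :=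
  Subtype.val f (⟨W, h⟩ : Set.Iic U)

/-- The restriction of a two-form to `W ⊆ U`. -/
def Form2.app (f : 𝒯.Form2 U) (W : Opens X) (h : W ≤ U) : (𝒯.sec W).TwoForm :=
  Subtype.val f (⟨W, h⟩ : Set.Iic U)

/-- The restriction of a three-form to `W ⊆ U`. -/
def Form3.app (f : 𝒯.Form3 U) (W : Opens X) (h : W ≤ U) : (𝒯.sec W).ClosedThreeForm :=
  Subtype.val f (⟨W, h⟩ : Set.Iic U)

theorem LocHom.nat (f : 𝒯.LocHom U) (hV : V ≤ U) (hWV : W ≤ V) (τ : (𝒯.sec V).T) :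
    (𝒯.res hWV).onΩ (f.app V hV τ) = f.app W (hWV.trans hV) ((𝒯.res hWV).onT τ) :=
  Subtype.property f (⟨V, hV⟩ : Set.Iic U) (⟨W, hWV.trans hV⟩ : Set.Iic U) hWV τ

theorem Form2.nat (f : 𝒯.Form2 U) (hV : V ≤ U) (hWV : W ≤ V) (τ : (𝒯.sec V).T) :
    (𝒯.res hWV).onΩ ((f.app V hV).val τ) = (f.app W (hWV.trans hV)).val ((𝒯.res hWV).onT τ) :=
  Subtype.property f (⟨V, hV⟩ : Set.Iic U) (⟨W, hWV.trans hV⟩ : Set.Iic U) hWV τ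

theorem Form3.nat (f : 𝒯.Form3 U) (hV : V ≤ U) (hWV : W ≤ V) (τ σ : (𝒯.sec V).T) :
    (𝒯.res hWV).onΩ ((f.app V hV).val τ σ) =
      (f.app W (hWV.trans hV)).val ((𝒯.res hWV).onT τ) ((𝒯.res hWV).onT σ) :=
  Subtype.property f (⟨V, hV⟩ : Set.Iic U) (⟨W, hWV.trans hV⟩ : Set.Iic U) hWV τ σ

theorem LocHom.ext {f g : 𝒯.LocHom U} (h : ∀ W hW, f.app W hW = g.app W hW) : f = g :=
  Subtype.ext (funext fun W => h W.1 W.2)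

theorem LocHom.add_app (f g : 𝒯.LocHom U) (h : W ≤ U) :
    (f + g).app W h = f.app W h + g.app W h := rfl

theorem LocHom.neg_app (f : 𝒯.LocHom U) (h : W ≤ U) : (-f).app W h = -f.app W h := rfl

/-- A compatible family of homomorphisms as an element of `Hom_k(T, Ω)(U)`. -/
def LocHom.mk (f : ∀ W : Opens X, W ≤ U → ((𝒯.sec W).T →ₗ[k] (𝒯.sec W).Ω))
    (hf : ∀ (V W : Opens X) (hV : V ≤ U) (hWV : W ≤ V) (τ : (𝒯.sec V).T),
      (𝒯.res hWV).onΩ (f V hV τ) = f W (hWV.trans hV) ((𝒯.res hWV).onT τ)) : 𝒯.LocHom U :=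
  (⟨fun W => f W.1 W.2, fun V W hWV τ => hf V.1 W.1 V.2 hWV τ⟩ : 𝒯.locHomSubmodule U)

/-- Restriction of two-forms. -/
def Form2.res (h : V ≤ U) : 𝒯.Form2 U →ₗ[k] 𝒯.Form2 V where
  toFun f := (⟨fun W => f.app W.1 (le_trans W.2 h), fun W _ hWW' τ => f.nat (le_trans W.2 h) hWW' τ⟩ :
    𝒯.form2Submodule V)
  map_add' _ _ := rfl
  map_smul' _ _ := rfl

/-- Restriction of closed three-forms. -/
def Form3.res (h : V ≤ U) : 𝒯.Form3 U →ₗ[k] 𝒯.Form3 V where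
  toFun f := (⟨fun W => f.app W.1 (le_trans W.2 h),
    fun W _ hWW' τ σ => f.nat (le_trans W.2 h) hWW' τ σ⟩ : 𝒯.form3Submodule V)
  map_add' _ _ := rfl
  map_smul' _ _ := rfl

/-- A two-form as a `k`-linear homomorphism `T → Ω`. -/
def Form2.toLocHom (f : 𝒯.Form2 U) : 𝒯.LocHom U :=
  LocHom.mk (fun W h => (f.app W h).val.restrictScalars k) fun _ _ hV hWV τ => f.nat hV hWV τ

variable (𝒯) in
/-- The differential `d : Ω²(U) → Ω^{3,cl}(U)`. -/
def d (U : Opens X) : 𝒯.Form2 U →ₗ[k] 𝒯.Form3 U where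
  toFun f := (⟨fun W => (𝒯.sec W.1).dTwo (f.app W.1 W.2), fun V W hWV τ σ => by
    have e := fun τ => f.nat V.2 hWV τ
    change (𝒯.res hWV).onΩ (-(f.app V.1 V.2).val ⁅τ, σ⁆ + ⁅τ, (f.app V.1 V.2).val σ⁆
        - ⁅σ, (f.app V.1 V.2).val τ⁆
        - (𝒯.sec V.1).del ((𝒯.sec V.1).pair τ ((f.app V.1 V.2).val σ))) =
      -(f.app W.1 W.2).val ⁅(𝒯.res hWV).onT τ, (𝒯.res hWV).onT σ⁆
        + ⁅(𝒯.res hWV).onT τ, (f.app W.1 W.2).val ((𝒯.res hWV).onT σ)⁆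
        - ⁅(𝒯.res hWV).onT σ, (f.app W.1 W.2).val ((𝒯.res hWV).onT τ)⁆
        - (𝒯.sec W.1).del ((𝒯.sec W.1).pair ((𝒯.res hWV).onT τ)
            ((f.app W.1 W.2).val ((𝒯.res hWV).onT σ)))
    simp only [map_add, map_sub, map_neg, (𝒯.res hWV).map_lie_Ω, (𝒯.res hWV).map_del,
      (𝒯.res hWV).map_pair, ← LieHom.map_lie, e]⟩ : 𝒯.form3Submodule U)
  map_add' f g :=
    Subtype.ext (funext fun W => (𝒯.sec W.1).dTwo.map_add (f.app W.1 W.2) (g.app W.1 W.2))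
  map_smul' c f :=
    Subtype.ext (funext fun W => (𝒯.sec W.1).dTwo.map_smul c (f.app W.1 W.2))

/-! ### Čech hypercohomology of `Ω^{[2,3⟩} : Ω² → Ω^{3,cl}` (with `Ω²` in degree zero) -/

section cech

variable (𝒯) {ι κ : Type u} (U : ι → Opens X)

/-- Čech zero-cochains. -/
abbrev C0 := ∀ i, 𝒯.Form2 (U i)

/-- Čech one-cochains `(ω_i, η_ij)`. -/
abbrev C1 := (∀ i, 𝒯.Form3 (U i)) × ∀ i j, 𝒯.Form2 (U i ⊓ U j)

/-- Čech two-cochains `(ω_ij, η_ijl)`. -/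
abbrev C2 := (∀ i j, 𝒯.Form3 (U i ⊓ U j)) × ∀ i j l, 𝒯.Form2 (U i ⊓ U j ⊓ U l)

/-- Čech three-cochains `(ω_ijl, η_ijlm)`. -/
abbrev C3 := (∀ i j l, 𝒯.Form3 (U i ⊓ U j ⊓ U l)) × ∀ i j l m, 𝒯.Form2 (U i ⊓ U j ⊓ U l ⊓ U m)

/-- `η ↦ (dη_i, η_j - η_i)`. -/
def D0 : 𝒯.C0 U →ₗ[k] 𝒯.C1 U where
  toFun η := (fun i => 𝒯.d _ (η i),
    fun i j => Form2.res inf_le_right (η j) - Form2.res inf_le_left (η i))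
  map_add' a b := by
    ext1
    · funext i; exact map_add _ _ _
    · funext i j
      simp only [Pi.add_apply, Prod.snd_add, map_add]; abel
  map_smul' c a := by
    ext1
    · funext i; exact (𝒯.d _).map_smul _ _
    · funext i j
      simp only [Pi.smul_apply, Prod.smul_snd, map_smul, RingHom.id_apply]
      rw [smul_sub]

/-- `(ω, η) ↦ (dη_ij - (ω_j - ω_i), η_jl - η_il + η_ij)`. -/
def D1 : 𝒯.C1 U →ₗ[k] 𝒯.C2 U where
  toFun z := (fun i j => 𝒯.d _ (z.2 i j)
      - (Form3.res inf_le_right (z.1 j) - Form3.res inf_le_left (z.1 i)),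
    fun i j l => Form2.res (le_inf (inf_le_left.trans inf_le_right) inf_le_right) (z.2 j l)
      - Form2.res (le_inf (inf_le_left.trans inf_le_left) inf_le_right) (z.2 i l)
      + Form2.res inf_le_left (z.2 i j))
  map_add' a b := by
    ext1
    · funext i j
      simp only [Pi.add_apply, Prod.fst_add, Prod.snd_add, map_add]; abel
    · funext i j l
      simp only [Pi.add_apply, Prod.snd_add, map_add]; abel
  map_smul' c a := by
    ext1
    · funext i j
      simp only [Pi.smul_apply, Prod.smul_fst, Prod.smul_snd, map_smul, RingHom.id_apply, smul_sub]
    · funext i j l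
      simp only [Pi.smul_apply, Prod.smul_snd, map_smul, RingHom.id_apply, smul_sub, smul_add]

/-- `(ω, η) ↦ (dη_ijl - (ω_jl - ω_il + ω_ij), η_jlm - η_ilm + η_ijm - η_ijl)`. -/
def D2 : 𝒯.C2 U →ₗ[k] 𝒯.C3 U where
  toFun z := (fun i j l => 𝒯.d _ (z.2 i j l)
      - (Form3.res (le_inf (inf_le_left.trans inf_le_right) inf_le_right) (z.1 j l)
        - Form3.res (le_inf (inf_le_left.trans inf_le_left) inf_le_right) (z.1 i l)
        + Form3.res inf_le_left (z.1 i j)),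
    fun i j l m =>
      Form2.res (le_inf (le_inf ((inf_le_left.trans inf_le_left).trans inf_le_right)
        (inf_le_left.trans inf_le_right)) inf_le_right) (z.2 j l m)
      - Form2.res (le_inf (le_inf ((inf_le_left.trans inf_le_left).trans inf_le_left)
        (inf_le_left.trans inf_le_right)) inf_le_right) (z.2 i l m)
      + Form2.res (le_inf (inf_le_left.trans inf_le_left) inf_le_right) (z.2 i j m)
      - Form2.res inf_le_left (z.2 i j l))
  map_add' a b := by
    ext1
    · funext i j l
      simp only [Pi.add_apply, Prod.fst_add, Prod.snd_add, map_add]; abel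
    · funext i j l m
      simp only [Pi.add_apply, Prod.snd_add, map_add]; abel
  map_smul' c a := by
    ext1
    · funext i j l
      simp only [Pi.smul_apply, Prod.smul_fst, Prod.smul_snd, map_smul, RingHom.id_apply, smul_sub,
        smul_add]
    · funext i j l m
      simp only [Pi.smul_apply, Prod.smul_snd, map_smul, RingHom.id_apply, smul_sub, smul_add]

/-- First Čech hypercohomology of the family `U`. -/
def CechH1 : Type u :=
  LinearMap.ker (𝒯.D1 U) ⧸ (LinearMap.range (𝒯.D0 U)).submoduleOf (LinearMap.ker (𝒯.D1 U))

instance : AddCommGroup (𝒯.CechH1 U) :=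
  inferInstanceAs (AddCommGroup (LinearMap.ker (𝒯.D1 U) ⧸
    (LinearMap.range (𝒯.D0 U)).submoduleOf (LinearMap.ker (𝒯.D1 U))))

instance : Module k (𝒯.CechH1 U) :=
  inferInstanceAs (Module k (LinearMap.ker (𝒯.D1 U) ⧸
    (LinearMap.range (𝒯.D0 U)).submoduleOf (LinearMap.ker (𝒯.D1 U))))

/-- The cohomology class of a cocycle. -/
def CechH1.mk : LinearMap.ker (𝒯.D1 U) →ₗ[k] 𝒯.CechH1 U :=
  ((LinearMap.range (𝒯.D0 U)).submoduleOf (LinearMap.ker (𝒯.D1 U))).mkQ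

/-- Second Čech hypercohomology of the family `U`. -/
def CechH2 : Type u :=
  LinearMap.ker (𝒯.D2 U) ⧸ (LinearMap.range (𝒯.D1 U)).submoduleOf (LinearMap.ker (𝒯.D2 U))

instance : AddCommGroup (𝒯.CechH2 U) :=
  inferInstanceAs (AddCommGroup (LinearMap.ker (𝒯.D2 U) ⧸
    (LinearMap.range (𝒯.D1 U)).submoduleOf (LinearMap.ker (𝒯.D2 U))))

instance : Module k (𝒯.CechH2 U) :=
  inferInstanceAs (Module k (LinearMap.ker (𝒯.D2 U) ⧸
    (LinearMap.range (𝒯.D1 U)).submoduleOf (LinearMap.ker (𝒯.D2 U))))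

/-- The cohomology class of a cocycle. -/
def CechH2.mk : LinearMap.ker (𝒯.D2 U) →ₗ[k] 𝒯.CechH2 U :=
  ((LinearMap.range (𝒯.D1 U)).submoduleOf (LinearMap.ker (𝒯.D2 U))).mkQ

variable {U} {V : κ → Opens X} (r : κ → ι) (h : ∀ a, V a ≤ U (r a))

/-- Pullback of cochains along a refinement. -/
def pull0 : 𝒯.C0 U →ₗ[k] 𝒯.C0 V where
  toFun η a := Form2.res (h a) (η (r a))
  map_add' _ _ := rfl
  map_smul' _ _ := rfl

/-- Pullback of cochains along a refinement. -/
def pull1 : 𝒯.C1 U →ₗ[k] 𝒯.C1 V where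
  toFun z := (fun a => Form3.res (h a) (z.1 (r a)),
    fun a b => Form2.res (inf_le_inf (h a) (h b)) (z.2 (r a) (r b)))
  map_add' _ _ := rfl
  map_smul' _ _ := rfl

/-- Pullback of cochains along a refinement. -/
def pull2 : 𝒯.C2 U →ₗ[k] 𝒯.C2 V where
  toFun z := (fun a b => Form3.res (inf_le_inf (h a) (h b)) (z.1 (r a) (r b)),
    fun a b c => Form2.res (inf_le_inf (inf_le_inf (h a) (h b)) (h c)) (z.2 (r a) (r b) (r c)))
  map_add' _ _ := rfl
  map_smul' _ _ := rfl

/-- Pullback of cochains along a refinement. -/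
def pull3 : 𝒯.C3 U →ₗ[k] 𝒯.C3 V where
  toFun z := (fun a b c => Form3.res (inf_le_inf (inf_le_inf (h a) (h b)) (h c))
      (z.1 (r a) (r b) (r c)),
    fun a b c e => Form2.res (inf_le_inf (inf_le_inf (inf_le_inf (h a) (h b)) (h c)) (h e))
      (z.2 (r a) (r b) (r c) (r e)))
  map_add' _ _ := rfl
  map_smul' _ _ := rfl

theorem pull1_mem {z : 𝒯.C1 U} (hz : z ∈ LinearMap.ker (𝒯.D1 U)) :
    𝒯.pull1 r h z ∈ LinearMap.ker (𝒯.D1 V) := by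
  have e : 𝒯.D1 V (𝒯.pull1 r h z) = 𝒯.pull2 r h (𝒯.D1 U z) := rfl
  rw [LinearMap.mem_ker] at hz ⊢
  rw [e, hz, map_zero]

theorem pull2_mem {z : 𝒯.C2 U} (hz : z ∈ LinearMap.ker (𝒯.D2 U)) :
    𝒯.pull2 r h z ∈ LinearMap.ker (𝒯.D2 V) := by
  have e : 𝒯.D2 V (𝒯.pull2 r h z) = 𝒯.pull3 r h (𝒯.D2 U z) := rfl
  rw [LinearMap.mem_ker] at hz ⊢
  rw [e, hz, map_zero]

/-- Pullback along a refinement in degree one. -/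
def pullH1 : 𝒯.CechH1 U →ₗ[k] 𝒯.CechH1 V :=
  Submodule.mapQ _ _ ((𝒯.pull1 r h).restrict fun _ hz => 𝒯.pull1_mem r h hz) (by
    rintro ⟨z, hz⟩ ⟨y, hy⟩
    exact ⟨𝒯.pull0 r h y, congrArg (𝒯.pull1 r h) hy⟩)

/-- Pullback along a refinement in degree two. -/
def pullH2 : 𝒯.CechH2 U →ₗ[k] 𝒯.CechH2 V :=
  Submodule.mapQ _ _ ((𝒯.pull2 r h).restrict fun _ hz => 𝒯.pull2_mem r h hz) (by
    rintro ⟨z, hz⟩ ⟨y, hy⟩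
    exact ⟨𝒯.pull1 r h y, congrArg (𝒯.pull2 r h) hy⟩)

end cech

/-- Open covers of `X` given by a choice of an open neighbourhood of each point (these are cofinal
among all open covers), ordered by refinement. -/
abbrev PointCover (X : TopCat.{u}) : Type u := {U : X → Opens X // ∀ x, x ∈ U x}ᵒᵈ

/-- `H⁰(X; Ω^{[2,3⟩})`: the globally defined closed two-forms. -/
abbrev H0 (𝒯 : ExtLieSheaf.{u, v} k X) : Type u := LinearMap.ker (𝒯.d ⊤)

theorem PointCover.le_apply {𝒰 𝒱 : PointCover X} (h : 𝒰 ≤ 𝒱) (x : X) :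
    𝒱.ofDual.1 x ≤ 𝒰.ofDual.1 x := h x

variable (𝒯)

/-- The transition maps of the direct system `𝒰 ↦ Ȟ¹(𝒰)`. -/
def transH1 (𝒰 𝒱 : PointCover X) (h : 𝒰 ≤ 𝒱) :
    𝒯.CechH1 𝒰.ofDual.1 →ₗ[k] 𝒯.CechH1 𝒱.ofDual.1 :=
  𝒯.pullH1 id (PointCover.le_apply h)

/-- The transition maps of the direct system `𝒰 ↦ Ȟ²(𝒰)`. -/
def transH2 (𝒰 𝒱 : PointCover X) (h : 𝒰 ≤ 𝒱) :
    𝒯.CechH2 𝒰.ofDual.1 →ₗ[k] 𝒯.CechH2 𝒱.ofDual.1 :=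
  𝒯.pullH2 id (PointCover.le_apply h)

open Classical in
/-- `H¹(X; Ω^{[2,3⟩})`, the colimit of `Ȟ¹(𝒰)` over all open covers. -/
abbrev H1 : Type u := Module.DirectLimit (fun 𝒰 : PointCover X => 𝒯.CechH1 𝒰.ofDual.1) 𝒯.transH1

open Classical in
/-- `H²(X; Ω^{[2,3⟩})`, the colimit of `Ȟ²(𝒰)` over all open covers. -/
abbrev H2 : Type u := Module.DirectLimit (fun 𝒰 : PointCover X => 𝒯.CechH2 𝒰.ofDual.1) 𝒯.transH2

section classes

variable {𝒯} {ι : Type u} (U : ι → Opens X) (r : X → ι) (hr : ∀ x, x ∈ U (r x))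

open Classical in
/-- The class of a one-cocycle on an open cover `U`; `r` exhibits that `U` covers `X`. -/
noncomputable def H1.mk : LinearMap.ker (𝒯.D1 U) →ₗ[k] 𝒯.H1 :=
  (Module.DirectLimit.of k (PointCover X) (fun 𝒰 : PointCover X => 𝒯.CechH1 𝒰.ofDual.1) 𝒯.transH1
      (OrderDual.toDual ⟨fun x => U (r x), hr⟩)).comp
    ((𝒯.pullH1 r fun _ => le_rfl).comp (CechH1.mk 𝒯 U))

open Classical in
/-- The class of a two-cocycle on an open cover `U`; `r` exhibits that `U` covers `X`. -/
noncomputable def H2.mk : LinearMap.ker (𝒯.D2 U) →ₗ[k] 𝒯.H2 :=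
  (Module.DirectLimit.of k (PointCover X) (fun 𝒰 : PointCover X => 𝒯.CechH2 𝒰.ofDual.1) 𝒯.transH2
      (OrderDual.toDual ⟨fun x => U (r x), hr⟩)).comp
    ((𝒯.pullH2 r fun _ => le_rfl).comp (CechH2.mk 𝒯 U))

end classes

/-! ### Regularity and local frames -/

/-- A basis of `T` over `U`: a family of sections over `U` whose restrictions to each open `V ⊆ U`
form a basis of the `A(V)`-module `T(V)`. -/
structure Frame (U : Opens X) (n : ℕ) where
  /-- the basis of `T(V)` -/
  basis : ∀ V : Opens X, V ≤ U → Module.Basis (Fin n) (𝒯.sec V).A (𝒯.sec V).T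
  nat : ∀ {V W : Opens X} (hV : V ≤ U) (hWV : W ≤ V) (a : Fin n),
    (𝒯.res hWV).onT (basis V hV a) = basis W (hWV.trans hV) a

/-- Regularity: locally on `X`, the extended Lie algebroid is perfect and `T` has a finite basis of
pairwise commuting sections. -/
def IsRegular : Prop :=
  ∀ x : X, ∃ U : Opens X, x ∈ U ∧ (∀ V ≤ U, (𝒯.sec V).IsPerfect) ∧
    ∃ (n : ℕ) (b : 𝒯.Frame U n), ∀ a a' : Fin n, ⁅b.basis U le_rfl a, b.basis U le_rfl a'⁆ = 0

/-- A trivialization of the locally free sheaf `T` over some open cover. -/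
structure LocalFrames where
  ι : Type u
  U : ι → Opens X
  cover : ∀ x, ∃ i, x ∈ U i
  n : ι → ℕ
  frame : ∀ i, 𝒯.Frame (U i) (n i)

variable {𝒯}

/-- The transition matrix `φ_ij`, defined by `τ^(j)_a = ∑_b φ_ij^{ab} τ^(i)_b`, over an open subset
`W` of `U i ∩ U j`. The inverse of `φ_ij` is `φ_ji`. -/
noncomputable def LocalFrames.trans (F : 𝒯.LocalFrames) (i j : F.ι) {W : Opens X}
    (hi : W ≤ F.U i) (hj : W ≤ F.U j) : Matrix (Fin (F.n j)) (Fin (F.n i)) (𝒯.sec W).A :=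
  Matrix.of fun a b => ((F.frame i).basis W hi).repr ((F.frame j).basis W hj a) b

/-- The action of a vector field on matrices of functions, entry by entry. -/
def lieMatrix {W : Opens X} {m n : ℕ} (τ : (𝒯.sec W).T)
    (M : Matrix (Fin m) (Fin n) (𝒯.sec W).A) : Matrix (Fin m) (Fin n) (𝒯.sec W).A :=
  M.map fun a => ⁅τ, a⁆

section vertex

variable [Invertible (2 : k)]

/-- The Atiyah–Chern–Simons cocycle `(α, β)` of a trivialization of `T`, with transition matrices
`φ_ij`, is
`β_ij(τ₁, τ₂, τ₃) = ½ tr(ABC - BAC)` with `A, B, C = φ_ij⁻¹ τ_s(φ_ij)` for `s = 1, 2, 3`, and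
`α_ijl(τ, τ') = ½ tr(P(τ) Q(τ') - P(τ') Q(τ))` with `P(τ) = φ_jl⁻¹ τ(φ_jl)` and
`Q(τ) = τ(φ_ij) φ_ij⁻¹`.
Forms are evaluated through the pairing: `β(τ₁, τ₂, τ₃) = ⟨τ₃, β(τ₁, τ₂)⟩` and
`α(τ, τ') = ⟨τ', α(τ)⟩`. -/
structure LocalFrames.IsACSCocycle (F : 𝒯.LocalFrames) (z : 𝒯.C2 F.U) : Prop where
  cocycle : z ∈ LinearMap.ker (𝒯.D2 F.U)
  beta : ∀ (i j : F.ι) (W : Opens X) (hi : W ≤ F.U i) (hj : W ≤ F.U j) (τ₁ τ₂ τ₃ : (𝒯.sec W).T),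
    algebraMap k (𝒯.sec W).A 2 *
      (𝒯.sec W).pair τ₃ (((z.1 i j).app W (le_inf hi hj)).val τ₁ τ₂) =
    Matrix.trace
      ((F.trans j i hj hi * lieMatrix τ₁ (F.trans i j hi hj))
        * (F.trans j i hj hi * lieMatrix τ₂ (F.trans i j hi hj))
        * (F.trans j i hj hi * lieMatrix τ₃ (F.trans i j hi hj))
      - (F.trans j i hj hi * lieMatrix τ₂ (F.trans i j hi hj))
        * (F.trans j i hj hi * lieMatrix τ₁ (F.trans i j hi hj))
        * (F.trans j i hj hi * lieMatrix τ₃ (F.trans i j hi hj)))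
  alpha : ∀ (i j l : F.ι) (W : Opens X) (hi : W ≤ F.U i) (hj : W ≤ F.U j) (hl : W ≤ F.U l)
    (τ τ' : (𝒯.sec W).T),
    algebraMap k (𝒯.sec W).A 2 *
      (𝒯.sec W).pair τ' (((z.2 i j l).app W (le_inf (le_inf hi hj) hl)).val τ) =
    Matrix.trace
      ((F.trans l j hl hj * lieMatrix τ (F.trans j l hj hl))
        * (lieMatrix τ' (F.trans i j hi hj) * F.trans j i hj hi)
      - (F.trans l j hl hj * lieMatrix τ' (F.trans j l hj hl))
        * (lieMatrix τ (F.trans i j hi hj) * F.trans j i hj hi))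

/-- `c` is the class of the Atiyah–Chern–Simons cocycle of the trivialization `F`. -/
def LocalFrames.HasClass (F : 𝒯.LocalFrames) (c : 𝒯.H2) : Prop :=
  ∃ (z : 𝒯.C2 F.U) (hz : F.IsACSCocycle z),
    ∀ (r : X → F.ι) (hr : ∀ x, x ∈ F.U (r x)), H2.mk F.U r hr ⟨z, hz.cocycle⟩ = c

variable (𝒯) in
/-- `ch` is the second Atiyah–Chern–Simons class `ch₂` of `T`: twice it is the class of the
Atiyah–Chern–Simons cocycle of any trivialization of `T`. -/
def IsCh2 (ch : 𝒯.H2) : Prop :=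
  Nonempty 𝒯.LocalFrames ∧ ∀ F : 𝒯.LocalFrames, F.HasClass ((2 : k) • ch)

/-! ### The gerbe of vertex algebroids and its characteristic class -/

variable (𝒯) in
/-- A vertex algebroid over `U`: a vertex algebroid structure on the sections over each open
`W ⊆ U`, compatible with restriction. -/
structure LocVA (U : Opens X) where
  /-- the structure over `W` -/
  app : ∀ W : Opens X, W ≤ U → (𝒯.sec W).VertexAlgebroid
  res_gam : ∀ {V W : Opens X} (hV : V ≤ U) (hWV : W ≤ V) (a : (𝒯.sec V).A) (τ : (𝒯.sec V).T),
    (𝒯.res hWV).onΩ ((app V hV).gam a τ) =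
      (app W (hWV.trans hV)).gam ((𝒯.res hWV).onA a) ((𝒯.res hWV).onT τ)
  res_ip : ∀ {V W : Opens X} (hV : V ≤ U) (hWV : W ≤ V) (τ₁ τ₂ : (𝒯.sec V).T),
    (𝒯.res hWV).onA ((app V hV).ip τ₁ τ₂) =
      (app W (hWV.trans hV)).ip ((𝒯.res hWV).onT τ₁) ((𝒯.res hWV).onT τ₂)
  res_c : ∀ {V W : Opens X} (hV : V ≤ U) (hWV : W ≤ V) (τ₁ τ₂ : (𝒯.sec V).T),
    (𝒯.res hWV).onΩ ((app V hV).c τ₁ τ₂) =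
      (app W (hWV.trans hV)).c ((𝒯.res hWV).onT τ₁) ((𝒯.res hWV).onT τ₂)

/-- `𝒜 ∔ ω` for a vertex algebroid `𝒜` over `U` and a closed three-form `ω` over `U`. -/
def LocVA.twist {U : Opens X} (𝒜 : 𝒯.LocVA U) (ω : 𝒯.Form3 U) : 𝒯.LocVA U where
  app W hW := (𝒜.app W hW).twist (ω.app W hW)
  res_gam := 𝒜.res_gam
  res_ip := 𝒜.res_ip
  res_c hV hWV τ₁ τ₂ := by
    change (𝒯.res hWV).onΩ ((𝒜.app _ _).c τ₁ τ₂ + (ω.app _ _).val τ₁ τ₂) =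
      (𝒜.app _ _).c _ _ + (ω.app _ _).val _ _
    rw [map_add, 𝒜.res_c, ω.nat]

variable (𝒯) in
/-- Local data presenting the gerbe of vertex algebroids: vertex algebroids `𝒜_i` over the members
of an open cover, and closed three-forms `ω_ij` with isomorphisms `h_ij : 𝒜_j → 𝒜_i ∔ ω_ij` over
the intersections. -/
structure GerbePresentation where
  ι : Type u
  U : ι → Opens X
  cover : ∀ x, ∃ i, x ∈ U i
  obj : ∀ i, 𝒯.LocVA (U i)
  ω : ∀ i j, 𝒯.Form3 (U i ⊓ U j)
  h : ∀ i j, 𝒯.LocHom (U i ⊓ U j)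
  isMor : ∀ (i j : ι) (W : Opens X) (hi : W ≤ U i) (hj : W ≤ U j),
    ((obj j).app W hj).IsMor (((obj i).app W hi).twist ((ω i j).app W (le_inf hi hj)))
      ((h i j).app W (le_inf hi hj))

/-- The two-cochain of a presentation is `(ω_ij, h_ij + h_jl - h_il)`: the obstruction to
`h_ij h_jl = h_il`. -/
structure GerbePresentation.IsCocycle (G : 𝒯.GerbePresentation) (z : 𝒯.C2 G.U) : Prop where
  cocycle : z ∈ LinearMap.ker (𝒯.D2 G.U)
  omega : ∀ i j, z.1 i j = G.ω i j
  eta : ∀ (i j l : G.ι) (W : Opens X) (hi : W ≤ G.U i) (hj : W ≤ G.U j) (hl : W ≤ G.U l)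
    (τ : (𝒯.sec W).T),
    ((z.2 i j l).app W (le_inf (le_inf hi hj) hl)).val τ =
      (G.h i j).app W (le_inf hi hj) τ + (G.h j l).app W (le_inf hj hl) τ
        - (G.h i l).app W (le_inf hi hl) τ

/-- `c` is the class of the two-cocycle of the presentation `G`. -/
def GerbePresentation.HasClass (G : 𝒯.GerbePresentation) (c : 𝒯.H2) : Prop :=
  ∃ (z : 𝒯.C2 G.U) (hz : G.IsCocycle z),
    ∀ (r : X → G.ι) (hr : ∀ x, x ∈ G.U (r x)), H2.mk G.U r hr ⟨z, hz.cocycle⟩ = c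

variable (𝒯) in
/-- `c` is the characteristic class of the gerbe of vertex algebroids: the class of each of its
presentations. -/
def IsCharacteristicClass (c : 𝒯.H2) : Prop :=
  Nonempty 𝒯.GerbePresentation ∧ ∀ G : 𝒯.GerbePresentation, G.HasClass c

end vertex

/-! ### Gluing -/

section gluing

variable {U : Opens X} {κ : Type u} (N : κ → Opens X)

theorem LocHom.eq_of_cover {f g : 𝒯.LocHom U} (hN : ∀ x ∈ U, ∃ j, x ∈ N j)
    (h : ∀ j (W : Opens X) (hW : W ≤ U), W ≤ N j → f.app W hW = g.app W hW) : f = g := by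
  refine LocHom.ext fun W hW => LinearMap.ext fun τ => ?_
  refine 𝒯.ext_Ω (fun j => W ⊓ N j) (fun _ => inf_le_left) (fun x hx => ?_) _ _ fun j => ?_
  · obtain ⟨j, hj⟩ := hN x (hW hx)
    exact ⟨j, hx, hj⟩
  · rw [f.nat hW, g.nat hW, h j _ _ inf_le_right]

/-- Restriction of homomorphisms. -/
def LocHom.res {V : Opens X} (f : 𝒯.LocHom U) (h : V ≤ U) : 𝒯.LocHom V :=
  LocHom.mk (fun W hW => f.app W (hW.trans h)) fun _ _ hV hWV τ => f.nat (hV.trans h) hWV τ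

theorem LocHom.app_eq_of_cover {f g : 𝒯.LocHom U} (hN : ∀ x ∈ U, ∃ j, x ∈ N j)
    (h : ∀ j (W : Opens X) (hW : W ≤ U), W ≤ N j → f.app W hW = g.app W hW) :
    f.app U le_rfl = g.app U le_rfl := by
  rw [LocHom.eq_of_cover N hN h]

theorem LocHom.exists_glue (hN : ∀ x ∈ U, ∃ j, x ∈ N j)
    (f : ∀ (j : κ) (W : Opens X), W ≤ U → W ≤ N j → ((𝒯.sec W).T →ₗ[k] (𝒯.sec W).Ω))
    (nat : ∀ (j : κ) (V W : Opens X) (hU : V ≤ U) (hV : V ≤ N j) (hWV : W ≤ V) (τ : (𝒯.sec V).T),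
      (𝒯.res hWV).onΩ (f j V hU hV τ) =
        f j W (hWV.trans hU) (hWV.trans hV) ((𝒯.res hWV).onT τ))
    (agree : ∀ (j j' : κ) (W : Opens X) (hU : W ≤ U) (hj : W ≤ N j) (hj' : W ≤ N j'),
      f j W hU hj = f j' W hU hj') :
    ∃ g : 𝒯.LocHom U, ∀ (j : κ) (W : Opens X) (hU : W ≤ U) (hj : W ≤ N j),
      g.app W hU = f j W hU hj := by
  have key : ∀ (W : Opens X) (hW : W ≤ U) (τ : (𝒯.sec W).T), ∃! t : (𝒯.sec W).Ω,
      ∀ j, (𝒯.res (inf_le_left : W ⊓ N j ≤ W)).onΩ t =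
        f j (W ⊓ N j) (inf_le_left.trans hW) inf_le_right ((𝒯.res inf_le_left).onT τ) := by
    intro W hW τ
    refine 𝒯.glue_Ω (fun j => W ⊓ N j) (fun _ => inf_le_left) (fun x hx => ?_) _ fun i j => ?_
    · obtain ⟨j, hj⟩ := hN x (hW hx)
      exact ⟨j, hx, hj⟩
    · rw [nat, nat, res_res_T, res_res_T]
      exact LinearMap.congr_fun (agree i j _ _ _ _) _
  choose t ht using fun W hW τ => (key W hW τ).exists
  have uniq : ∀ W hW τ s, (∀ j, (𝒯.res (inf_le_left : W ⊓ N j ≤ W)).onΩ s =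
        f j (W ⊓ N j) (inf_le_left.trans hW) inf_le_right ((𝒯.res inf_le_left).onT τ)) →
        t W hW τ = s :=
    fun W hW τ s hs => (key W hW τ).unique (ht W hW τ) hs
  refine ⟨LocHom.mk (fun W hW =>
    { toFun := t W hW
      map_add' := fun a b => uniq _ _ _ _ fun j => by rw [map_add, ht, ht, map_add, map_add]
      map_smul' := fun c a => uniq _ _ _ _ fun j => by
        rw [RingHom.id_apply, map_smul, ht, map_smul, map_smul] }) ?_, ?_⟩
  · intro V W hV hWV τ
    refine (uniq _ _ _ _ fun j => ?_).symm
    change (𝒯.res _).onΩ ((𝒯.res hWV).onΩ (t V hV τ)) = _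
    rw [res_res_Ω, ← res_res_Ω 𝒯 (inf_le_left : V ⊓ N j ≤ V)
      (le_inf (inf_le_left.trans hWV) inf_le_right), ht, nat, res_res_T, res_res_T]
  · intro j W hU hj
    refine LinearMap.ext fun τ => uniq _ _ _ _ fun j' => ?_
    rw [nat]
    exact LinearMap.congr_fun (agree j j' _ _ _ _) _

variable [Invertible (2 : k)]

/-- Restriction of vertex algebroids. -/
def LocVA.res {V : Opens X} (𝒜 : 𝒯.LocVA U) (h : V ≤ U) : 𝒯.LocVA V where
  app W hW := 𝒜.app W (hW.trans h)
  res_gam hV := 𝒜.res_gam (hV.trans h)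
  res_ip hV := 𝒜.res_ip (hV.trans h)
  res_c hV := 𝒜.res_c (hV.trans h)

theorem isMor_of_cover {V : Opens X} (𝒜 ℬ : 𝒯.LocVA V) (h : 𝒯.LocHom V)
    (hN : ∀ x ∈ V, ∃ j, x ∈ N j)
    (H : ∀ j (W : Opens X) (hW : W ≤ V), W ≤ N j →
      (𝒜.app W hW).IsMor (ℬ.app W hW) (h.app W hW)) :
    (𝒜.app V le_rfl).IsMor (ℬ.app V le_rfl) (h.app V le_rfl) := by
  have c : ∀ x ∈ V, ∃ j, x ∈ V ⊓ N j := fun x hx => by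
    obtain ⟨j, hj⟩ := hN x hx
    exact ⟨j, hx, hj⟩
  have l : ∀ j, V ⊓ N j ≤ V := fun _ => inf_le_left
  have M := fun j => H j (V ⊓ N j) (l j) inf_le_right
  refine ⟨fun a τ => ?_, fun τ₁ τ₂ => ?_, fun τ₁ τ₂ => ?_⟩
  · refine 𝒯.ext_Ω (fun j => V ⊓ N j) l c _ _ fun j => ?_
    simp only [map_add, map_sub, h.nat, ℬ.res_gam, 𝒜.res_gam, (𝒯.res _).map_smul_T,
      (𝒯.res _).map_smul_Ω, (M j).gam]
  · refine 𝒯.ext_A (fun j => V ⊓ N j) l c _ _ fun j => ?_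
    simp only [map_add, ℬ.res_ip, 𝒜.res_ip, (𝒯.res _).map_pair, h.nat, (M j).ip]
  · refine 𝒯.ext_Ω (fun j => V ⊓ N j) l c _ _ fun j => ?_
    simp only [map_add, map_sub, map_smul, ℬ.res_c, 𝒜.res_c, (𝒯.res _).map_pair,
      (𝒯.res _).map_del, (𝒯.res _).map_lie_Ω, h.nat, LieHom.map_lie, (M j).c]

end gluing

/-! ### Global vertex algebroids -/

variable [Invertible (2 : k)]

variable (𝒯) in
/-- A global section of the gerbe of vertex algebroids (the stack associated with the prestack of
vertex algebroids): vertex algebroids over the members of an open cover, glued along isomorphisms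
`h_ij : 𝒜_i → 𝒜_j` satisfying the cocycle condition. -/
structure GlobalVA where
  ι : Type u
  U : ι → Opens X
  cover : ∀ x, ∃ i, x ∈ U i
  obj : ∀ i, 𝒯.LocVA (U i)
  h : ∀ i j, 𝒯.LocHom (U i ⊓ U j)
  isMor : ∀ (i j : ι) (W : Opens X) (hi : W ≤ U i) (hj : W ≤ U j),
    ((obj i).app W hi).IsMor ((obj j).app W hj) ((h i j).app W (le_inf hi hj))
  cocycle : ∀ (i j l : ι) (W : Opens X) (hi : W ≤ U i) (hj : W ≤ U j) (hl : W ≤ U l),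
    (h i j).app W (le_inf hi hj) + (h j l).app W (le_inf hj hl) = (h i l).app W (le_inf hi hl)

namespace GlobalVA

/-- A morphism of global vertex algebroids: isomorphisms `f_ij : 𝒜_i → 𝒜'_j` over the
intersections `U i ∩ U' j`, compatible with the gluing isomorphisms. -/
@[ext]
structure Hom (D D' : 𝒯.GlobalVA) where
  f : ∀ i j, 𝒯.LocHom (D.U i ⊓ D'.U j)
  isMor : ∀ (i : D.ι) (j : D'.ι) (W : Opens X) (hi : W ≤ D.U i) (hj : W ≤ D'.U j),
    ((D.obj i).app W hi).IsMor ((D'.obj j).app W hj) ((f i j).app W (le_inf hi hj))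
  compat : ∀ (i i' : D.ι) (j j' : D'.ι) (W : Opens X) (hi : W ≤ D.U i) (hi' : W ≤ D.U i')
    (hj : W ≤ D'.U j) (hj' : W ≤ D'.U j'),
    (D.h i i').app W (le_inf hi hi') + (f i' j').app W (le_inf hi' hj') =
      (f i j).app W (le_inf hi hj) + (D'.h j j').app W (le_inf hj hj')

theorem h_self (D : 𝒯.GlobalVA) (i : D.ι) (W : Opens X) (hi : W ≤ D.U i) :
    (D.h i i).app W (le_inf hi hi) = 0 := by
  have e := D.cocycle i i i W hi hi hi
  exact left_eq_add.1 e.symm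

/-- The identity, given by the gluing isomorphisms. -/
def idHom (D : 𝒯.GlobalVA) : Hom D D where
  f := D.h
  isMor := D.isMor
  compat i i' j j' W hi hi' hj hj' := by
    rw [D.cocycle i i' j' W hi hi' hj', D.cocycle i j j' W hi hj hj']

theorem exists_comp {D D' D'' : 𝒯.GlobalVA} (f : Hom D D') (g : Hom D' D'') (i : D.ι)
    (l : D''.ι) : ∃ h : 𝒯.LocHom (D.U i ⊓ D''.U l),
      ∀ (j : D'.ι) (W : Opens X) (hU : W ≤ D.U i ⊓ D''.U l) (hj : W ≤ D'.U j),
        h.app W hU = (f.f i j).app W (le_inf (le_inf_iff.1 hU).1 hj) +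
          (g.f j l).app W (le_inf hj (le_inf_iff.1 hU).2) := by
  refine LocHom.exists_glue (𝒯 := 𝒯) D'.U (fun x _ => D'.cover x) _ ?_ ?_
  · intro j V W hU hV hWV τ
    rw [LinearMap.add_apply, LinearMap.add_apply, map_add, LocHom.nat, LocHom.nat]
  · intro j j' W hU hj hj'
    obtain ⟨hi, hl⟩ := le_inf_iff.1 hU
    have e₁ := f.compat i i j j' W hi hi hj hj'
    have e₂ := g.compat j j' l l W hj hj' hl hl
    rw [h_self D i W hi, zero_add] at e₁
    rw [h_self D'' l W hl, add_zero] at e₂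
    rw [e₁, ← e₂, add_assoc]

/-- The composite of `f` and `g` is the family `f_ij + g_jl`, glued over `j`. -/
noncomputable def compHom {D D' D'' : 𝒯.GlobalVA} (f : Hom D D') (g : Hom D' D'') :
    Hom D D'' where
  f i l := (exists_comp f g i l).choose
  isMor i l W hi hl := by
    have s := (exists_comp f g i l).choose_spec
    refine isMor_of_cover (𝒯 := 𝒯) D'.U ((D.obj i).res hi) ((D''.obj l).res hl)
      ((exists_comp f g i l).choose.res (le_inf hi hl)) (fun x _ => D'.cover x) ?_
    intro j V hV hj
    change ((D.obj i).app V _).IsMor ((D''.obj l).app V _) ((exists_comp f g i l).choose.app V _)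
    rw [s j V (hV.trans (le_inf hi hl)) hj]
    exact (f.isMor i j V (hV.trans hi) hj).comp (g.isMor j l V hj (hV.trans hl))
  compat i i' l l' W hi hi' hl hl' := by
    have s := fun i l => (exists_comp f g i l).choose_spec
    refine LocHom.app_eq_of_cover (𝒯 := 𝒯) D'.U
      (f := (D.h i i').res (le_inf hi hi') +
        (exists_comp f g i' l').choose.res (le_inf hi' hl'))
      (g := (exists_comp f g i l).choose.res (le_inf hi hl) + (D''.h l l').res (le_inf hl hl'))
      (fun x _ => D'.cover x) ?_
    intro j V hV hj
    change (D.h i i').app V _ + (exists_comp f g i' l').choose.app V _ =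
      (exists_comp f g i l).choose.app V _ + (D''.h l l').app V _
    rw [s i' l' j V (hV.trans (le_inf hi' hl')) hj, s i l j V (hV.trans (le_inf hi hl)) hj]
    have e₁ := f.compat i i' j j V (hV.trans hi) (hV.trans hi') hj hj
    have e₂ := g.compat j j l l' V hj hj (hV.trans hl) (hV.trans hl')
    rw [h_self D' j V hj, add_zero] at e₁
    rw [h_self D' j V hj, zero_add] at e₂
    rw [← add_assoc, e₁, add_assoc, ← e₂]

theorem compHom_app {D D' D'' : 𝒯.GlobalVA} (f : Hom D D') (g : Hom D' D'') (i : D.ι) (j : D'.ι)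
    (l : D''.ι) (W : Opens X) (hi : W ≤ D.U i) (hj : W ≤ D'.U j) (hl : W ≤ D''.U l) :
    ((compHom f g).f i l).app W (le_inf hi hl) =
      (f.f i j).app W (le_inf hi hj) + (g.f j l).app W (le_inf hj hl) :=
  (exists_comp f g i l).choose_spec j W (le_inf hi hl) hj

theorem hom_ext {D D' : 𝒯.GlobalVA} {f g : Hom D D'} {κ : Type u} (N : κ → Opens X)
    (hN : ∀ x, ∃ j, x ∈ N j)
    (h : ∀ i j l (W : Opens X) (hi : W ≤ D.U i) (hj : W ≤ D'.U j), W ≤ N l →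
      (f.f i j).app W (le_inf hi hj) = (g.f i j).app W (le_inf hi hj)) : f = g := by
  refine Hom.ext (funext fun i => funext fun j => ?_)
  refine LocHom.eq_of_cover (𝒯 := 𝒯) N (fun x _ => hN x) fun l W hW hl => ?_
  exact h i j l W (le_inf_iff.1 hW).1 (le_inf_iff.1 hW).2 hl

noncomputable instance : Category 𝒯.GlobalVA where
  Hom := Hom
  id := idHom
  comp := compHom
  id_comp {D D'} f := by
    refine hom_ext D.U D.cover fun i j l W hi hj hl => ?_
    have e := f.compat i i j j W hi hi hj hj
    rw [compHom_app (idHom D) f i i j W hi hi hj]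
    change (D.h i i).app W _ + _ = _
    rw [h_self D i W hi, zero_add]
  comp_id {D D'} f := by
    refine hom_ext D.U D.cover fun i j l W hi hj hl => ?_
    rw [compHom_app f (idHom D') i j j W hi hj hj]
    change _ + (D'.h j j).app W _ = _
    rw [h_self D' j W hj, add_zero]
  assoc {D₁ D₂ D₃ D₄} f g h := by
    refine hom_ext (fun p : D₂.ι × D₃.ι => D₂.U p.1 ⊓ D₃.U p.2) (fun x => ?_) ?_
    · obtain ⟨i, hi⟩ := D₂.cover x
      obtain ⟨j, hj⟩ := D₃.cover x
      exact ⟨(i, j), hi, hj⟩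
    · intro i m p W hi hm hp
      obtain ⟨hj, hl⟩ := le_inf_iff.1 hp
      rw [compHom_app (compHom f g) h i p.2 m W hi hl hm, compHom_app f g i p.1 p.2 W hi hj hl,
        compHom_app f (compHom g h) i p.1 m W hi hj hm, compHom_app g h p.1 p.2 m W hj hl hm,
        add_assoc]

/-- The twist of a global vertex algebroid by a one-cocycle `(ω_i, η_ij)` on its open cover: the
local objects become `𝒜_i ∔ ω_i`, and the gluing isomorphisms become `h_ij + η_ij`. -/
def twist (D : 𝒯.GlobalVA) (z : LinearMap.ker (𝒯.D1 D.U)) : 𝒯.GlobalVA where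
  ι := D.ι
  U := D.U
  cover := D.cover
  obj i := (D.obj i).twist (z.1.1 i)
  h i j := D.h i j + Form2.toLocHom (z.1.2 i j)
  isMor i j W hi hj := by
    have e := congrArg (fun y : 𝒯.C2 D.U => (y.1 i j).app W (le_inf hi hj)) (LinearMap.mem_ker.1 z.2)
    exact (D.isMor i j W hi hj).twist (η := (z.1.2 i j).app W (le_inf hi hj)) (sub_eq_zero.1 e)
  cocycle i j l W hi hj hl := by
    have e := congrArg (fun y : 𝒯.C2 D.U => ((y.2 i j l).app W (le_inf (le_inf hi hj) hl)).val)
      (LinearMap.mem_ker.1 z.2)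
    have e' : ((z.1.2 j l).app W (le_inf hj hl)).val - ((z.1.2 i l).app W (le_inf hi hl)).val
      + ((z.1.2 i j).app W (le_inf hi hj)).val = 0 := e
    have c := D.cocycle i j l W hi hj hl
    refine LinearMap.ext fun τ => ?_
    have e₁ := congrArg (fun f => f τ) e'
    have c₁ := congrArg (fun f => f τ) c
    simp only [LinearMap.add_apply, LinearMap.sub_apply, LinearMap.zero_apply] at e₁ c₁
    change (D.h i j).app W _ τ + ((z.1.2 i j).app W _).val τ
      + ((D.h j l).app W _ τ + ((z.1.2 j l).app W _).val τ)
      = (D.h i l).app W _ τ + ((z.1.2 i l).app W _).val τ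
    rw [← c₁, ← sub_eq_zero, ← e₁]
    abel

end GlobalVA

/-! ### Torsors under `Ω^{[2,3⟩}` -/

variable (𝒯) in
/-- A torsor under the complex of sheaves `Ω^{[2,3⟩} : Ω² → Ω^{3,cl}`: a torsor `P` under the sheaf
`Ω²` with a map of sheaves `w : P → Ω^{3,cl}` such that `w(η + p) = dη + w(p)`. -/
structure FormTorsor where
  P : TopCat.Presheaf (Type u) X
  isSheaf : P.IsSheaf
  /-- the action of `Ω²(U)` on `P(U)` -/
  act : ∀ U : Opens X, 𝒯.Form2 U → P.obj (op U) → P.obj (op U)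
  /-- the map `w` -/
  w : ∀ U : Opens X, P.obj (op U) → 𝒯.Form3 U
  zero_act : ∀ (U : Opens X) (p : P.obj (op U)), act U 0 p = p
  add_act : ∀ (U : Opens X) (η η' : 𝒯.Form2 U) (p : P.obj (op U)),
    act U (η + η') p = act U η (act U η' p)
  simply_transitive : ∀ (U : Opens X) (p q : P.obj (op U)), ∃! η, act U η p = q
  locally_nonempty : ∀ x : X, ∃ U : Opens X, x ∈ U ∧ Nonempty (P.obj (op U))
  res_act : ∀ {U V : Opens X} (h : V ≤ U) (η : 𝒯.Form2 U) (p : P.obj (op U)),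
    P.map (homOfLE h).op (act U η p) = act V (Form2.res h η) (P.map (homOfLE h).op p)
  res_w : ∀ {U V : Opens X} (h : V ≤ U) (p : P.obj (op U)),
    w V (P.map (homOfLE h).op p) = Form3.res h (w U p)
  w_act : ∀ (U : Opens X) (η : 𝒯.Form2 U) (p : P.obj (op U)), w U (act U η p) = 𝒯.d U η + w U p

namespace FormTorsor

/-- A morphism of torsors: an equivariant map of sheaves over `Ω^{3,cl}`. -/
@[ext]
structure Hom (P Q : 𝒯.FormTorsor) where
  f : P.P ⟶ Q.P
  map_act : ∀ (U : Opens X) (η : 𝒯.Form2 U) (p : P.P.obj (op U)),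
    f.app (op U) (P.act U η p) = Q.act U η (f.app (op U) p)
  map_w : ∀ (U : Opens X) (p : P.P.obj (op U)), Q.w U (f.app (op U) p) = P.w U p

instance : Category 𝒯.FormTorsor where
  Hom := Hom
  id P := ⟨𝟙 P.P, fun _ _ _ => rfl, fun _ _ => rfl⟩
  comp {P Q R} f g := ⟨f.f ≫ g.f, fun U η p => by
      change g.f.app (op U) (f.f.app (op U) _) = R.act U η (g.f.app (op U) (f.f.app (op U) p))
      rw [f.map_act, g.map_act], fun U p => by
      change R.w U (g.f.app (op U) (f.f.app (op U) p)) = _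
      rw [g.map_w, f.map_w]⟩

end FormTorsor

end ExtLieSheaf

/-!
The proof is organized around *morphisms of curvature `ω`*, that is, morphisms `𝒜 → ℬ ∔ ω` of
vertex algebroids for a closed three-form `ω` (`CurvedMor`). Curvatures add up under composition,
two such morphisms between the same vertex algebroids differ by a two-form `η`, and then their
curvatures differ by `dη` (`CurvedMor.exists_twoForm`). Conversely, a map compatible with `γ` and
with the pairings always has a curvature (`PreMor.exists_curvedMor`), and over a basis of `T` such
a map exists, because half of the difference of the two pairings can be prescribed on the basis
(`exists_preMor_of_pair`; this is where `1/2` and the duality between `T` and `Ω` enter). So any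
two vertex algebroids are locally isomorphic up to a twist, and the stack of vertex algebroids is
a gerbe under `Ω^{[2,3⟩}` as soon as vertex algebroids exist locally.

A frame of commuting vector fields provides one: with the Jacobian matrix `J(τ)_pq = τ_p(t_q)` of
`τ = ∑ t_q τ_q` the structure is `⟨τ, σ⟩ = -tr(J(τ) J(σ))` and `c(τ, σ) = ½ tr(J(σ) ∂J(τ) - J(τ)
∂J(σ))` (`frameVA`). For two commuting frames with transition matrix `φ` and Maurer–Cartan form
`M(τ) = φ⁻¹ τ(φ)` the Jacobian matrices differ, up to conjugation by `φ`, by `M`, and the map `h`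
with `⟨ν, h(σ)⟩ = tr(M(ν) J(σ)) - ½ tr(M(ν) M(σ))` relates the two structures (`frameMor`). Its
curvature is exactly `β_ij` (`curvedMor_frameMor`), and `h_ij + h_jl - h_il` is exactly `α_ijl`
(`acsAlpha_eq_frameMor`). Hence the cocycle of this presentation of the gerbe is the
Atiyah–Chern–Simons cocycle of the frames.

The characteristic class does not depend on the presentation: on a common refinement, local
isomorphisms up to a twist between the objects of two presentations yield a cochain bounding the
difference of the cocycles (`GerbePresentation.IsCocycle.mk_eq_mk`). The Atiyah–Chern–Simons class
does not depend on the trivialization, since the cocycles of two trivializations are restrictions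
of that of their disjoint union, and refinement maps are homotopic (`LocalFrames.mk_acs_eq_mk`).
As commuting frames exist locally, the two classes agree (`IsRegular.exists_class`). If the class
vanishes, a bounding cochain corrects the objects and isomorphisms of a presentation to a global
section.

Given global sections `D₀` and `D`, the isomorphisms `D₀ ∔ ω → D` with varying `ω` form an
`Ω^{[2,3⟩}`-torsor, and `D ↦` this torsor is an equivalence (`GlobalVA.torsorFunctor`): morphisms
and objects are recovered from local sections by gluing. The torsor structure on isomorphism
classes assigns to `D` and `D'` the class of the cocycle obtained from local isomorphisms up to a
twist (`GlobalVA.Comparison`), and an automorphism is, locally and hence globally, a closed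
two-form.
-/

set_option linter.unusedSectionVars false

namespace ExtLieAlgebroid

variable {k : Type v} [CommRing k] {E : ExtLieAlgebroid.{u, v} k}

/-! ### Elementary identities -/

theorem TwoForm.sub_val (a b : E.TwoForm) : (a - b).val = a.val - b.val := rfl

theorem TwoForm.zero_val : (0 : E.TwoForm).val = 0 := rfl

theorem ClosedThreeForm.neg_val (a : E.ClosedThreeForm) : (-a).val = -a.val := rfl

theorem ClosedThreeForm.sub_val (a b : E.ClosedThreeForm) : (a - b).val = a.val - b.val := rfl

theorem ClosedThreeForm.zero_val : (0 : E.ClosedThreeForm).val = 0 := rfl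

theorem dTwo_val (η : E.TwoForm) (τ₁ τ₂ : E.T) :
    (E.dTwo η).val τ₁ τ₂ =
      -η.val ⁅τ₁, τ₂⁆ + ⁅τ₁, η.val τ₂⁆ - ⁅τ₂, η.val τ₁⁆ - E.del (E.pair τ₁ (η.val τ₂)) := rfl

theorem smul_lie_vec (a : E.A) (τ σ : E.T) : ⁅a • τ, σ⁆ = a • ⁅τ, σ⁆ - ⁅σ, a⁆ • τ := by
  rw [← lie_skew, LieRinehartRing.leibniz_smul_right, ← lie_skew τ σ, smul_neg]
  abel

theorem pair_lie (τ ν : E.T) (ω : E.Ω) :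
    E.pair ν ⁅τ, ω⁆ = ⁅τ, E.pair ν ω⁆ - E.pair ⁅τ, ν⁆ ω := by
  rw [E.lie_pair]; ring

theorem pair_smul_k (c : k) (τ : E.T) (ω : E.Ω) : E.pair τ (c • ω) = c • E.pair τ ω := by
  rw [← algebraMap_smul E.A c, map_smul, algebraMap_smul]

section half

variable [Invertible (2 : k)]

theorem half_add_half {M : Type*} [AddCommGroup M] [Module k M] (x : M) :
    (⅟2 : k) • x + (⅟2 : k) • x = x := by
  rw [← add_smul, invOf_two_add_invOf_two, one_smul]

end half

namespace VertexAlgebroid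

/-! ### Morphisms of vertex algebroids with curvature -/

variable [Invertible (2 : k)]

@[ext]
theorem ext_components {𝒜 ℬ : E.VertexAlgebroid} (h₁ : 𝒜.gam = ℬ.gam) (h₂ : 𝒜.ip = ℬ.ip)
    (h₃ : 𝒜.c = ℬ.c) : 𝒜 = ℬ := by
  cases 𝒜; cases ℬ; cases h₁; cases h₂; cases h₃; rfl

theorem twist_c (𝒜 : E.VertexAlgebroid) (ω : E.ClosedThreeForm) (τ₁ τ₂ : E.T) :
    (𝒜.twist ω).c τ₁ τ₂ = 𝒜.c τ₁ τ₂ + ω.val τ₁ τ₂ := rfl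

/-- The conditions on a morphism of vertex algebroids that involve only `γ` and `⟨ , ⟩`. -/
structure PreMor (𝒜 ℬ : E.VertexAlgebroid) (h : E.T →ₗ[k] E.Ω) : Prop where
  gam : ∀ (a : E.A) (τ : E.T), h (a • τ) = a • h τ - ℬ.gam a τ + 𝒜.gam a τ
  ip : ∀ τ₁ τ₂ : E.T,
    𝒜.ip τ₁ τ₂ = ℬ.ip τ₁ τ₂ + E.pair τ₁ (h τ₂) + E.pair τ₂ (h τ₁)

/-- `h` is a morphism `𝒜 → ℬ ∔ ω`, a *morphism of curvature `ω`*. Curvatures add up under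
composition, so that these form a groupoid graded by closed three-forms. -/
structure CurvedMor (𝒜 ℬ : E.VertexAlgebroid) (h : E.T →ₗ[k] E.Ω) (ω : E.ClosedThreeForm) : Prop
    extends PreMor 𝒜 ℬ h where
  c : ∀ τ₁ τ₂ : E.T,
    𝒜.c τ₁ τ₂ = ℬ.c τ₁ τ₂ + ω.val τ₁ τ₂ + (⅟2 : k) • E.del (E.pair τ₁ (h τ₂))
      - (⅟2 : k) • E.del (E.pair τ₂ (h τ₁)) - ⁅τ₁, h τ₂⁆ + ⁅τ₂, h τ₁⁆ + h ⁅τ₁, τ₂⁆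

theorem isMor_twist_twist {𝒜 ℬ : E.VertexAlgebroid} {h : E.T →ₗ[k] E.Ω}
    {ω ω' : E.ClosedThreeForm} :
    IsMor (𝒜.twist ω) (ℬ.twist ω') h ↔ CurvedMor 𝒜 ℬ h (ω' - ω) := by
  refine ⟨fun H => ⟨⟨H.gam, H.ip⟩, fun τ₁ τ₂ => ?_⟩,
    fun H => ⟨H.gam, H.ip, fun τ₁ τ₂ => ?_⟩⟩
  · have e := H.c τ₁ τ₂
    rw [twist_c, twist_c, ← eq_sub_iff_add_eq] at e
    rw [e, ClosedThreeForm.sub_val, LinearMap.sub_apply, LinearMap.sub_apply]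
    abel
  · have e := H.c τ₁ τ₂
    rw [ClosedThreeForm.sub_val, LinearMap.sub_apply, LinearMap.sub_apply] at e
    rw [twist_c, twist_c, e]
    abel

theorem twist_zero (𝒜 : E.VertexAlgebroid) : 𝒜.twist 0 = 𝒜 :=
  ext_components rfl rfl (LinearMap.ext fun _ => LinearMap.ext fun _ => add_zero _)

theorem twist_twist (𝒜 : E.VertexAlgebroid) (ω ω' : E.ClosedThreeForm) :
    (𝒜.twist ω).twist ω' = 𝒜.twist (ω + ω') :=
  ext_components rfl rfl (LinearMap.ext fun _ => LinearMap.ext fun _ => add_assoc _ _ _)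

/-- A morphism `𝒜 → ℬ ∔ ω` is a morphism of curvature `ω`. -/
theorem isMor_twist {𝒜 ℬ : E.VertexAlgebroid} {h : E.T →ₗ[k] E.Ω} {ω : E.ClosedThreeForm} :
    IsMor 𝒜 (ℬ.twist ω) h ↔ CurvedMor 𝒜 ℬ h ω := by
  have e := isMor_twist_twist (𝒜 := 𝒜) (ℬ := ℬ) (h := h) (ω := 0) (ω' := ω)
  rwa [twist_zero, sub_zero] at e

theorem isMor_iff {𝒜 ℬ : E.VertexAlgebroid} {h : E.T →ₗ[k] E.Ω} :
    IsMor 𝒜 ℬ h ↔ CurvedMor 𝒜 ℬ h 0 := by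
  rw [← isMor_twist, twist_zero]

theorem curvedMor_twist {𝒜 ℬ : E.VertexAlgebroid} {h : E.T →ₗ[k] E.Ω}
    {ω₁ ω₂ ω : E.ClosedThreeForm} :
    CurvedMor (𝒜.twist ω₁) (ℬ.twist ω₂) h ω ↔ CurvedMor 𝒜 ℬ h (ω₂ + ω - ω₁) := by
  rw [← isMor_twist, twist_twist, isMor_twist_twist]

theorem CurvedMor.comp {𝒜 ℬ 𝒞 : E.VertexAlgebroid} {h h' : E.T →ₗ[k] E.Ω}
    {ω ω' : E.ClosedThreeForm} (H : CurvedMor 𝒜 ℬ h ω) (H' : CurvedMor ℬ 𝒞 h' ω') :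
    CurvedMor 𝒜 𝒞 (h + h') (ω + ω') where
  gam a τ := by
    simp only [LinearMap.add_apply, H.gam, H'.gam, smul_add]; abel
  ip τ₁ τ₂ := by
    simp only [LinearMap.add_apply, H.ip, H'.ip, map_add]; abel
  c τ₁ τ₂ := by
    simp only [LinearMap.add_apply, ClosedThreeForm.add_val, H.c, H'.c, map_add, lie_add, smul_add]
    abel

theorem CurvedMor.inv {𝒜 ℬ : E.VertexAlgebroid} {h : E.T →ₗ[k] E.Ω}
    {ω : E.ClosedThreeForm} (H : CurvedMor 𝒜 ℬ h ω) : CurvedMor ℬ 𝒜 (-h) (-ω) where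
  gam a τ := by
    simp only [LinearMap.neg_apply, H.gam, smul_neg]; abel
  ip τ₁ τ₂ := by
    simp only [LinearMap.neg_apply, H.ip, map_neg]; abel
  c τ₁ τ₂ := by
    simp only [LinearMap.neg_apply, ClosedThreeForm.neg_val, H.c, map_neg, lie_neg, smul_neg]
    abel

theorem CurvedMor.refl (𝒜 : E.VertexAlgebroid) : CurvedMor 𝒜 𝒜 0 0 where
  gam a τ := by simp
  ip τ₁ τ₂ := by simp
  c τ₁ τ₂ := by simp [ClosedThreeForm.zero_val]

/-- A two-form `η` is a morphism `𝒜 → 𝒜 ∔ dη`. -/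
theorem CurvedMor.ofTwoForm (𝒜 : E.VertexAlgebroid) (η : E.TwoForm) :
    CurvedMor 𝒜 𝒜 (η.val.restrictScalars k) (E.dTwo η) := by
  have e := (isMor_iff.2 (CurvedMor.refl 𝒜)).twist (ω := 0) (ω' := E.dTwo η) (η := η)
    (sub_zero _).symm
  rwa [isMor_twist_twist, sub_zero, zero_add] at e

/-- Two curved morphisms between the same vertex algebroids differ by a two-form, and their
curvatures by its differential. -/
theorem CurvedMor.exists_twoForm {𝒜 ℬ : E.VertexAlgebroid} {h h' : E.T →ₗ[k] E.Ω}
    {ω ω' : E.ClosedThreeForm} (H : CurvedMor 𝒜 ℬ h ω) (H' : CurvedMor 𝒜 ℬ h' ω') :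
    ∃ η : E.TwoForm, (∀ τ, η.val τ = h τ - h' τ) ∧ E.dTwo η = ω - ω' := by
  let η : E.TwoForm :=
    ⟨{ toFun := fun τ => h τ - h' τ
       map_add' := fun τ σ => by rw [map_add, map_add]; abel
       map_smul' := fun a τ => by rw [H.gam, H'.gam, RingHom.id_apply, smul_sub]; abel },
      fun τ σ => by
        have e := (H.ip τ σ).symm.trans (H'.ip τ σ)
        change E.pair τ (h σ - h' σ) = -E.pair σ (h τ - h' τ)
        rw [map_sub, map_sub]
        linear_combination e⟩
  refine ⟨η, fun _ => rfl, ClosedThreeForm.ext fun τ₁ τ₂ => ?_⟩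
  have e : ∀ τ, η.val τ = h τ - h' τ := fun _ => rfl
  have s := η.skew τ₁ τ₂
  have c := (H.c τ₁ τ₂).symm.trans (H'.c τ₁ τ₂)
  have s' : (⅟2 : k) • E.del (E.pair τ₁ (η.val τ₂)) =
      E.del (E.pair τ₁ (η.val τ₂)) + (⅟2 : k) • E.del (E.pair τ₂ (η.val τ₁)) := by
    rw [eq_comm]
    nth_rewrite 1 [← half_add_half (k := k) (E.del (E.pair τ₁ (η.val τ₂)))]
    rw [s]; simp
  rw [dTwo_val, ClosedThreeForm.sub_val, LinearMap.sub_apply, LinearMap.sub_apply]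
  simp only [e, map_sub, smul_sub, lie_sub] at s' ⊢
  linear_combination (norm := module) s' - c

/-! ### The curvature of a pre-morphism -/

/-- The defect `c_𝒜 - c_ℬ - δh` of a pre-morphism `h`. -/
noncomputable def curvatureFun (𝒜 ℬ : E.VertexAlgebroid) (h : E.T →ₗ[k] E.Ω) (τ₁ τ₂ : E.T) : E.Ω :=
  𝒜.c τ₁ τ₂ - ℬ.c τ₁ τ₂ - (⅟2 : k) • E.del (E.pair τ₁ (h τ₂))
      + (⅟2 : k) • E.del (E.pair τ₂ (h τ₁)) + ⁅τ₁, h τ₂⁆ - ⁅τ₂, h τ₁⁆ - h ⁅τ₁, τ₂⁆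

variable {𝒜 ℬ : E.VertexAlgebroid} {h : E.T →ₗ[k] E.Ω}

theorem curvatureFun_skew (τ₁ τ₂ : E.T) :
    curvatureFun 𝒜 ℬ h τ₁ τ₂ = -curvatureFun 𝒜 ℬ h τ₂ τ₁ := by
  simp only [curvatureFun, 𝒜.c_skew τ₁ τ₂, ℬ.c_skew τ₁ τ₂, ← lie_skew τ₁ τ₂, map_neg]
  abel

theorem curvatureFun_add_left (τ τ' σ : E.T) :
    curvatureFun 𝒜 ℬ h (τ + τ') σ = curvatureFun 𝒜 ℬ h τ σ + curvatureFun 𝒜 ℬ h τ' σ := by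
  simp only [curvatureFun, map_add, LinearMap.add_apply, add_lie, lie_add, smul_add]
  abel

theorem PreMor.curvatureFun_smul_left (H : PreMor 𝒜 ℬ h) (a : E.A) (τ σ : E.T) :
    curvatureFun 𝒜 ℬ h (a • τ) σ = a • curvatureFun 𝒜 ℬ h τ σ := by
  have g : ∀ a τ, 𝒜.gam a τ - ℬ.gam a τ = h (a • τ) - a • h τ := fun a τ => by
    rw [H.gam]; abel
  have g₁ := g a ⁅τ, σ⁆
  have g₂ := g ⁅σ, a⁆ τ
  have g₃ := congrArg (fun x => ⁅σ, x⁆) (g a τ)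
  have g₄ := congrArg (fun x => (⅟2 : k) • E.del (E.pair σ x)) (g a τ)
  have i := congrArg (fun x => (⅟2 : k) • x • E.del a) (H.ip τ σ)
  -- `module` does not know that `½ + ½ = 1` in `k`; this is supplied for the terms that need it
  have j : ∀ x : E.Ω, x = (⅟2 : k) • x + (⅟2 : k) • x := fun x => (half_add_half x).symm
  have j₁ := j (E.pair τ (h σ) • E.del a)
  simp only [lie_sub, map_sub, smul_sub, E.lie_smul_form, map_smul, smul_eq_mul,
    Derivation.leibniz, smul_add, add_smul] at g₃ g₄ i
  simp only [curvatureFun, 𝒜.A3, ℬ.A3, smul_lie_vec, map_sub, map_smul, LinearMap.smul_apply,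
    smul_eq_mul, Derivation.leibniz, E.smul_lie_form, smul_add, smul_sub]
  rw [smul_comm a (⅟2 : k), smul_comm a (⅟2 : k)]
  linear_combination (norm := module) g₁ - g₂ + g₃ - g₄ - i + j₁

theorem half_smul_eq (x : E.A) : (⅟2 : k) • x = algebraMap k E.A ⅟2 * x := Algebra.smul_def _ _

theorem two_mul_half : (2 : E.A) * algebraMap k E.A ⅟2 = 1 := by
  rw [← map_ofNat (algebraMap k E.A) 2, ← map_mul, mul_invOf_self, map_one]

/-- Skew symmetry of the curvature in all its arguments: the difference of the axioms `A4` for the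
two vertex algebroids. -/
theorem PreMor.pair_curvatureFun (H : PreMor 𝒜 ℬ h) (τ₁ τ₂ τ₃ : E.T) :
    E.pair τ₁ (curvatureFun 𝒜 ℬ h τ₂ τ₃) = -E.pair τ₂ (curvatureFun 𝒜 ℬ h τ₁ τ₃) := by
  have a := 𝒜.A4 τ₃ τ₁ τ₂
  have b := ℬ.A4 τ₃ τ₁ τ₂
  simp only [H.ip, lie_add, smul_add] at a
  have t := two_mul_half (E := E)
  have sk : ∀ x y w, E.pair ⁅x, y⁆ w = -E.pair ⁅y, x⁆ w := fun x y w => by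
    rw [← lie_skew, map_neg, LinearMap.neg_apply]
  have sh : ∀ x y z, E.pair z (h ⁅x, y⁆) = -E.pair z (h ⁅y, x⁆) := fun x y z => by
    rw [← lie_skew, map_neg, map_neg]
  simp only [curvatureFun, map_add, map_sub, pair_lie, pair_smul_k, pair_del, half_smul_eq,
    𝒜.c_skew τ₂ τ₃, ℬ.c_skew τ₂ τ₃, 𝒜.c_skew τ₁ τ₃, ℬ.c_skew τ₁ τ₃, map_neg,
    sk τ₁ τ₂, sh τ₁ τ₃, sh τ₂ τ₃] at a b ⊢
  linear_combination a - b - (⁅τ₂, E.pair τ₁ (h τ₃)⁆ + ⁅τ₁, E.pair τ₂ (h τ₃)⁆) * t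

/-- Closedness of the curvature: the difference of the axioms `A5` for the two vertex algebroids. -/
theorem dLie_curvatureFun (H : PreMor 𝒜 ℬ h) (τ₁ τ₂ τ₃ : E.T) :
    E.dLie (curvatureFun 𝒜 ℬ h) τ₁ τ₂ τ₃ - E.del (E.pair τ₁ (curvatureFun 𝒜 ℬ h τ₂ τ₃)) = 0 := by
  have e : E.pair τ₁ (curvatureFun 𝒜 ℬ h τ₂ τ₃) = E.pair τ₃ (curvatureFun 𝒜 ℬ h τ₁ τ₂) := by
    rw [curvatureFun_skew τ₂ τ₃, map_neg, H.pair_curvatureFun τ₁ τ₃ τ₂, neg_neg]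
  rw [e]
  have a := 𝒜.A5 τ₁ τ₂ τ₃
  have b := ℬ.A5 τ₁ τ₂ τ₃
  have l : ∀ (x y : E.T) (w : E.Ω), ⁅⁅x, y⁆, w⁆ = ⁅x, ⁅y, w⁆⁆ - ⁅y, ⁅x, w⁆⁆ :=
    fun x y w => lie_lie x y w
  have j : h ⁅⁅τ₁, τ₂⁆, τ₃⁆ - h ⁅⁅τ₁, τ₃⁆, τ₂⁆ + h ⁅⁅τ₂, τ₃⁆, τ₁⁆ = 0 := by
    have e := lie_jacobi τ₁ τ₂ τ₃
    rw [← lie_skew τ₃ τ₁, lie_neg] at e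
    rw [← map_sub, ← map_add, ← map_zero h, ← neg_zero, ← e, ← lie_skew ⁅τ₁, τ₂⁆ τ₃,
      ← lie_skew ⁅τ₁, τ₃⁆ τ₂, ← lie_skew ⁅τ₂, τ₃⁆ τ₁]
    congr 1
    abel
  have ls : ∀ (τ : E.T) (x : E.Ω), ⁅τ, (⅟2 : k) • x⁆ = (⅟2 : k) • ⁅τ, x⁆ := fun τ x =>
    lie_smul _ _ _
  have hh : ∀ x : E.Ω, x = (⅟2 : k) • x + (⅟2 : k) • x := fun x => (half_add_half x).symm
  have two : ∀ x : E.Ω, (⅟2 : k) • (2 : k) • x = x := fun x => by simp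
  simp only [dLie, H.ip, map_add, map_sub, lie_add, E.del_lie, smul_add, smul_sub,
    Derivation.map_smul, two] at a b
  simp only [dLie, curvatureFun, map_add, map_sub, lie_add, lie_sub, ls, pair_lie, E.del_lie,
    pair_del, pair_smul_k, Derivation.map_smul, l]
  linear_combination (norm := module) a - b + j - hh ⁅τ₁, E.del (E.pair τ₃ (h τ₂))⁆
    + hh ⁅τ₂, E.del (E.pair τ₃ (h τ₁))⁆ + hh (E.del (E.pair τ₃ (h ⁅τ₁, τ₂⁆)))
    + hh (E.del (E.pair ⁅τ₁, τ₃⁆ (h τ₂))) - hh (E.del (E.pair ⁅τ₂, τ₃⁆ (h τ₁)))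

/-- The curvature of a pre-morphism: `A`-linearity, skewness and closedness are the differences of
the axioms `A3`, `A4` and `A5` for the two vertex algebroids. -/
theorem PreMor.exists_curvedMor (H : PreMor 𝒜 ℬ h) : ∃ ω, CurvedMor 𝒜 ℬ h ω := by
  refine ⟨⟨LinearMap.mk₂ E.A (curvatureFun 𝒜 ℬ h) curvatureFun_add_left H.curvatureFun_smul_left
    (fun τ σ σ' => ?_) (fun a τ σ => ?_), ?_, ?_, ?_⟩, H, fun τ₁ τ₂ => ?_⟩
  · rw [curvatureFun_skew, curvatureFun_add_left, curvatureFun_skew σ, curvatureFun_skew σ']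
    abel
  · rw [curvatureFun_skew, H.curvatureFun_smul_left, curvatureFun_skew σ, smul_neg, neg_neg]
  · exact curvatureFun_skew
  · exact H.pair_curvatureFun
  · exact dLie_curvatureFun H
  · change _ = _ + curvatureFun 𝒜 ℬ h τ₁ τ₂ + _ - _ - _ + _ + _
    rw [curvatureFun]
    abel

/-! ### Pre-morphisms over a basis -/

variable {n : Type*} [Fintype n] (e : Module.Basis n E.A E.T)

/-- The condition on the pairings need only be checked on a basis. -/
theorem PreMor.of_basis (hg : ∀ (a : E.A) (τ : E.T), h (a • τ) = a • h τ - ℬ.gam a τ + 𝒜.gam a τ)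
    (hi : ∀ i j, 𝒜.ip (e i) (e j) = ℬ.ip (e i) (e j) + E.pair (e i) (h (e j)) +
      E.pair (e j) (h (e i))) : PreMor 𝒜 ℬ h := by
  refine ⟨hg, ?_⟩
  let P : E.T → E.T → Prop := fun τ₁ τ₂ =>
    𝒜.ip τ₁ τ₂ = ℬ.ip τ₁ τ₂ + E.pair τ₁ (h τ₂) + E.pair τ₂ (h τ₁)
  have symm : ∀ τ₁ τ₂, P τ₁ τ₂ → P τ₂ τ₁ := fun τ₁ τ₂ H => by
    change 𝒜.ip _ _ = _ + _ + _
    rw [𝒜.ip_symm, H, ℬ.ip_symm]; ring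
  have add : ∀ τ τ' σ, P τ σ → P τ' σ → P (τ + τ') σ := fun τ τ' σ H H' => by
    change 𝒜.ip _ _ = _ + _ + _
    simp only [map_add, LinearMap.add_apply]
    rw [H, H']; ring
  have smul : ∀ a τ σ, P τ σ → P (a • τ) σ := fun a τ σ H => by
    change 𝒜.ip _ _ = _ + _ + _
    rw [𝒜.A2, ℬ.A2, H, hg, map_smul, LinearMap.smul_apply, map_add, map_sub, map_smul,
      smul_eq_mul, smul_eq_mul]
    ring
  have sum : ∀ τ σ, (∀ i, P (e i) σ) → P τ σ := fun τ σ H => by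
    rw [← e.sum_repr τ]
    refine Finset.sum_induction _ (P · σ) (fun _ _ => add _ _ _) ?_ fun i _ => smul _ _ _ (H i)
    change 𝒜.ip _ _ = _ + _ + _
    simp
  exact fun τ₁ τ₂ => sum _ _ fun i => symm _ _ (sum _ _ fun j => symm _ _ (hi i j))

/-- The map `h` with `h(a τ_i) = γ_𝒜(a, τ_i) - γ_ℬ(a, τ_i) + a x_i`. -/
noncomputable def extendMor (𝒜 ℬ : E.VertexAlgebroid) (x : n → E.Ω) : E.T →ₗ[k] E.Ω where
  toFun τ := ∑ i, (𝒜.gam (e.repr τ i) (e i) - ℬ.gam (e.repr τ i) (e i) + e.repr τ i • x i)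
  map_add' τ σ := by
    rw [← Finset.sum_add_distrib]
    refine Finset.sum_congr rfl fun i _ => ?_
    simp only [map_add, Finsupp.add_apply, LinearMap.add_apply, add_smul]
    abel
  map_smul' c τ := by
    rw [RingHom.id_apply, Finset.smul_sum]
    refine Finset.sum_congr rfl fun i _ => ?_
    rw [← algebraMap_smul E.A c τ, map_smul, Finsupp.smul_apply, smul_eq_mul, ← Algebra.smul_def,
      map_smul, map_smul, LinearMap.smul_apply, LinearMap.smul_apply, smul_add, smul_sub,
      smul_assoc]

theorem gam_one (𝒜 : E.VertexAlgebroid) (τ : E.T) : 𝒜.gam 1 τ = 0 := by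
  have e := 𝒜.A1 1 1 τ
  have l : ⁅τ, (1 : E.A)⁆ = 0 := by
    rw [← E.pair_del, Derivation.map_one_eq_zero, map_zero]
  simpa [l] using e

theorem extendMor_basis (x : n → E.Ω) (i : n) : extendMor e 𝒜 ℬ x (e i) = x i := by
  change ∑ j, _ = _
  rw [Finset.sum_eq_single i]
  · simp [gam_one]
  · intro j _ hj
    simp [e.repr_self, Ne.symm hj]
  · simp

theorem extendMor_smul (x : n → E.Ω) (a : E.A) (τ : E.T) :
    extendMor e 𝒜 ℬ x (a • τ) = a • extendMor e 𝒜 ℬ x τ - ℬ.gam a τ + 𝒜.gam a τ := by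
  have hτ : ∀ 𝒞 : E.VertexAlgebroid, 𝒞.gam a τ = ∑ i, 𝒞.gam a (e.repr τ i • e i) := fun 𝒞 => by
    rw [← map_sum, e.sum_repr]
  rw [hτ, hτ]
  change ∑ i, _ = a • ∑ i, _ - _ + _
  rw [Finset.smul_sum, ← Finset.sum_sub_distrib, ← Finset.sum_add_distrib]
  refine Finset.sum_congr rfl fun i _ => ?_
  rw [𝒜.A1, ℬ.A1, map_smul, Finsupp.smul_apply, smul_eq_mul, smul_add, smul_sub, mul_smul]
  abel

/-- Over a basis of `T`, perfectness allows to prescribe the pairings `⟨τ_i, h τ_j⟩`, so that any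
two vertex algebroids are related by a curved morphism. -/
theorem exists_preMor_of_pair (x : n → E.Ω) (𝒜 ℬ : E.VertexAlgebroid)
    (hx : ∀ i j, E.pair (e i) (x j) = (⅟2 : k) • (𝒜.ip (e i) (e j) - ℬ.ip (e i) (e j))) :
    PreMor 𝒜 ℬ (extendMor e 𝒜 ℬ x) := by
  refine PreMor.of_basis e (extendMor_smul e x) fun i j => ?_
  rw [extendMor_basis, extendMor_basis, hx, hx, 𝒜.ip_symm (e j), ℬ.ip_symm (e j), add_assoc,
    half_add_half]
  abel

end VertexAlgebroid

end ExtLieAlgebroid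

namespace ExtLieAlgebroid

variable {k : Type v} [CommRing k] {E : ExtLieAlgebroid.{u, v} k}

/-! ### Matrix calculus over an extended Lie algebroid -/

section matrix

variable {l m n : Type*}

/-- The action of a vector field on matrices of functions, entry by entry. -/
def lieMat (τ : E.T) (M : Matrix m n E.A) : Matrix m n E.A := M.map fun a => ⁅τ, a⁆

theorem lieMat_sub_right (τ : E.T) (M N : Matrix m n E.A) :
    lieMat τ (M - N) = lieMat τ M - lieMat τ N := by ext; simp [lieMat]

theorem lieMat_add_left (τ σ : E.T) (M : Matrix m n E.A) :
    lieMat (τ + σ) M = lieMat τ M + lieMat σ M := by ext; simp [lieMat]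

theorem lieMat_smul_left (a : E.A) (τ : E.T) (M : Matrix m n E.A) :
    lieMat (a • τ) M = a • lieMat τ M := by ext; simp [lieMat]

theorem lieMat_lie (τ σ : E.T) (M : Matrix m n E.A) :
    lieMat ⁅τ, σ⁆ M = lieMat τ (lieMat σ M) - lieMat σ (lieMat τ M) := by
  ext; simp [lieMat]

theorem lie_finset_sum (τ : E.T) {ι : Type*} (s : Finset ι) (f : ι → E.A) :
    ⁅τ, ∑ i ∈ s, f i⁆ = ∑ i ∈ s, ⁅τ, f i⁆ :=
  map_sum (LieModule.toEnd k E.T E.A τ) f s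

theorem lie_finset_sum_form (τ : E.T) {ι : Type*} (s : Finset ι) (f : ι → E.Ω) :
    ⁅τ, ∑ i ∈ s, f i⁆ = ∑ i ∈ s, ⁅τ, f i⁆ :=
  map_sum (LieModule.toEnd k E.T E.Ω τ) f s

theorem lie_one (τ : E.T) : ⁅τ, (1 : E.A)⁆ = 0 := by
  rw [← E.pair_del, Derivation.map_one_eq_zero, map_zero]

theorem lieMat_one [DecidableEq n] (τ : E.T) : lieMat τ (1 : Matrix n n E.A) = 0 := by
  ext i j
  by_cases h : i = j
  · simp [lieMat, h, lie_one]
  · simp [lieMat, h]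

variable [Fintype m]

theorem lieMat_mul (τ : E.T) (M : Matrix l m E.A) (N : Matrix m n E.A) :
    lieMat τ (M * N) = lieMat τ M * N + M * lieMat τ N := by
  ext i j
  simp only [lieMat, Matrix.map_apply, Matrix.mul_apply, Matrix.add_apply, lie_finset_sum,
    LieRinehartRing.leibniz_mul_right, smul_eq_mul, Finset.sum_add_distrib]
  ring

variable [Fintype n]

theorem lie_trace (τ : E.T) (M : Matrix n n E.A) :
    ⁅τ, M.trace⁆ = (lieMat τ M).trace := by
  simp [Matrix.trace, lie_finset_sum, lieMat]

/-- The one-form `tr(X ∂Y)`. -/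
def trDel (X : Matrix m n E.A) (Y : Matrix n m E.A) : E.Ω :=
  ∑ p, ∑ q, X p q • E.del (Y q p)

theorem trDel_add_left (X X' : Matrix m n E.A) (Y : Matrix n m E.A) :
    trDel (X + X') Y = trDel X Y + trDel X' Y := by
  simp [trDel, add_smul, Finset.sum_add_distrib]

theorem trDel_sub_left (X X' : Matrix m n E.A) (Y : Matrix n m E.A) :
    trDel (X - X') Y = trDel X Y - trDel X' Y := by
  simp [trDel, sub_smul, Finset.sum_sub_distrib]

theorem trDel_smul_left (a : E.A) (X : Matrix m n E.A) (Y : Matrix n m E.A) :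
    trDel (a • X) Y = a • trDel X Y := by
  simp [trDel, mul_smul, Finset.smul_sum]

theorem trDel_add_right (X : Matrix m n E.A) (Y Y' : Matrix n m E.A) :
    trDel X (Y + Y') = trDel X Y + trDel X Y' := by
  simp [trDel, Finset.sum_add_distrib]

theorem trDel_sub_right (X : Matrix m n E.A) (Y Y' : Matrix n m E.A) :
    trDel X (Y - Y') = trDel X Y - trDel X Y' := by
  simp [trDel, smul_sub, Finset.sum_sub_distrib]

theorem trDel_smul_right (a : E.A) (X : Matrix m n E.A) (Y : Matrix n m E.A) :
    trDel X (a • Y) = a • trDel X Y + (X * Y).trace • E.del a := by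
  simp only [trDel, Matrix.smul_apply, smul_eq_mul, Derivation.leibniz, smul_add,
    Finset.sum_add_distrib, Finset.smul_sum, Matrix.trace, Matrix.diag, Matrix.mul_apply,
    Finset.sum_smul, smul_smul, mul_comm]

theorem trDel_smul_k_left (c : k) (X : Matrix m n E.A) (Y : Matrix n m E.A) :
    trDel (c • X) Y = c • trDel X Y := by
  simp [trDel, Finset.smul_sum]

theorem trDel_smul_k_right (c : k) (X : Matrix m n E.A) (Y : Matrix n m E.A) :
    trDel X (c • Y) = c • trDel X Y := by
  simp only [trDel, Matrix.smul_apply, Derivation.map_smul, Finset.smul_sum]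
  exact Finset.sum_congr rfl fun p _ => Finset.sum_congr rfl fun q _ => smul_comm _ _ _

theorem lie_trDel (τ : E.T) (X : Matrix m n E.A) (Y : Matrix n m E.A) :
    ⁅τ, trDel X Y⁆ = trDel (lieMat τ X) Y + trDel X (lieMat τ Y) := by
  simp [trDel, lie_finset_sum_form, lie_smul_form, lieMat, E.del_lie, Finset.sum_add_distrib]

theorem pair_trDel (τ : E.T) (X : Matrix m n E.A) (Y : Matrix n m E.A) :
    E.pair τ (trDel X Y) = (X * lieMat τ Y).trace := by
  simp [trDel, pair_del, lieMat, Matrix.trace, Matrix.mul_apply]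

theorem del_trace_mul (X : Matrix m n E.A) (Y : Matrix n m E.A) :
    E.del (X * Y).trace = trDel X Y + trDel Y X := by
  simp only [trDel, Matrix.trace, Matrix.diag, Matrix.mul_apply, map_sum, Derivation.leibniz,
    Finset.sum_add_distrib]
  congr 1
  exact Finset.sum_comm

theorem trDel_mul_right [Fintype l] (Z : Matrix m n E.A) (X : Matrix n l E.A)
    (Y : Matrix l m E.A) : trDel Z (X * Y) = trDel (Y * Z) X + trDel (Z * X) Y := by
  simp only [trDel, Matrix.mul_apply, map_sum, Derivation.leibniz, Finset.smul_sum, smul_add,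
    Finset.sum_add_distrib, Finset.sum_smul, smul_smul]
  rw [add_comm]
  congr 1
  · rw [Finset.sum_comm_cycle]
    simp only [mul_comm]
    exact Finset.sum_congr rfl fun _ _ => Finset.sum_comm
  · exact Finset.sum_congr rfl fun p _ => Finset.sum_comm

end matrix

/-! ### The vertex algebroid of a commuting frame -/

section frame

variable {n : Type*} (e : Module.Basis n E.A E.T)

/-- The Jacobian matrix `τ_p(t_q)` of a vector field `τ = ∑ t_q τ_q` in the frame `(τ_q)`: the
covariant derivative of `τ` for the connection that makes the frame flat. -/
noncomputable def jac (τ : E.T) : Matrix n n E.A := Matrix.of fun p q => ⁅e p, e.repr τ q⁆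

theorem jac_apply (τ : E.T) (p q : n) : jac e τ p q = ⁅e p, e.repr τ q⁆ := rfl

theorem jac_add (τ σ : E.T) : jac e (τ + σ) = jac e τ + jac e σ := by
  ext p q; simp [jac]

theorem jac_smul_k (c : k) (τ : E.T) : jac e (c • τ) = c • jac e τ := by
  ext p q
  change ⁅e p, e.repr (c • τ) q⁆ = c • ⁅e p, e.repr τ q⁆
  rw [← algebraMap_smul E.A c τ, map_smul, Finsupp.smul_apply, smul_eq_mul, ← Algebra.smul_def]
  exact lie_smul c (e p) (e.repr τ q)

/-- The matrix `τ_p(a) t_q`. -/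
noncomputable def gradMat (a : E.A) (τ : E.T) : Matrix n n E.A :=
  Matrix.of fun p q => ⁅e p, a⁆ * e.repr τ q

theorem jac_smul (a : E.A) (τ : E.T) : jac e (a • τ) = a • jac e τ + gradMat e a τ := by
  ext p q; simp [jac, gradMat]

variable [Fintype n]

theorem anchor_eq_sum (τ : E.T) (a : E.A) : ⁅τ, a⁆ = ∑ q, e.repr τ q * ⁅e q, a⁆ := by
  conv_lhs => rw [← e.sum_repr τ, ← E.pair_del, map_sum, LinearMap.sum_apply]
  simp [E.pair_del]

theorem repr_lie (he : ∀ a b, ⁅e a, e b⁆ = 0) (τ σ : E.T) (b : n) :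
    e.repr ⁅τ, σ⁆ b = ⁅τ, e.repr σ b⁆ - ⁅σ, e.repr τ b⁆ := by
  have h₀ : ∀ p, ⁅τ, e p⁆ = -∑ q, ⁅e p, e.repr τ q⁆ • e q := fun p => by
    rw [← lie_skew]
    conv_lhs => rw [← e.sum_repr τ]
    rw [neg_inj, show ⁅e p, ∑ i, e.repr τ i • e i⁆ = ∑ i, ⁅e p, e.repr τ i • e i⁆ from
      map_sum (LieModule.toEnd k E.T E.T (e p)) _ _]
    simp [he]
  have h : ⁅τ, σ⁆ = ∑ q, (⁅τ, e.repr σ q⁆ - ⁅σ, e.repr τ q⁆) • e q := by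
    conv_lhs => rw [← e.sum_repr σ]
    rw [show ⁅τ, ∑ i, e.repr σ i • e i⁆ = ∑ i, ⁅τ, e.repr σ i • e i⁆ from
      map_sum (LieModule.toEnd k E.T E.T τ) _ _]
    simp only [LieRinehartRing.leibniz_smul_right, h₀, sub_smul, Finset.sum_add_distrib,
      Finset.sum_sub_distrib, smul_neg, Finset.sum_neg_distrib, anchor_eq_sum e σ,
      Finset.sum_smul, Finset.smul_sum, smul_smul]
    rw [Finset.sum_comm (f := fun x i => (e.repr σ i * ⁅e i, e.repr τ x⁆) • e x)]
    abel
  rw [h, e.repr_sum_self]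

theorem lie_frame (he : ∀ a b, ⁅e a, e b⁆ = 0) (p : n) (τ : E.T) (a : E.A) :
    ⁅e p, ⁅τ, a⁆⁆ = ⁅τ, ⁅e p, a⁆⁆ + ∑ q, jac e τ p q * ⁅e q, a⁆ := by
  rw [leibniz_lie, add_comm]
  congr 1
  rw [anchor_eq_sum e]
  refine Finset.sum_congr rfl fun q _ => ?_
  rw [repr_lie e he, e.repr_self]
  by_cases h : p = q
  · subst h; simp [lie_one, jac_apply]
  · simp [jac_apply, h]

/-- The connection that makes a commuting frame flat has no curvature and no torsion. -/
theorem jac_lie (he : ∀ a b, ⁅e a, e b⁆ = 0) (τ σ : E.T) :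
    jac e ⁅τ, σ⁆ = lieMat τ (jac e σ) - lieMat σ (jac e τ) + jac e τ * jac e σ
      - jac e σ * jac e τ := by
  ext p q
  simp only [jac_apply e ⁅τ, σ⁆, repr_lie e he, lie_sub, lie_frame e he p, Matrix.sub_apply,
    Matrix.add_apply, Matrix.mul_apply, lieMat, Matrix.map_apply, jac_apply]
  ring

theorem trace_gradMat (X : Matrix n n E.A) (a : E.A) (τ : E.T) :
    (X * gradMat e a τ).trace = ∑ p, ∑ q, X p q * ⁅e q, a⁆ * e.repr τ p := by
  simp only [Matrix.trace, Matrix.diag, Matrix.mul_apply, gradMat, Matrix.of_apply, mul_assoc]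

theorem lie_repr_eq (τ σ : E.T) (q : n) :
    ⁅τ, e.repr σ q⁆ = ∑ p, e.repr τ p * jac e σ p q := by
  rw [anchor_eq_sum e]; rfl

/-- `γ(a, τ) = ∑ t_b ∂(τ_b a)`. -/
noncomputable def frameGam (a : E.A) (τ : E.T) : E.Ω := ∑ b, e.repr τ b • E.del ⁅e b, a⁆

theorem pair_frameGam (he : ∀ a b, ⁅e a, e b⁆ = 0) (a : E.A) (τ σ : E.T) :
    E.pair σ (frameGam e a τ) = ⁅τ, ⁅σ, a⁆⁆ - (jac e σ * gradMat e a τ).trace := by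
  rw [trace_gradMat, anchor_eq_sum e τ]
  simp only [frameGam, map_sum, map_smul, pair_del, lie_frame e he, smul_eq_mul, mul_add,
    Finset.sum_add_distrib, Finset.mul_sum]
  rw [eq_sub_iff_add_eq]
  congr 1
  exact Finset.sum_congr rfl fun p _ => Finset.sum_congr rfl fun q _ => by ring

theorem frameGam_lie (he : ∀ a b, ⁅e a, e b⁆ = 0) (a : E.A) (τ σ : E.T) :
    frameGam e a ⁅τ, σ⁆ - frameGam e ⁅σ, a⁆ τ + ⁅σ, frameGam e a τ⁆ =
      -trDel (gradMat e a τ) (jac e σ) := by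
  have h : trDel (gradMat e a τ) (jac e σ) =
      ∑ b, ∑ q, (⁅e q, a⁆ * e.repr τ b) • E.del (jac e σ b q) := by
    rw [Finset.sum_comm]; rfl
  simp only [h, frameGam, lie_finset_sum_form, lie_smul_form, ← E.del_lie, repr_lie e he,
    lie_frame e he _ σ, lie_repr_eq e τ, map_add, map_sum, Derivation.leibniz, smul_add, sub_smul,
    Finset.sum_smul, Finset.smul_sum, Finset.sum_add_distrib, Finset.sum_sub_distrib, smul_smul]
  rw [Finset.sum_comm (f := fun x i => (e.repr τ i * jac e σ i x) • E.del ⁅e x, a⁆)]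
  simp only [mul_comm (e.repr τ _) ⁅_, a⁆]
  abel

theorem frameGam_smul (a b : E.A) (τ : E.T) : frameGam e a (b • τ) = b • frameGam e a τ := by
  simp [frameGam, Finset.smul_sum, mul_smul]

theorem frameGam_mul (a b : E.A) (τ : E.T) :
    frameGam e (a * b) τ = a • frameGam e b τ + b • frameGam e a τ + ⁅τ, a⁆ • E.del b
      + ⁅τ, b⁆ • E.del a := by
  simp only [frameGam, LieRinehartRing.leibniz_mul_right, smul_eq_mul, map_add, Derivation.leibniz,
    smul_add, Finset.sum_add_distrib, Finset.smul_sum, anchor_eq_sum e τ, Finset.sum_smul,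
    smul_smul, mul_comm]
  abel

/-- `γ` of a frame as a bilinear map. -/
noncomputable def frameGamHom : E.A →ₗ[k] E.T →ₗ[k] E.Ω :=
  LinearMap.mk₂ k (frameGam e) (fun a b τ => by simp [frameGam, Finset.sum_add_distrib])
    (fun c a τ => by
      simp only [frameGam, lie_smul, Derivation.map_smul, Finset.smul_sum]
      exact Finset.sum_congr rfl fun _ _ => smul_comm _ _ _)
    (fun a τ σ => by simp [frameGam, add_smul, Finset.sum_add_distrib])
    (fun c a τ => by
      rw [← algebraMap_smul E.A c τ, frameGam_smul, algebraMap_smul])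

/-- `⟨τ, σ⟩ = -tr(J(τ) J(σ))`. -/
noncomputable def frameIp : E.T →ₗ[k] E.T →ₗ[k] E.A :=
  LinearMap.mk₂ k (fun τ σ => -(jac e τ * jac e σ).trace)
    (fun τ τ' σ => by rw [jac_add, Matrix.add_mul, Matrix.trace_add, neg_add])
    (fun c τ σ => by rw [jac_smul_k, Matrix.smul_mul, Matrix.trace_smul, smul_neg])
    (fun τ τ' σ => by rw [jac_add, Matrix.mul_add, Matrix.trace_add, neg_add])
    (fun c τ σ => by rw [jac_smul_k, Matrix.mul_smul, Matrix.trace_smul, smul_neg])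

theorem frameIp_apply (τ σ : E.T) : frameIp e τ σ = -(jac e τ * jac e σ).trace := rfl

variable [Invertible (2 : k)]

/-- `c(τ, σ) = ½ tr(J(σ) ∂J(τ) - J(τ) ∂J(σ))`. -/
noncomputable def frameC : E.T →ₗ[k] E.T →ₗ[k] E.Ω :=
  LinearMap.mk₂ k (fun τ σ => (⅟2 : k) • (trDel (jac e σ) (jac e τ) - trDel (jac e τ) (jac e σ)))
    (fun τ τ' σ => by
      rw [← smul_add, jac_add, trDel_add_left, trDel_add_right]; congr 1; abel)
    (fun c τ σ => by
      rw [smul_comm c, jac_smul_k, trDel_smul_k_left, trDel_smul_k_right, smul_sub c])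
    (fun τ τ' σ => by
      rw [← smul_add, jac_add, trDel_add_left, trDel_add_right]; congr 1; abel)
    (fun c τ σ => by
      rw [smul_comm c, jac_smul_k, trDel_smul_k_left, trDel_smul_k_right, smul_sub c])

theorem frameC_apply (τ σ : E.T) : frameC e τ σ =
    (⅟2 : k) • (trDel (jac e σ) (jac e τ) - trDel (jac e τ) (jac e σ)) := rfl

theorem frame_A4 (he : ∀ a b, ⁅e a, e b⁆ = 0) (τ₁ τ₂ τ₃ : E.T) :
    frameIp e ⁅τ₁, τ₂⁆ τ₃ + frameIp e τ₂ ⁅τ₁, τ₃⁆ =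
      ⁅τ₁, frameIp e τ₂ τ₃⁆ - (⅟2 : k) • ⁅τ₂, frameIp e τ₁ τ₃⁆ - (⅟2 : k) • ⁅τ₃, frameIp e τ₁ τ₂⁆
        + E.pair τ₂ (frameC e τ₁ τ₃) + E.pair τ₃ (frameC e τ₁ τ₂) := by
  have t := VertexAlgebroid.two_mul_half (E := E)
  have sy : ∀ X Y : Matrix n n E.A, (X * Y).trace = (Y * X).trace := Matrix.trace_mul_comm
  -- traces are compared up to cyclic permutation
  have cy : ∀ X Y Z : Matrix n n E.A, (X * Y * Z).trace = (Z * X * Y).trace :=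
    Matrix.trace_mul_cycle
  simp only [frameIp_apply, frameC_apply, pair_smul_k, map_sub, pair_trDel, jac_lie e he,
    lie_neg, lie_trace, lieMat_mul, Matrix.trace_add, Matrix.trace_sub, Matrix.add_mul,
    Matrix.sub_mul, Matrix.mul_add, Matrix.mul_sub, VertexAlgebroid.half_smul_eq,
    ← Matrix.mul_assoc]
  have s₁ := sy (lieMat τ₂ (jac e τ₁)) (jac e τ₃)
  have s₂ := sy (lieMat τ₃ (jac e τ₁)) (jac e τ₂)
  linear_combination cy (jac e τ₂) (jac e τ₃) (jac e τ₁) + algebraMap k E.A ⅟2 * s₁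
    - algebraMap k E.A ⅟2 * s₂ - ((lieMat τ₂ (jac e τ₁) * jac e τ₃).trace
      + (jac e τ₂ * lieMat τ₃ (jac e τ₁)).trace) * t

theorem frame_A5 (he : ∀ a b, ⁅e a, e b⁆ = 0) (τ₁ τ₂ τ₃ : E.T) :
    E.dLie (fun τ σ => frameC e τ σ) τ₁ τ₂ τ₃ =
      -((⅟2 : k) • E.del (frameIp e ⁅τ₁, τ₂⁆ τ₃ + frameIp e ⁅τ₁, τ₃⁆ τ₂ - frameIp e ⁅τ₂, τ₃⁆ τ₁
        - ⁅τ₁, frameIp e τ₂ τ₃⁆ + ⁅τ₂, frameIp e τ₁ τ₃⁆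
        - (2 : k) • E.pair τ₃ (frameC e τ₁ τ₂))) := by
  have two : ∀ x : E.Ω, (⅟2 : k) • (2 : k) • x = x := fun x => by simp
  have ls : ∀ (τ : E.T) (x : E.Ω), ⁅τ, (⅟2 : k) • x⁆ = (⅟2 : k) • ⁅τ, x⁆ := fun τ x =>
    lie_smul _ _ _
  simp only [dLie, frameIp_apply, frameC_apply, pair_smul_k, map_sub, pair_trDel, jac_lie e he,
    lie_neg, lie_trace, lieMat_mul, Matrix.trace_add, Matrix.trace_sub, Matrix.add_mul,
    Matrix.sub_mul, map_add, map_neg, smul_invOf_smul, ls, lie_sub, lie_trDel]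
  simp only [← smul_add, ← smul_sub, ← smul_neg, del_trace_mul, trDel_sub_left, trDel_add_left,
    trDel_sub_right, trDel_add_right, trDel_mul_right]
  congr 1
  abel

/-- The vertex algebroid of a frame of commuting vector fields. -/
noncomputable def frameVA (he : ∀ a b, ⁅e a, e b⁆ = 0) : E.VertexAlgebroid where
  gam := frameGamHom e
  ip := frameIp e
  c := frameC e
  ip_symm τ σ := by rw [frameIp_apply, frameIp_apply, Matrix.trace_mul_comm]
  c_skew τ σ := by rw [frameC_apply, frameC_apply, ← smul_neg, neg_sub]
  A1 a b τ := by
    change frameGam e a (b • τ) = frameGam e (a * b) τ - a • frameGam e b τ - _ - _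
    rw [frameGam_smul, frameGam_mul]
    abel
  A2 a τ σ := by
    change _ = _ + E.pair σ (frameGam e a τ) - _
    rw [pair_frameGam e he, frameIp_apply, frameIp_apply, jac_smul, Matrix.add_mul,
      Matrix.trace_add, Matrix.trace_mul_comm (gradMat e a τ), Matrix.smul_mul, Matrix.trace_smul,
      smul_eq_mul]
    ring
  A3 a τ σ := by
    change _ = _ + frameGam e a ⁅τ, σ⁆ - frameGam e ⁅σ, a⁆ τ + ⁅σ, frameGam e a τ⁆
      - _ + _ - (⅟2 : k) • E.del (E.pair σ (frameGam e a τ))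
    have g := frameGam_lie e he a τ σ
    have hh := fun x : E.Ω => (half_add_half (k := k) x).symm
    have h := hh (trDel (gradMat e a τ) (jac e σ))
    rw [pair_frameGam e he, frameC_apply, frameC_apply, jac_smul, frameIp_apply, map_sub,
      del_trace_mul, trDel_add_left, trDel_add_right, trDel_smul_left, trDel_smul_right,
      Matrix.trace_mul_comm (jac e τ), smul_comm a]
    simp only [smul_sub, smul_add, neg_smul, smul_neg]
    linear_combination (norm := module) -g + h
  A4 := frame_A4 e he
  A5 := frame_A5 e he

end frame
end ExtLieAlgebroid

namespace ExtLieAlgebroid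

variable {k : Type v} [CommRing k] {E : ExtLieAlgebroid.{u, v} k}

/-! ### Forms with values in matrices -/

section perfect

variable (hp : E.IsPerfect)

include hp in
theorem IsPerfect.pair_ext {x y : E.Ω} (h : ∀ τ, E.pair τ x = E.pair τ y) : x = y :=
  hp.1 (LinearMap.ext h)

/-- The one-form with given pairings, over a perfect extended Lie algebroid. -/
noncomputable def IsPerfect.dual : (E.T →ₗ[E.A] E.A) ≃ₗ[E.A] E.Ω :=
  (LinearEquiv.ofBijective E.pair.flip hp).symm

theorem IsPerfect.pair_dual (f : E.T →ₗ[E.A] E.A) (τ : E.T) : E.pair τ (hp.dual f) = f τ :=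
  LinearMap.congr_fun ((LinearEquiv.ofBijective E.pair.flip hp).apply_symm_apply f) τ

end perfect

section mc

variable {n : Type*} [Fintype n]

/-- `tr([X, Y] Z)`, an alternating function of three matrices. -/
def triTrace (X Y Z : Matrix n n E.A) : E.A := ((X * Y - Y * X) * Z).trace

theorem triTrace_swap (X Y Z : Matrix n n E.A) : triTrace X Y Z = -triTrace Y X Z := by
  rw [triTrace, triTrace, ← Matrix.trace_neg, ← Matrix.neg_mul, neg_sub]

theorem triTrace_cycle (X Y Z : Matrix n n E.A) : triTrace X Y Z = triTrace Z X Y := by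
  simp only [triTrace, Matrix.sub_mul, Matrix.trace_sub]
  rw [Matrix.trace_mul_cycle X Y Z, Matrix.trace_mul_cycle X Z Y, Matrix.trace_mul_cycle Y X Z,
    Matrix.trace_mul_cycle Z Y X]

theorem triTrace_add_left (X X' Y Z : Matrix n n E.A) :
    triTrace (X + X') Y Z = triTrace X Y Z + triTrace X' Y Z := by
  simp only [triTrace, Matrix.sub_mul, Matrix.trace_sub, Matrix.add_mul, Matrix.mul_add,
    Matrix.trace_add]
  ring

theorem triTrace_sub_left (X X' Y Z : Matrix n n E.A) :
    triTrace (X - X') Y Z = triTrace X Y Z - triTrace X' Y Z := by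
  simp only [triTrace, Matrix.sub_mul, Matrix.trace_sub, Matrix.mul_sub]
  ring

theorem triTrace_sub_mid (X Y Y' Z : Matrix n n E.A) :
    triTrace X (Y - Y') Z = triTrace X Y Z - triTrace X Y' Z := by
  simp only [triTrace_swap X, triTrace_sub_left]; ring

theorem triTrace_add_right (X Y Z Z' : Matrix n n E.A) :
    triTrace X Y (Z + Z') = triTrace X Y Z + triTrace X Y Z' := by
  simp only [triTrace, Matrix.mul_add, Matrix.trace_add]

theorem triTrace_sub_right (X Y Z Z' : Matrix n n E.A) :
    triTrace X Y (Z - Z') = triTrace X Y Z - triTrace X Y Z' := by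
  simp only [triTrace, Matrix.mul_sub, Matrix.trace_sub]

theorem lie_triTrace (τ : E.T) (X Y Z : Matrix n n E.A) :
    ⁅τ, triTrace X Y Z⁆ = triTrace (lieMat τ X) Y Z + triTrace X (lieMat τ Y) Z
      + triTrace X Y (lieMat τ Z) := by
  rw [triTrace, lie_trace]
  simp only [triTrace, lieMat_mul, lieMat_sub_right, Matrix.sub_mul, Matrix.add_mul,
    Matrix.trace_sub, Matrix.trace_add]
  ring

theorem triTrace_jacobi (X Y Z W : Matrix n n E.A) :
    triTrace (X * Y - Y * X) Z W - triTrace (X * Z - Z * X) Y W + triTrace (Y * Z - Z * Y) X W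
      = 0 := by
  have h : (X * Y - Y * X) * Z - Z * (X * Y - Y * X) - ((X * Z - Z * X) * Y - Y * (X * Z - Z * X))
      + ((Y * Z - Z * Y) * X - X * (Y * Z - Z * Y)) = 0 := by noncomm_ring
  rw [triTrace, triTrace, triTrace, ← Matrix.trace_sub, ← Matrix.trace_add, ← Matrix.sub_mul,
    ← Matrix.add_mul, h, Matrix.zero_mul, Matrix.trace_zero]

/-- The Maurer–Cartan equation `dP + P ∧ P = 0` for a matrix valued one-form. -/
def IsMaurerCartan (P : E.T →ₗ[E.A] Matrix n n E.A) : Prop :=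
  ∀ τ σ, P ⁅τ, σ⁆ = lieMat τ (P σ) - lieMat σ (P τ) + (P τ * P σ - P σ * P τ)

/-- The Chern–Simons form `½ tr([P, P] P)` is closed. -/
theorem IsMaurerCartan.triTrace_closed {P : E.T →ₗ[E.A] Matrix n n E.A} (hP : IsMaurerCartan P)
    (τ₁ τ₂ τ₃ τ₄ : E.T) :
    ⁅τ₁, triTrace (P τ₂) (P τ₃) (P τ₄)⁆ - ⁅τ₂, triTrace (P τ₁) (P τ₃) (P τ₄)⁆
      + ⁅τ₃, triTrace (P τ₁) (P τ₂) (P τ₄)⁆ - ⁅τ₄, triTrace (P τ₁) (P τ₂) (P τ₃)⁆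
      - triTrace (P ⁅τ₁, τ₂⁆) (P τ₃) (P τ₄) + triTrace (P ⁅τ₁, τ₃⁆) (P τ₂) (P τ₄)
      - triTrace (P ⁅τ₂, τ₃⁆) (P τ₁) (P τ₄) - triTrace (P τ₂) (P τ₃) (P ⁅τ₁, τ₄⁆)
      + triTrace (P τ₁) (P τ₃) (P ⁅τ₂, τ₄⁆) - triTrace (P τ₁) (P τ₂) (P ⁅τ₃, τ₄⁆) = 0 := by
  have m : ∀ a b c d, triTrace (P a) (lieMat b (P c)) (P d) =
    -triTrace (lieMat b (P c)) (P a) (P d) := fun _ _ _ _ => triTrace_swap _ _ _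
  have r : ∀ a b c d, triTrace (P a) (P d) (lieMat b (P c)) =
    triTrace (lieMat b (P c)) (P a) (P d) := fun _ _ _ _ => triTrace_cycle _ _ _
  have j : ∀ a b c d : E.T, triTrace (P a) (P b) (P c * P d - P d * P c) =
      triTrace (P a * P b - P b * P a) (P c) (P d) := fun a b c d => by
    rw [triTrace_cycle (P a * P b - P b * P a), triTrace_cycle _ (P a * P b - P b * P a), triTrace,
      triTrace, Matrix.trace_mul_comm]
  have J := triTrace_jacobi (P τ₁) (P τ₂) (P τ₃) (P τ₄)
  have hP' : ∀ τ σ, P ⁅τ, σ⁆ = _ := hP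
  simp only [lie_triTrace, hP', triTrace_add_left, triTrace_sub_left, triTrace_add_right,
    triTrace_sub_right, m, r, j]
  simp only [triTrace_sub_left] at J
  linear_combination - 2 * J

variable (hp : E.IsPerfect)

/-- The one-form `tr(X P)` of a matrix `X` and a matrix valued one-form `P`. -/
noncomputable def trOne (P : E.T →ₗ[E.A] Matrix n n E.A) (X : Matrix n n E.A) : E.Ω :=
  hp.dual ((Matrix.traceLinearMap n E.A E.A).comp ((LinearMap.mulLeft E.A X).comp P))

theorem pair_trOne (P : E.T →ₗ[E.A] Matrix n n E.A) (X : Matrix n n E.A) (τ : E.T) :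
    E.pair τ (trOne hp P X) = (X * P τ).trace := hp.pair_dual _ τ

theorem trOne_add (P : E.T →ₗ[E.A] Matrix n n E.A) (X Y : Matrix n n E.A) :
    trOne hp P (X + Y) = trOne hp P X + trOne hp P Y :=
  hp.pair_ext fun τ => by
    rw [map_add, pair_trOne, pair_trOne, pair_trOne, Matrix.add_mul, Matrix.trace_add]

theorem trOne_smul (P : E.T →ₗ[E.A] Matrix n n E.A) (a : E.A) (X : Matrix n n E.A) :
    trOne hp P (a • X) = a • trOne hp P X :=
  hp.pair_ext fun τ => by
    rw [map_smul, pair_trOne, pair_trOne, Matrix.smul_mul, Matrix.trace_smul]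

theorem trOne_smul_k (P : E.T →ₗ[E.A] Matrix n n E.A) (c : k) (X : Matrix n n E.A) :
    trOne hp P (c • X) = c • trOne hp P X :=
  hp.pair_ext fun τ => by
    rw [pair_smul_k, pair_trOne, pair_trOne, Matrix.smul_mul, Matrix.trace_smul]

theorem pair_dTwo (η : E.TwoForm) (τ₁ τ₂ τ₃ : E.T) :
    E.pair τ₃ ((E.dTwo η).val τ₁ τ₂) =
      ⁅τ₁, E.pair τ₃ (η.val τ₂)⁆ - ⁅τ₂, E.pair τ₃ (η.val τ₁)⁆ + ⁅τ₃, E.pair τ₂ (η.val τ₁)⁆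
        - E.pair τ₃ (η.val ⁅τ₁, τ₂⁆) + E.pair τ₂ (η.val ⁅τ₁, τ₃⁆) - E.pair τ₁ (η.val ⁅τ₂, τ₃⁆) := by
  rw [dTwo_val]
  simp only [map_add, map_sub, map_neg, pair_lie, pair_del]
  rw [η.skew τ₁ τ₂, lie_neg, η.skew ⁅τ₁, τ₃⁆, η.skew ⁅τ₂, τ₃⁆]
  ring

variable [Invertible (2 : k)]

/-- The Chern–Simons three-form `½ tr([P, P] P)`. -/
noncomputable def csForm {P : E.T →ₗ[E.A] Matrix n n E.A} (hP : IsMaurerCartan P) :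
    E.ClosedThreeForm :=
  ⟨LinearMap.mk₂ E.A (fun τ σ => (⅟2 : k) • trOne hp P (P τ * P σ - P σ * P τ))
    (fun τ τ' σ => by
      rw [← smul_add, ← trOne_add, map_add, Matrix.add_mul, Matrix.mul_add]; congr 2; abel)
    (fun a τ σ => by
      rw [smul_comm a, ← trOne_smul, map_smul, Matrix.smul_mul, Matrix.mul_smul, smul_sub])
    (fun τ τ' σ => by
      rw [← smul_add, ← trOne_add, map_add, Matrix.add_mul, Matrix.mul_add]; congr 2; abel)
    (fun a τ σ => by
      rw [smul_comm a, ← trOne_smul, map_smul, Matrix.smul_mul, Matrix.mul_smul, smul_sub]), by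
    have pr : ∀ τ σ ν, E.pair ν ((⅟2 : k) • trOne hp P (P τ * P σ - P σ * P τ)) =
        (⅟2 : k) • triTrace (P τ) (P σ) (P ν) := fun τ σ ν => by
      rw [pair_smul_k, pair_trOne, triTrace]
    refine ⟨fun τ σ => ?_, fun τ₁ τ₂ τ₃ => ?_, fun τ₁ τ₂ τ₃ => ?_⟩
    · refine hp.pair_ext fun ν => ?_
      rw [LinearMap.mk₂_apply, LinearMap.mk₂_apply, pr, map_neg, pr, triTrace_swap, smul_neg]
    · rw [LinearMap.mk₂_apply, LinearMap.mk₂_apply, pr, pr, triTrace_cycle, triTrace_swap,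
        triTrace_cycle (P τ₁), smul_neg]
    · refine hp.pair_ext fun τ₄ => ?_
      have h := congrArg ((⅟2 : k) • ·) (hP.triTrace_closed τ₁ τ₂ τ₃ τ₄)
      have c : ∀ (τ : E.T) (a : E.A), ⁅τ, (⅟2 : k) • a⁆ = (⅟2 : k) • ⁅τ, a⁆ := fun τ a =>
        lie_smul (⅟2 : k) τ a
      simp only [dLie, LinearMap.mk₂_apply, map_sub, map_add, map_zero, pair_lie, pair_del, pr, c,
        smul_add, smul_sub, smul_zero] at h ⊢
      rw [triTrace_cycle (P τ₁) (P τ₂) (P τ₃), triTrace_cycle (P τ₃) (P τ₁)] at h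
      rw [← h]
      abel⟩

theorem pair_csForm {P : E.T →ₗ[E.A] Matrix n n E.A} (hP : IsMaurerCartan P) (τ σ ν : E.T) :
    E.pair ν ((csForm hp hP).val τ σ) = (⅟2 : k) • triTrace (P τ) (P σ) (P ν) := by
  change E.pair ν ((⅟2 : k) • trOne hp P (P τ * P σ - P σ * P τ)) = _
  rw [pair_smul_k, pair_trOne, triTrace]

/-- The two-form `α(τ, σ) = ½ tr(N(τ) P(σ) - P(τ) N(σ))`. -/
noncomputable def acForm (P N : E.T →ₗ[E.A] Matrix n n E.A) : E.TwoForm :=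
  ⟨{ toFun := fun τ => (⅟2 : k) • (trOne hp P (N τ) - trOne hp N (P τ))
     map_add' := fun τ σ => by
      rw [← smul_add, map_add, map_add, trOne_add, trOne_add]; congr 1; abel
     map_smul' := fun a τ => by
      rw [map_smul, map_smul, trOne_smul, trOne_smul, ← smul_sub, RingHom.id_apply,
        smul_comm] }, fun τ σ => by
    change E.pair τ ((⅟2 : k) • (trOne hp P (N σ) - trOne hp N (P σ))) =
      -E.pair σ ((⅟2 : k) • (trOne hp P (N τ) - trOne hp N (P τ)))
    rw [pair_smul_k, pair_smul_k, map_sub, map_sub, pair_trOne, pair_trOne, pair_trOne, pair_trOne,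
      ← smul_neg, Matrix.trace_mul_comm (N σ), Matrix.trace_mul_comm (P σ), neg_sub]⟩

theorem pair_acForm (P N : E.T →ₗ[E.A] Matrix n n E.A) (τ σ : E.T) :
    E.pair σ ((acForm hp P N).val τ) = (⅟2 : k) • ((N τ * P σ).trace - (P τ * N σ).trace) := by
  change E.pair σ ((⅟2 : k) • (trOne hp P (N τ) - trOne hp N (P τ))) = _
  rw [pair_smul_k, map_sub, pair_trOne, pair_trOne]

/-- The Polyakov–Wiegmann identity: the Chern–Simons form is additive up to an exact term. -/
theorem pair_dTwo_acForm {P N : E.T →ₗ[E.A] Matrix n n E.A} (hP : IsMaurerCartan P)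
    (hN : IsMaurerCartan N) (τ₁ τ₂ τ₃ : E.T) :
    E.pair τ₃ ((E.dTwo (acForm hp P N)).val τ₁ τ₂) = (⅟2 : k) •
      (triTrace (P τ₁) (P τ₂) (P τ₃) - triTrace (P τ₁ - N τ₁) (P τ₂ - N τ₂) (P τ₃ - N τ₃)
        - triTrace (N τ₁) (N τ₂) (N τ₃)) := by
  have c : ∀ (τ : E.T) (a : E.A), ⁅τ, (⅟2 : k) • a⁆ = (⅟2 : k) • ⁅τ, a⁆ := fun τ a =>
    lie_smul (⅟2 : k) τ a
  have hP' : ∀ τ σ, P ⁅τ, σ⁆ = _ := hP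
  have hN' : ∀ τ σ, N ⁅τ, σ⁆ = _ := hN
  have s₁ : ∀ a b, (P a * N b).trace = (N b * P a).trace := fun _ _ => Matrix.trace_mul_comm _ _
  have s₃ : ∀ a b c, (lieMat b (P c) * N a).trace = (N a * lieMat b (P c)).trace :=
    fun _ _ _ => Matrix.trace_mul_comm _ _
  have e₁ : ∀ X Y Z : Matrix n n E.A, triTrace X Y Z = (X * Y * Z).trace - (Y * X * Z).trace :=
    fun X Y Z => by rw [triTrace, Matrix.sub_mul, Matrix.trace_sub]
  have n₁ : ∀ a b c, triTrace (P a) (N b) (P c) =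
      -((P a * P c * N b).trace - (P c * P a * N b).trace) :=
    fun a b c => by rw [triTrace_swap, triTrace_cycle, triTrace_cycle, e₁]
  have n₂ : ∀ a b c, triTrace (N a) (P b) (P c) =
      (P b * P c * N a).trace - (P c * P b * N a).trace :=
    fun a b c => by rw [triTrace_cycle, triTrace_cycle, e₁]
  have n₃ : ∀ a b c, triTrace (N a) (P b) (N c) =
      -((N a * N c * P b).trace - (N c * N a * P b).trace) :=
    fun a b c => by rw [triTrace_swap, triTrace_cycle, triTrace_cycle, e₁]
  have n₄ : ∀ a b c, triTrace (P a) (N b) (N c) =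
      (N b * N c * P a).trace - (N c * N b * P a).trace :=
    fun a b c => by rw [triTrace_cycle, triTrace_cycle, e₁]
  rw [pair_dTwo]
  simp only [pair_acForm, c, ← smul_add, ← smul_sub]
  congr 1
  simp only [triTrace_sub_left, triTrace_sub_mid, triTrace_sub_right, n₁, n₂, n₃, n₄,
    e₁ (P _) (P _) (N _), e₁ (N _) (N _) (P _), lie_sub, lie_trace, lieMat_mul, hP', hN',
    Matrix.add_mul, Matrix.sub_mul, Matrix.trace_add, Matrix.trace_sub, s₁, s₃]
  ring

end mc
/-! ### Change of frame -/

section frames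

variable {l m n : Type*} [Fintype l] [Fintype m] [Fintype n] [DecidableEq l] [DecidableEq m]
  [DecidableEq n] (e : Module.Basis n E.A E.T) (f : Module.Basis m E.A E.T)
  (g : Module.Basis l E.A E.T)

/-- The matrix `φ` with `f_a = ∑ φ_ab e_b`. -/
noncomputable def transMat : Matrix m n E.A := Matrix.of fun a b => e.repr (f a) b

theorem repr_eq_transMat (τ : E.T) (b : n) :
    e.repr τ b = ∑ a, f.repr τ a * transMat e f a b := by
  conv_lhs => rw [← f.sum_repr τ]
  rw [map_sum, Finsupp.finsetSum_apply]
  simp [transMat]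

theorem transMat_mul : transMat f g * transMat e f = transMat e g := by
  ext a b
  rw [Matrix.mul_apply]
  exact (repr_eq_transMat e f (g a) b).symm

theorem transMat_self : transMat e e = 1 := by
  ext a b
  simp [transMat, Matrix.one_apply, Finsupp.single_apply]

theorem transMat_mul_self : transMat f e * transMat e f = 1 := by
  rw [transMat_mul, transMat_self]

/-- The Maurer–Cartan form `φ⁻¹ τ(φ)` of a change of frame. -/
noncomputable def mcForm : E.T →ₗ[E.A] Matrix n n E.A where
  toFun τ := transMat f e * lieMat τ (transMat e f)
  map_add' τ σ := by rw [lieMat_add_left, Matrix.mul_add]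
  map_smul' a τ := by rw [lieMat_smul_left, Matrix.mul_smul, RingHom.id_apply]

theorem mcForm_apply (τ : E.T) : mcForm e f τ = transMat f e * lieMat τ (transMat e f) := rfl

theorem lieMat_transMat (τ : E.T) :
    lieMat τ (transMat e f) = transMat e f * mcForm e f τ := by
  rw [mcForm_apply, ← Matrix.mul_assoc, transMat_mul_self, Matrix.one_mul]

theorem lieMat_transMat_inv (τ : E.T) :
    lieMat τ (transMat f e) = -(mcForm e f τ * transMat f e) := by
  have h := congrArg (fun M => lieMat τ M * transMat f e) (transMat_mul_self e f)
  simp only [lieMat_mul, lieMat_one, Matrix.zero_mul, Matrix.add_mul] at h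
  rw [Matrix.mul_assoc, transMat_mul_self f e, Matrix.mul_one] at h
  exact eq_neg_of_add_eq_zero_left h

theorem isMaurerCartan_mcForm : IsMaurerCartan (mcForm e f) := by
  intro τ σ
  rw [mcForm_apply e f ⁅τ, σ⁆, lieMat_lie, Matrix.mul_sub]
  have h : ∀ τ σ, transMat f e * lieMat τ (lieMat σ (transMat e f)) =
      lieMat τ (mcForm e f σ) + mcForm e f τ * mcForm e f σ := fun τ σ => by
    rw [lieMat_transMat e f σ, lieMat_mul, lieMat_transMat, Matrix.mul_add, ← Matrix.mul_assoc,
      ← Matrix.mul_assoc, ← Matrix.mul_assoc, transMat_mul_self, Matrix.one_mul, Matrix.one_mul]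
    abel
  rw [h, h]
  abel

theorem mcForm_symm (τ : E.T) :
    mcForm f e τ = -(lieMat τ (transMat e f) * transMat f e) := by
  rw [mcForm_apply, lieMat_transMat_inv, Matrix.mul_neg, lieMat_transMat, Matrix.mul_assoc]

theorem mcForm_conj (τ : E.T) :
    mcForm e f τ = -(transMat f e * mcForm f e τ * transMat e f) := by
  rw [mcForm_symm e f, Matrix.mul_neg, Matrix.neg_mul, neg_neg, Matrix.mul_assoc, Matrix.mul_assoc,
    transMat_mul_self, Matrix.mul_one, mcForm_apply]

/-- The cocycle property of Maurer–Cartan forms. -/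
theorem mcForm_trans (τ : E.T) :
    mcForm e g τ = mcForm e f τ + transMat f e * mcForm f g τ * transMat e f := by
  have h : ∀ X : Matrix m n E.A, transMat g f * (transMat f g * X) = X := fun X => by
    rw [← Matrix.mul_assoc, transMat_mul_self, Matrix.one_mul]
  rw [mcForm_apply e g, ← transMat_mul e f g, lieMat_mul, ← transMat_mul g f e, lieMat_transMat f g]
  simp only [Matrix.mul_add, Matrix.mul_assoc, h, mcForm_apply e f]
  rw [add_comm]

theorem triTrace_conj (X Y Z : Matrix m m E.A) :
    triTrace (transMat f e * X * transMat e f) (transMat f e * Y * transMat e f)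
      (transMat f e * Z * transMat e f) = triTrace X Y Z := by
  have h : ∀ X Y : Matrix m m E.A, transMat f e * X * transMat e f *
      (transMat f e * Y * transMat e f) = transMat f e * (X * Y) * transMat e f := fun X Y => by
    rw [Matrix.mul_assoc (transMat f e * X), ← Matrix.mul_assoc (transMat e f),
      ← Matrix.mul_assoc (transMat e f), transMat_mul_self f e, Matrix.one_mul, ← Matrix.mul_assoc,
      Matrix.mul_assoc (transMat f e)]
  rw [triTrace, h, h, ← Matrix.sub_mul, ← Matrix.mul_sub, h, Matrix.trace_mul_cycle,
    transMat_mul_self f e, Matrix.one_mul, triTrace]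

theorem triTrace_neg (X Y Z : Matrix m m E.A) : triTrace (-X) (-Y) (-Z) = -triTrace X Y Z := by
  simp [triTrace]

theorem trace_conj (X : Matrix m m E.A) (Y : Matrix n n E.A) :
    (transMat f e * X * transMat e f * Y).trace =
      (X * (transMat e f * Y * transMat f e)).trace := by
  rw [Matrix.mul_assoc, Matrix.mul_assoc, Matrix.trace_mul_comm, Matrix.mul_assoc]

variable [Invertible (2 : k)] (hp : E.IsPerfect)

/-- The Atiyah–Chern–Simons two-form of three frames. -/
noncomputable def acsAlpha : E.TwoForm := acForm hp (mcForm f g) (mcForm f e)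

/-- The Atiyah–Chern–Simons three-form of two frames. -/
noncomputable def acsBeta : E.ClosedThreeForm := csForm hp (isMaurerCartan_mcForm e f)

theorem pair_acsBeta (τ₁ τ₂ τ₃ : E.T) : E.pair τ₃ ((acsBeta e f hp).val τ₁ τ₂) =
    (⅟2 : k) • triTrace (mcForm e f τ₁) (mcForm e f τ₂) (mcForm e f τ₃) := pair_csForm _ _ _ _ _

/-- `α` is half the antisymmetrization of `tr(φ_fg⁻¹ τ(φ_fg) σ(φ_ef) φ_ef⁻¹)`. -/
theorem pair_acsAlpha (τ σ : E.T) : E.pair σ ((acsAlpha e f g hp).val τ) =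
    (⅟2 : k) • (((transMat g f * lieMat τ (transMat f g)) *
        (lieMat σ (transMat e f) * transMat f e)).trace
      - ((transMat g f * lieMat σ (transMat f g)) *
        (lieMat τ (transMat e f) * transMat f e)).trace) := by
  rw [acsAlpha, pair_acForm, mcForm_symm e f, mcForm_symm e f, Matrix.mul_neg, Matrix.neg_mul,
    Matrix.trace_neg, Matrix.trace_neg, mcForm_apply, mcForm_apply,
    Matrix.trace_mul_comm (lieMat τ (transMat e f) * transMat f e)]
  congr 1
  ring

theorem pair_acsAlpha_mcForm (τ σ : E.T) : E.pair σ ((acsAlpha e f g hp).val τ) =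
    (⅟2 : k) • ((mcForm f e τ * mcForm f g σ).trace - (mcForm f g τ * mcForm f e σ).trace) :=
  pair_acForm _ _ _ _ _

/-- The forms `β` are conjugation invariant, so that all of them can be computed in the middle
frame `f`, where the Maurer–Cartan form of `(e, g)` becomes the difference of those of `(f, g)`
and `(f, e)`. -/
theorem dTwo_acsAlpha :
    E.dTwo (acsAlpha e f g hp) = acsBeta f g hp - acsBeta e g hp + acsBeta e f hp := by
  refine ClosedThreeForm.ext fun τ₁ τ₂ => hp.pair_ext fun τ₃ => ?_
  rw [acsAlpha, pair_dTwo_acForm hp (isMaurerCartan_mcForm f g) (isMaurerCartan_mcForm f e),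
    ClosedThreeForm.add_val, ClosedThreeForm.sub_val]
  simp only [LinearMap.add_apply, LinearMap.sub_apply, map_add, map_sub, pair_acsBeta]
  have h : ∀ τ, mcForm e g τ =
      transMat f e * (mcForm f g τ - mcForm f e τ) * transMat e f := fun τ => by
    rw [mcForm_trans e f g, mcForm_conj e f, Matrix.mul_sub, Matrix.sub_mul]
    abel
  simp only [h, triTrace_conj]
  simp only [mcForm_conj e f, triTrace_neg, triTrace_conj, smul_sub, smul_neg]
  abel

/-- The Čech cocycle property of `α`, from that of the Maurer–Cartan forms. -/
theorem acsAlpha_cocycle {p : Type*} [Fintype p] [DecidableEq p] (q : Module.Basis p E.A E.T) :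
    acsAlpha f g q hp - acsAlpha e g q hp + acsAlpha e f q hp - acsAlpha e f g hp = 0 := by
  refine TwoForm.ext fun τ => hp.pair_ext fun σ => ?_
  simp only [TwoForm.add_val, TwoForm.sub_val, LinearMap.add_apply, LinearMap.sub_apply, map_add,
    map_sub, TwoForm.zero_val, LinearMap.zero_apply, map_zero, pair_acsAlpha_mcForm,
    ← smul_add, ← smul_sub]
  refine (congrArg _ ?_).trans (smul_zero (⅟2 : k))
  rw [mcForm_trans g f e τ, mcForm_trans g f e σ, mcForm_trans f g q τ, mcForm_trans f g q σ]
  simp only [Matrix.add_mul, Matrix.mul_add, Matrix.trace_add, trace_conj]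
  have h : ∀ (X : Matrix l l E.A) (Y : Matrix m m E.A),
      (Y * (transMat g f * X * transMat f g)).trace =
        ((transMat f g * Y * transMat g f) * X).trace := fun X Y => by
    rw [trace_conj]
  simp only [h]
  ring

end frames

/-! ### Comparison of the vertex algebroids of two commuting frames -/

section compare

variable {l m n : Type*} [Fintype l] [Fintype m] [Fintype n] [DecidableEq l] [DecidableEq m]
  [DecidableEq n] (e : Module.Basis n E.A E.T) (f : Module.Basis m E.A E.T)
  (g : Module.Basis l E.A E.T) (he : ∀ a b, ⁅e a, e b⁆ = 0) (hf : ∀ a b, ⁅f a, f b⁆ = 0)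
  (hg : ∀ a b, ⁅g a, g b⁆ = 0)

include he hf in
/-- Both frames being commuting, their connections are torsion-free, so that the Jacobian matrices
differ by the Maurer–Cartan form. -/
theorem transMat_mul_jac (τ : E.T) :
    transMat e f * jac e τ = jac f τ * transMat e f + lieMat τ (transMat e f) := by
  ext a b
  have h : ∀ c, ⁅f c, transMat e f a b⁆ = ⁅f a, transMat e f c b⁆ := fun c => by
    have h := repr_lie e he (f a) (f c) b
    rw [hf, map_zero, Finsupp.zero_apply] at h
    exact (sub_eq_zero.1 h.symm).symm
  have h₁ : (transMat e f * jac e τ) a b = ⁅f a, e.repr τ b⁆ := by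
    rw [anchor_eq_sum e]; rfl
  rw [h₁, repr_eq_transMat e f, lie_finset_sum, Matrix.add_apply, Matrix.mul_apply, lieMat,
    Matrix.map_apply, anchor_eq_sum f τ, ← Finset.sum_add_distrib]
  refine Finset.sum_congr rfl fun c _ => ?_
  rw [LieRinehartRing.leibniz_mul_right, h, smul_eq_mul, jac_apply]
  ring

include he hf in
theorem jac_conj (τ : E.T) :
    jac f τ = transMat e f * (jac e τ - mcForm e f τ) * transMat f e := by
  rw [Matrix.mul_sub, transMat_mul_jac e f he hf, ← lieMat_transMat, add_sub_cancel_right,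
    Matrix.mul_assoc, transMat_mul_self, Matrix.mul_one]

theorem transMat_mul_gradMat (a : E.A) (τ : E.T) :
    gradMat f a τ * transMat e f = transMat e f * gradMat e a τ := by
  ext p q
  simp only [Matrix.mul_apply, gradMat, Matrix.of_apply, repr_eq_transMat e f τ q,
    anchor_eq_sum e (f p) a, Finset.sum_mul, Finset.mul_sum]
  rw [Finset.sum_comm]
  refine Finset.sum_congr rfl fun c _ => Finset.sum_congr rfl fun d _ => ?_
  change _ = e.repr (f p) c * _
  ring

variable [Invertible (2 : k)] (hp : E.IsPerfect)

/-- The isomorphism, up to curvature, between the vertex algebroids of two commuting frames: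
`⟨ν, h(σ)⟩ = tr(M(ν) J(σ)) - ½ tr(M(ν) M(σ))`, where `M` is the Maurer–Cartan form of the change
of frame and `J` the Jacobian matrix. -/
noncomputable def frameMor : E.T →ₗ[k] E.Ω where
  toFun σ := trOne hp (mcForm e f) (jac e σ - (⅟2 : k) • mcForm e f σ)
  map_add' σ σ' := by
    rw [← trOne_add, jac_add, map_add, smul_add]; congr 1; abel
  map_smul' c σ := by
    rw [RingHom.id_apply, ← trOne_smul_k, smul_sub, jac_smul_k, ← algebraMap_smul E.A c σ, map_smul,
      algebraMap_smul, smul_comm c]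

theorem pair_frameMor (ν σ : E.T) : E.pair ν (frameMor e f hp σ) =
    (jac e σ * mcForm e f ν).trace - (⅟2 : k) • (mcForm e f σ * mcForm e f ν).trace := by
  change E.pair ν (trOne hp (mcForm e f) (jac e σ - (⅟2 : k) • mcForm e f σ)) = _
  rw [pair_trOne, Matrix.sub_mul, Matrix.trace_sub, Matrix.smul_mul, Matrix.trace_smul]

include he hf in
/-- The terms of `⟨τ₃, c(τ₁, τ₂)⟩` for the frame `f`, computed in the frame `e`. -/
theorem pair_frameC_conj (τ₁ τ₂ τ₃ : E.T) : (jac f τ₂ * lieMat τ₃ (jac f τ₁)).trace =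
    ((jac e τ₂ - mcForm e f τ₂) * (lieMat τ₃ (jac e τ₁) - lieMat τ₃ (mcForm e f τ₁)
      + mcForm e f τ₃ * (jac e τ₁ - mcForm e f τ₁)
      - (jac e τ₁ - mcForm e f τ₁) * mcForm e f τ₃)).trace := by
  have h : ∀ X : Matrix n n E.A, lieMat τ₃ (transMat e f * X * transMat f e) =
      transMat e f * (lieMat τ₃ X + mcForm e f τ₃ * X - X * mcForm e f τ₃) * transMat f e :=
    fun X => by
      rw [lieMat_mul, lieMat_mul, lieMat_transMat, lieMat_transMat_inv]
      simp only [Matrix.mul_add, Matrix.add_mul, Matrix.mul_sub, Matrix.sub_mul, Matrix.mul_neg,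
        Matrix.mul_assoc]
      abel
  rw [jac_conj e f he hf, jac_conj e f he hf, h, trace_conj, ← lieMat_sub_right]
  congr 2
  rw [← Matrix.mul_assoc, ← Matrix.mul_assoc, transMat_mul_self, Matrix.one_mul, Matrix.mul_assoc,
    transMat_mul_self, Matrix.mul_one]

theorem preMor_frameMor : VertexAlgebroid.PreMor (frameVA f hf) (frameVA e he)
    (frameMor e f hp) where
  gam a σ := by
    refine hp.pair_ext fun ν => ?_
    change _ = E.pair ν (_ - frameGam e a σ + frameGam f a σ)
    have h : (jac f ν * gradMat f a σ).trace =
        ((jac e ν - mcForm e f ν) * gradMat e a σ).trace := by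
      rw [jac_conj e f he hf, trace_conj, Matrix.mul_assoc, transMat_mul_gradMat,
        ← Matrix.mul_assoc (transMat f e), transMat_mul_self, Matrix.one_mul]
    rw [map_add, map_sub, (E.pair ν).map_smul, pair_frameGam e he, pair_frameGam f hf, h,
      pair_frameMor, pair_frameMor, jac_smul, map_smul, Matrix.add_mul, Matrix.smul_mul,
      Matrix.sub_mul, Matrix.smul_mul, Matrix.trace_add, Matrix.trace_sub, Matrix.trace_smul, Matrix.trace_smul,
      Matrix.trace_mul_comm (gradMat e a σ), smul_comm (⅟2 : k), smul_sub]
    ring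
  ip τ₁ τ₂ := by
    change -(jac f τ₁ * jac f τ₂).trace = -(jac e τ₁ * jac e τ₂).trace + _ + _
    have h : (jac f τ₁ * jac f τ₂).trace =
        ((jac e τ₁ - mcForm e f τ₁) * (jac e τ₂ - mcForm e f τ₂)).trace := by
      rw [jac_conj e f he hf, jac_conj e f he hf, trace_conj]
      congr 2
      rw [← Matrix.mul_assoc, ← Matrix.mul_assoc, transMat_mul_self, Matrix.one_mul,
        Matrix.mul_assoc, transMat_mul_self, Matrix.mul_one]
    rw [h, pair_frameMor, pair_frameMor, Matrix.trace_mul_comm (jac e τ₂)]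
    simp only [Matrix.sub_mul, Matrix.mul_sub, Matrix.trace_sub]
    have t := half_add_half (k := k) (mcForm e f τ₁ * mcForm e f τ₂).trace
    rw [Matrix.trace_mul_comm (mcForm e f τ₂)]
    linear_combination t

/-- The curvature of the isomorphism between the vertex algebroids of two commuting frames is the
Atiyah–Chern–Simons three-form on the nose. -/
theorem curvedMor_frameMor : VertexAlgebroid.CurvedMor (frameVA f hf) (frameVA e he)
    (frameMor e f hp) (acsBeta e f hp) where
  toPreMor := preMor_frameMor e f he hf hp
  c τ₁ τ₂ := by
    refine hp.pair_ext fun τ₃ => ?_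
    change E.pair τ₃ ((⅟2 : k) • (trDel (jac f τ₂) (jac f τ₁) - trDel (jac f τ₁) (jac f τ₂))) =
      E.pair τ₃ ((⅟2 : k) • (trDel (jac e τ₂) (jac e τ₁) - trDel (jac e τ₁) (jac e τ₂))
        + _ + _ - _ - _ + _ + _)
    have hM : ∀ τ σ, mcForm e f ⁅τ, σ⁆ = _ := isMaurerCartan_mcForm e f
    -- the cyclic identities bring every trace monomial in `J` and `M` to a normal form, in which the
    -- claim is an identity of polynomials with `2 · ½ = 1`
    have s₃ : ∀ a b c, (mcForm e f c * lieMat a (jac e b)).trace =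
      (lieMat a (jac e b) * mcForm e f c).trace := fun _ _ _ => Matrix.trace_mul_comm _ _
    have s₄ : ∀ a b c, (lieMat a (mcForm e f b) * mcForm e f c).trace =
      (mcForm e f c * lieMat a (mcForm e f b)).trace := fun _ _ _ => Matrix.trace_mul_comm _ _
    have c₁ : ∀ a b c, (jac e a * mcForm e f c * jac e b).trace =
      (jac e b * jac e a * mcForm e f c).trace := fun _ _ _ => Matrix.trace_mul_cycle _ _ _
    have c₃ : ∀ a b c, (mcForm e f a * jac e b * mcForm e f c).trace =
      (jac e b * mcForm e f c * mcForm e f a).trace := fun _ _ _ =>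
        (Matrix.trace_mul_cycle _ _ _).symm
    have c₄ : ∀ a b c, (mcForm e f a * mcForm e f b * jac e c).trace =
      (jac e c * mcForm e f a * mcForm e f b).trace := fun _ _ _ => Matrix.trace_mul_cycle _ _ _
    have c₅ : (mcForm e f τ₂ * mcForm e f τ₃ * mcForm e f τ₁).trace =
      (mcForm e f τ₁ * mcForm e f τ₂ * mcForm e f τ₃).trace := Matrix.trace_mul_cycle _ _ _
    have c₆ : (mcForm e f τ₁ * mcForm e f τ₃ * mcForm e f τ₂).trace =
      (mcForm e f τ₂ * mcForm e f τ₁ * mcForm e f τ₃).trace := Matrix.trace_mul_cycle _ _ _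
    have c : ∀ (τ : E.T) (a : E.A), ⁅τ, algebraMap k E.A ⅟2 * a⁆ = algebraMap k E.A ⅟2 * ⁅τ, a⁆ :=
      fun τ a => by simpa only [VertexAlgebroid.half_smul_eq] using lie_smul (⅟2 : k) τ a
    have t := VertexAlgebroid.two_mul_half (E := E)
    simp only [map_add, map_sub, pair_smul_k, pair_trDel, pair_frameC_conj e f he hf, pair_acsBeta,
      pair_del, pair_lie, pair_frameMor, lie_sub, c, triTrace, lie_trace, lieMat_mul, hM,
      jac_lie e he, Matrix.add_mul, Matrix.sub_mul, Matrix.mul_add, Matrix.mul_sub,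
      Matrix.trace_add, Matrix.trace_sub, ← Matrix.mul_assoc, VertexAlgebroid.half_smul_eq,
      s₃, s₄, c₁, c₃, c₄, c₅, c₆]
    generalize algebraMap k E.A ⅟2 = r at *
    linear_combination -((jac e τ₂ * lieMat τ₃ (mcForm e f τ₁)).trace
      - (jac e τ₁ * jac e τ₂ * mcForm e f τ₃).trace
      + (jac e τ₁ * mcForm e f τ₂ * mcForm e f τ₃).trace
      + (jac e τ₂ * mcForm e f τ₃ * mcForm e f τ₁).trace
      + (jac e τ₂ * jac e τ₁ * mcForm e f τ₃).trace
      - (jac e τ₁ * mcForm e f τ₃ * mcForm e f τ₂).trace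
      - (jac e τ₂ * mcForm e f τ₁ * mcForm e f τ₃).trace
      - (jac e τ₁ * lieMat τ₃ (mcForm e f τ₂)).trace) * t

include he hf in
/-- The failure of the isomorphisms `frameMor` to compose is the Atiyah–Chern–Simons two-form on the
nose. -/
theorem acsAlpha_eq_frameMor (σ : E.T) : (acsAlpha e f g hp).val σ =
    frameMor e f hp σ + frameMor f g hp σ - frameMor e g hp σ := by
  refine hp.pair_ext fun ν => ?_
  rw [map_sub, map_add, pair_acsAlpha_mcForm, pair_frameMor, pair_frameMor, pair_frameMor,
    jac_conj e f he hf, mcForm_trans e f g σ, mcForm_trans e f g ν, mcForm_conj f e]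
  have h : (transMat f e * mcForm f g σ * transMat e f *
      (transMat f e * mcForm f g ν * transMat e f)).trace =
      (mcForm f g σ * mcForm f g ν).trace := by
    rw [trace_conj, Matrix.mul_assoc (transMat f e), ← Matrix.mul_assoc (transMat e f),
      transMat_mul_self f e, Matrix.one_mul, Matrix.mul_assoc (mcForm f g ν),
      transMat_mul_self f e, Matrix.mul_one]
  rw [mcForm_conj f e]
  simp only [Matrix.neg_mul, Matrix.mul_neg, Matrix.trace_neg, trace_conj f e, Matrix.mul_add,
    Matrix.add_mul, Matrix.trace_add, h, Matrix.sub_mul, Matrix.trace_sub,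
    VertexAlgebroid.half_smul_eq]
  rw [Matrix.trace_mul_comm (mcForm f g σ), trace_conj f e,
    Matrix.trace_mul_comm (_ * _ * _) (mcForm e f ν)]
  linear_combination -(mcForm e f σ * (transMat f e * mcForm f g ν * transMat e f)).trace *
    VertexAlgebroid.two_mul_half (E := E)

end compare

end ExtLieAlgebroid

namespace ExtLieAlgebroid

variable {k : Type v} [CommRing k] {E F : ExtLieAlgebroid.{u, v} k}

/-! ### Naturality of the constructions on frames -/

namespace Hom

variable (r : Hom E F) {l m n : Type*} [Fintype l] [Fintype m] [Fintype n]
  [DecidableEq l] [DecidableEq m] [DecidableEq n]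
  {e : Module.Basis n E.A E.T} {e' : Module.Basis n F.A F.T} (he : ∀ a, r.onT (e a) = e' a)
  {f : Module.Basis m E.A E.T} {f' : Module.Basis m F.A F.T} (hf : ∀ a, r.onT (f a) = f' a)
  {g : Module.Basis l E.A E.T} {g' : Module.Basis l F.A F.T} (hg : ∀ a, r.onT (g a) = g' a)

include he

theorem repr_onT (τ : E.T) (a : n) : e'.repr (r.onT τ) a = r.onA (e.repr τ a) := by
  have h : r.onT τ = ∑ a, r.onA (e.repr τ a) • e' a := by
    conv_lhs => rw [← e.sum_repr τ]
    rw [map_sum]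
    exact Finset.sum_congr rfl fun a _ => by rw [r.map_smul_T, he]
  rw [h, e'.repr_sum_self]

theorem jac_onT (τ : E.T) : jac e' (r.onT τ) = (jac e τ).map r.onA := by
  ext p q
  rw [Matrix.map_apply, jac_apply, jac_apply, r.repr_onT he, ← he, r.map_lie_A]

theorem onΩ_frameGam (a : E.A) (τ : E.T) :
    r.onΩ (frameGam e a τ) = frameGam e' (r.onA a) (r.onT τ) := by
  simp only [frameGam, map_sum, r.map_smul_Ω, r.map_del, r.map_lie_A, r.repr_onT he, he]

omit he in
theorem onΩ_trDel (X : Matrix m n E.A) (Y : Matrix n m E.A) :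
    r.onΩ (trDel X Y) = trDel (X.map r.onA) (Y.map r.onA) := by
  simp only [trDel, map_sum, r.map_smul_Ω, r.map_del, Matrix.map_apply]

omit he in
theorem onA_trace (X : Matrix n n E.A) : r.onA X.trace = (X.map r.onA).trace := by
  simp [Matrix.trace, map_sum]

omit he in
theorem map_lieMat (τ : E.T) (X : Matrix m n E.A) :
    (lieMat τ X).map r.onA = lieMat (r.onT τ) (X.map r.onA) := by
  ext; simp [lieMat, r.map_lie_A]

include hf in
theorem transMat_map : transMat e' f' = (transMat e f).map r.onA := by
  ext a b
  change e'.repr (f' a) b = r.onA (e.repr (f a) b)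
  rw [← hf, r.repr_onT he]

include hf in
theorem mcForm_onT (τ : E.T) : mcForm e' f' (r.onT τ) = (mcForm e f τ).map r.onA := by
  rw [mcForm_apply, mcForm_apply, Matrix.map_mul, r.map_lieMat, ← r.transMat_map he hf,
    ← r.transMat_map hf he]

/-- Over a perfect target with a frame, one-forms are compared through their components. -/
theorem onΩ_eq (hp : F.IsPerfect) {x : E.Ω} {y : F.Ω}
    (h : ∀ a, r.onA (E.pair (e a) x) = F.pair (e' a) y) : r.onΩ x = y := by
  refine hp.1 (e'.ext fun a => ?_)
  change F.pair (e' a) (r.onΩ x) = F.pair (e' a) y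
  rw [← h, r.map_pair, he]

section half

variable [Invertible (2 : k)]

theorem onΩ_frameC (τ σ : E.T) :
    r.onΩ (frameC e τ σ) = frameC e' (r.onT τ) (r.onT σ) := by
  rw [frameC_apply, frameC_apply, map_smul, map_sub, r.onΩ_trDel, r.onΩ_trDel, r.jac_onT he,
    r.jac_onT he]

theorem onA_frameIp (τ σ : E.T) :
    r.onA (frameIp e τ σ) = frameIp e' (r.onT τ) (r.onT σ) := by
  rw [frameIp_apply, frameIp_apply, map_neg, r.onA_trace, Matrix.map_mul, r.jac_onT he,
    r.jac_onT he]

variable (hE : E.IsPerfect) (hF : F.IsPerfect)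

include hf in
theorem onΩ_frameMor (σ : E.T) :
    r.onΩ (frameMor e f hE σ) = frameMor e' f' hF (r.onT σ) := by
  refine r.onΩ_eq he hF fun a => ?_
  rw [pair_frameMor, pair_frameMor, ← he, r.mcForm_onT he hf, r.mcForm_onT he hf, r.jac_onT he,
    map_sub, map_smul, r.onA_trace, r.onA_trace, Matrix.map_mul, Matrix.map_mul]

include hf in
theorem onΩ_acsBeta (τ σ : E.T) :
    r.onΩ ((acsBeta e f hE).val τ σ) = (acsBeta e' f' hF).val (r.onT τ) (r.onT σ) := by
  refine r.onΩ_eq he hF fun a => ?_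
  rw [pair_acsBeta, pair_acsBeta, ← he, r.mcForm_onT he hf, r.mcForm_onT he hf, r.mcForm_onT he hf,
    map_smul, triTrace, triTrace, r.onA_trace, Matrix.map_mul,
    Matrix.map_sub _ (map_sub r.onA), Matrix.map_mul, Matrix.map_mul]

include hf hg in
theorem onΩ_acsAlpha (τ : E.T) :
    r.onΩ ((acsAlpha e f g hE).val τ) = (acsAlpha e' f' g' hF).val (r.onT τ) := by
  refine r.onΩ_eq he hF fun a => ?_
  rw [pair_acsAlpha_mcForm, pair_acsAlpha_mcForm, ← he, r.mcForm_onT hf hg, r.mcForm_onT hf hg,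
    r.mcForm_onT hf he, r.mcForm_onT hf he, map_smul, map_sub, r.onA_trace, r.onA_trace,
    Matrix.map_mul, Matrix.map_mul]

theorem onΩ_extendMor {𝒜 ℬ : E.VertexAlgebroid} {𝒜' ℬ' : F.VertexAlgebroid} (x : n → E.Ω)
    (h𝒜 : ∀ a τ, r.onΩ (𝒜.gam a τ) = 𝒜'.gam (r.onA a) (r.onT τ))
    (hℬ : ∀ a τ, r.onΩ (ℬ.gam a τ) = ℬ'.gam (r.onA a) (r.onT τ)) (τ : E.T) :
    r.onΩ (VertexAlgebroid.extendMor e 𝒜 ℬ x τ) =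
      VertexAlgebroid.extendMor e' 𝒜' ℬ' (fun i => r.onΩ (x i)) (r.onT τ) := by
  change r.onΩ (∑ i, _) = ∑ i, _
  rw [map_sum]
  refine Finset.sum_congr rfl fun i _ => ?_
  rw [map_add, map_sub, h𝒜, hℬ, r.map_smul_Ω, r.repr_onT he, he]

end half

end Hom

end ExtLieAlgebroid

namespace ExtLieSheaf

open ExtLieAlgebroid

variable {k : Type v} [CommRing k] {X : TopCat.{u}} {𝒯 : ExtLieSheaf.{u, v} k X}
  {U V W : Opens X}

/-! ### Sheaves of forms -/

theorem Form2.ext {f g : 𝒯.Form2 U} (h : ∀ W hW, f.app W hW = g.app W hW) : f = g :=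
  Subtype.ext (funext fun W => h W.1 W.2)

theorem Form3.ext {f g : 𝒯.Form3 U} (h : ∀ W hW, f.app W hW = g.app W hW) : f = g :=
  Subtype.ext (funext fun W => h W.1 W.2)

/-- A compatible family of two-forms as a section of `Ω²`. -/
def Form2.mk (f : ∀ W : Opens X, W ≤ U → (𝒯.sec W).TwoForm)
    (hf : ∀ (V W : Opens X) (hV : V ≤ U) (hWV : W ≤ V) (τ : (𝒯.sec V).T),
      (𝒯.res hWV).onΩ ((f V hV).val τ) = (f W (hWV.trans hV)).val ((𝒯.res hWV).onT τ)) :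
    𝒯.Form2 U :=
  (⟨fun W => f W.1 W.2, fun V W hWV τ => hf V.1 W.1 V.2 hWV τ⟩ : 𝒯.form2Submodule U)

/-- A compatible family of closed three-forms as a section of `Ω^{3,cl}`. -/
def Form3.mk (f : ∀ W : Opens X, W ≤ U → (𝒯.sec W).ClosedThreeForm)
    (hf : ∀ (V W : Opens X) (hV : V ≤ U) (hWV : W ≤ V) (τ σ : (𝒯.sec V).T),
      (𝒯.res hWV).onΩ ((f V hV).val τ σ) =
        (f W (hWV.trans hV)).val ((𝒯.res hWV).onT τ) ((𝒯.res hWV).onT σ)) :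
    𝒯.Form3 U :=
  (⟨fun W => f W.1 W.2, fun V W hWV τ => hf V.1 W.1 V.2 hWV τ⟩ : 𝒯.form3Submodule U)

section app

variable (h : W ≤ U)

theorem Form3.add_app (f g : 𝒯.Form3 U) : (f + g).app W h = f.app W h + g.app W h := rfl
theorem Form3.sub_app (f g : 𝒯.Form3 U) : (f - g).app W h = f.app W h - g.app W h := rfl
theorem LocHom.sub_app (f g : 𝒯.LocHom U) : (f - g).app W h = f.app W h - g.app W h := rfl

theorem d_app (f : 𝒯.Form2 U) : (𝒯.d U f).app W h = (𝒯.sec W).dTwo (f.app W h) := rfl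

theorem LocHom.res_app (hV : V ≤ U) (f : 𝒯.LocHom U) (hW : W ≤ V) :
    (f.res hV).app W hW = f.app W (hW.trans hV) := rfl

end app

/-- Two-forms over `E`, seen as `k`-linear maps. -/
def toHom (E : ExtLieAlgebroid.{u, v} k) : E.TwoForm →+ (E.T →ₗ[k] E.Ω) where
  toFun η := η.val.restrictScalars k
  map_zero' := rfl
  map_add' _ _ := rfl

theorem toHom_injective (E : ExtLieAlgebroid.{u, v} k) : Function.Injective (toHom E) :=
  fun _ _ h => TwoForm.ext fun τ => LinearMap.congr_fun h τ

theorem toLocHom_app (f : 𝒯.Form2 U) (h : W ≤ U) : f.toLocHom.app W h = toHom _ (f.app W h) := rfl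

theorem mem_of_cover {κ : Type*} {N : κ → Opens X} (hN : ∀ x ∈ U, ∃ j, x ∈ N j) (hW : W ≤ U) :
    ∀ x ∈ W, ∃ j, x ∈ W ⊓ N j := fun x hx =>
  (hN x (hW hx)).imp fun _ hj => ⟨hx, hj⟩

section glue

variable {κ : Type u} (N : κ → Opens X) (hN : ∀ x ∈ U, ∃ j, x ∈ N j)

include hN

theorem Form2.eq_of_cover {f g : 𝒯.Form2 U}
    (h : ∀ j (W : Opens X) (hW : W ≤ U), W ≤ N j → f.app W hW = g.app W hW) : f = g := by
  have e : f.toLocHom = g.toLocHom := LocHom.eq_of_cover N hN fun j W hW hj => by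
    rw [toLocHom_app, toLocHom_app, h j W hW hj]
  exact Form2.ext fun W hW => toHom_injective _ (congrArg (fun t : 𝒯.LocHom U => t.app W hW) e)

theorem Form3.eq_of_cover {f g : 𝒯.Form3 U}
    (h : ∀ j (W : Opens X) (hW : W ≤ U), W ≤ N j → f.app W hW = g.app W hW) : f = g := by
  refine Form3.ext fun W hW => ClosedThreeForm.ext fun τ σ => ?_
  refine 𝒯.ext_Ω (fun j => W ⊓ N j) (fun _ => inf_le_left) (mem_of_cover hN hW) _ _ fun j => ?_
  rw [f.nat hW, g.nat hW, h j _ _ inf_le_right]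

/-- Gluing of two-forms. -/
theorem Form2.exists_glue
    (f : ∀ (j : κ) (W : Opens X), W ≤ U → W ≤ N j → (𝒯.sec W).TwoForm)
    (nat : ∀ (j : κ) (V W : Opens X) (hU : V ≤ U) (hV : V ≤ N j) (hWV : W ≤ V) (τ : (𝒯.sec V).T),
      (𝒯.res hWV).onΩ ((f j V hU hV).val τ) =
        (f j W (hWV.trans hU) (hWV.trans hV)).val ((𝒯.res hWV).onT τ))
    (agree : ∀ (j j' : κ) (W : Opens X) (hU : W ≤ U) (hj : W ≤ N j) (hj' : W ≤ N j'),
      f j W hU hj = f j' W hU hj') :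
    ∃ g : 𝒯.Form2 U, ∀ (j : κ) (W : Opens X) (hU : W ≤ U) (hj : W ≤ N j),
      g.app W hU = f j W hU hj := by
  obtain ⟨g, hg⟩ := LocHom.exists_glue N hN (fun j W hU hj => toHom _ (f j W hU hj)) nat
    fun j j' W hU hj hj' => congrArg _ (agree j j' W hU hj hj')
  have hg' : ∀ j W (hU : W ≤ U) (hj : W ≤ N j) τ, g.app W hU τ = (f j W hU hj).val τ :=
    fun j W hU hj τ => LinearMap.congr_fun (hg j W hU hj) τ
  have l : ∀ {W : Opens X} (j : κ), W ⊓ N j ≤ W := fun _ => inf_le_left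
  refine ⟨Form2.mk
    (fun W hW => ⟨{ toFun := g.app W hW, map_add' := map_add _, map_smul' := ?_ }, ?_⟩)
    (fun _ _ hV hWV τ => g.nat hV hWV τ), fun j W hU hj => TwoForm.ext fun τ => hg' j W hU hj τ⟩
  · intro a τ
    refine 𝒯.ext_Ω (fun j => W ⊓ N j) l (mem_of_cover hN hW) _ _ fun j => ?_
    rw [RingHom.id_apply, g.nat, (𝒯.res _).map_smul_T, (𝒯.res _).map_smul_Ω, g.nat,
      hg' j _ _ inf_le_right, hg' j _ _ inf_le_right, map_smul]
  · intro τ σ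
    change (𝒯.sec W).pair τ (g.app W hW σ) = -(𝒯.sec W).pair σ (g.app W hW τ)
    refine 𝒯.ext_A (fun j => W ⊓ N j) l (mem_of_cover hN hW) _ _ fun j => ?_
    rw [map_neg, (𝒯.res _).map_pair, (𝒯.res _).map_pair, g.nat, g.nat, hg' j _ _ inf_le_right,
      hg' j _ _ inf_le_right, TwoForm.skew]

/-- Gluing of closed three-forms. -/
theorem Form3.exists_glue
    (f : ∀ (j : κ) (W : Opens X), W ≤ U → W ≤ N j → (𝒯.sec W).ClosedThreeForm)
    (nat : ∀ (j : κ) (V W : Opens X) (hU : V ≤ U) (hV : V ≤ N j) (hWV : W ≤ V)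
      (τ σ : (𝒯.sec V).T), (𝒯.res hWV).onΩ ((f j V hU hV).val τ σ) =
        (f j W (hWV.trans hU) (hWV.trans hV)).val ((𝒯.res hWV).onT τ) ((𝒯.res hWV).onT σ))
    (agree : ∀ (j j' : κ) (W : Opens X) (hU : W ≤ U) (hj : W ≤ N j) (hj' : W ≤ N j'),
      f j W hU hj = f j' W hU hj') :
    ∃ g : 𝒯.Form3 U, ∀ (j : κ) (W : Opens X) (hU : W ≤ U) (hj : W ≤ N j),
      g.app W hU = f j W hU hj := by
  have l : ∀ {W : Opens X} (j : κ), W ⊓ N j ≤ W := fun _ => inf_le_left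
  have key : ∀ (W : Opens X) (hW : W ≤ U) (τ σ : (𝒯.sec W).T), ∃! t : (𝒯.sec W).Ω,
      ∀ j, (𝒯.res (inf_le_left : W ⊓ N j ≤ W)).onΩ t =
        (f j (W ⊓ N j) (inf_le_left.trans hW) inf_le_right).val ((𝒯.res inf_le_left).onT τ)
          ((𝒯.res inf_le_left).onT σ) := by
    intro W hW τ σ
    refine 𝒯.glue_Ω (fun j => W ⊓ N j) l (mem_of_cover hN hW) _ fun i j => ?_
    rw [nat, nat, res_res_T, res_res_T, res_res_T, res_res_T, agree i j _ _ _ _]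
  choose t ht using fun W hW τ σ => (key W hW τ σ).exists
  have uniq : ∀ W hW τ σ s, (∀ j, (𝒯.res (inf_le_left : W ⊓ N j ≤ W)).onΩ s =
        (f j (W ⊓ N j) (inf_le_left.trans hW) inf_le_right).val ((𝒯.res inf_le_left).onT τ)
          ((𝒯.res inf_le_left).onT σ)) → t W hW τ σ = s :=
    fun W hW τ σ s hs => (key W hW τ σ).unique (ht W hW τ σ) hs
  have tnat : ∀ (V W : Opens X) (hV : V ≤ U) (hWV : W ≤ V) (τ σ : (𝒯.sec V).T),
      (𝒯.res hWV).onΩ (t V hV τ σ) =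
        t W (hWV.trans hV) ((𝒯.res hWV).onT τ) ((𝒯.res hWV).onT σ) := by
    intro V W hV hWV τ σ
    refine (uniq _ _ _ _ _ fun j => ?_).symm
    rw [res_res_Ω, ← res_res_Ω 𝒯 (inf_le_left : V ⊓ N j ≤ V)
      (le_inf (inf_le_left.trans hWV) inf_le_right), ht, nat, res_res_T, res_res_T, res_res_T,
      res_res_T]
  have tf : ∀ (j : κ) (W : Opens X) (hU : W ≤ U) (hj : W ≤ N j) (τ σ : (𝒯.sec W).T),
      t W hU τ σ = (f j W hU hj).val τ σ := fun j W hU hj τ σ => uniq _ _ _ _ _ fun j' => by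
    rw [nat, agree j j' _ _ _ _]
  refine ⟨Form3.mk (fun W hW => ⟨LinearMap.mk₂ _ (t W hW)
    (fun a b c => uniq _ _ _ _ _ fun j => by
      rw [map_add, ht, ht, map_add, map_add, LinearMap.add_apply])
    (fun a b c => uniq _ _ _ _ _ fun j => by
      rw [(𝒯.res _).map_smul_Ω, ht, (𝒯.res _).map_smul_T, map_smul, LinearMap.smul_apply])
    (fun a b c => uniq _ _ _ _ _ fun j => by rw [map_add, ht, ht, map_add, map_add])
    (fun a b c => uniq _ _ _ _ _ fun j => by
      rw [(𝒯.res _).map_smul_Ω, ht, (𝒯.res _).map_smul_T, map_smul]),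
    fun τ σ => uniq _ _ _ _ _ fun j => by
      rw [map_neg, LinearMap.mk₂_apply, ht, ClosedThreeForm.skew, neg_neg], ?_, ?_⟩) tnat,
    fun j W hU hj => ClosedThreeForm.ext (tf j W hU hj)⟩
  · intro τ₁ τ₂ τ₃
    rw [LinearMap.mk₂_apply, LinearMap.mk₂_apply]
    refine 𝒯.ext_A (fun j => W ⊓ N j) l (mem_of_cover hN hW) _ _ fun j => ?_
    rw [map_neg, (𝒯.res _).map_pair, (𝒯.res _).map_pair, ht, ht, ClosedThreeForm.skew']
  · intro τ₁ τ₂ τ₃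
    refine 𝒯.ext_Ω (fun j => W ⊓ N j) l (mem_of_cover hN hW) _ _ fun j => ?_
    refine Eq.trans ?_ (((f j (W ⊓ N j) (inf_le_left.trans hW) inf_le_right).closed
      ((𝒯.res inf_le_left).onT τ₁) ((𝒯.res inf_le_left).onT τ₂)
      ((𝒯.res inf_le_left).onT τ₃)).trans (map_zero _).symm)
    simp only [dLie, LinearMap.mk₂_apply, map_sub, map_add, (𝒯.res _).map_lie_Ω, (𝒯.res _).map_del,
      (𝒯.res _).map_pair, ht, LieHom.map_lie]

end glue

/-! ### Perfectness over the domain of a frame -/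

variable {n m l : ℕ}

/-- Over a regular sheaf, perfectness, which is only a local condition, holds over every open set
over which `T` has a frame: a linear form on `T` is determined by finitely many values, which are
represented locally, and the representing one-forms glue. -/
theorem Frame.isPerfect (h𝒯 : 𝒯.IsRegular) (F : 𝒯.Frame U n) (W : Opens X) (hW : W ≤ U) :
    (𝒯.sec W).IsPerfect := by
  choose N hxN hN _ using h𝒯
  have hp : ∀ x, (𝒯.sec (W ⊓ N x)).IsPerfect := fun x => hN x _ inf_le_right
  have l : ∀ x, W ⊓ N x ≤ W := fun _ => inf_le_left
  have c : ∀ x ∈ W, ∃ j, x ∈ W ⊓ N j := fun x hx => ⟨x, hx, hxN x⟩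
  refine ⟨fun ω ω' h => ?_, fun φ => ?_⟩
  · refine 𝒯.ext_Ω _ l c _ _ fun x => ?_
    refine (𝒯.res (l x)).onΩ_eq (fun a => F.nat hW (l x) a) (hp x) fun a => ?_
    rw [← F.nat hW (l x), ← (𝒯.res (l x)).map_pair]
    exact congrArg _ (LinearMap.congr_fun h _)
  · have h : ∀ x, ∃ ω : (𝒯.sec (W ⊓ N x)).Ω, ∀ a,
        (𝒯.sec (W ⊓ N x)).pair (F.basis _ ((l x).trans hW) a) ω =
          (𝒯.res (l x)).onA (φ (F.basis W hW a)) := fun x =>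
      ⟨(hp x).dual ((F.basis _ ((l x).trans hW)).constr ℕ
        fun a => (𝒯.res (l x)).onA (φ (F.basis W hW a))), fun a => by
          rw [IsPerfect.pair_dual, Module.Basis.constr_basis]⟩
    choose ω hω using h
    obtain ⟨t, ht, -⟩ := 𝒯.glue_Ω _ l c ω fun x y => by
      refine (𝒯.res _).onΩ_eq (fun a => F.nat ((l x).trans hW) inf_le_left a)
        (hN x _ (inf_le_left.trans inf_le_right)) fun a => ?_
      rw [hω, res_res_A, ← F.nat ((l y).trans hW) inf_le_right, ← (𝒯.res _).map_pair, hω, res_res_A]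
    refine ⟨t, (F.basis W hW).ext fun a => ?_⟩
    refine 𝒯.ext_A _ l c _ _ fun x => ?_
    change (𝒯.res (l x)).onA ((𝒯.sec W).pair _ t) = _
    rw [(𝒯.res (l x)).map_pair, ht, F.nat, hω]

end ExtLieSheaf

namespace ExtLieSheaf

open ExtLieAlgebroid

variable {k : Type v} [CommRing k] [Invertible (2 : k)] {X : TopCat.{u}}
  {𝒯 : ExtLieSheaf.{u, v} k X} {U V W : Opens X}

/-! ### Curved morphisms of sheaves of vertex algebroids -/

/-- `h : 𝒜 → ℬ ∔ ω` is a morphism of vertex algebroids over `U`. -/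
def CurvedMor (𝒜 ℬ : 𝒯.LocVA U) (h : 𝒯.LocHom U) (ω : 𝒯.Form3 U) : Prop :=
  ∀ (W : Opens X) (hW : W ≤ U),
    VertexAlgebroid.CurvedMor (𝒜.app W hW) (ℬ.app W hW) (h.app W hW) (ω.app W hW)

section

variable {𝒜 ℬ : 𝒯.LocVA U} {h h' : 𝒯.LocHom U} {ω ω' : 𝒯.Form3 U}

/-- Two morphisms `𝒜 → ℬ ∔ ω` and `𝒜 → ℬ ∔ ω'` differ by a two-form with differential `ω - ω'`. -/
theorem CurvedMor.exists_form2 (H : CurvedMor 𝒜 ℬ h ω) (H' : CurvedMor 𝒜 ℬ h' ω') :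
    ∃ η : 𝒯.Form2 U, η.toLocHom = h - h' ∧ 𝒯.d U η = ω - ω' := by
  choose η hη dη using fun W hW => (H W hW).exists_twoForm (H' W hW)
  refine ⟨Form2.mk η fun V W hV hWV τ => ?_, LocHom.ext fun W hW => LinearMap.ext (hη W hW),
    Form3.ext dη⟩
  rw [hη, hη, map_sub, h.nat, h'.nat]

/-- A family of maps compatible with `γ` and with the pairings is a morphism `𝒜 → ℬ ∔ ω` for a
closed three-form `ω`. -/
theorem exists_curvedMor
    (H : ∀ W (hW : W ≤ U), VertexAlgebroid.PreMor (𝒜.app W hW) (ℬ.app W hW) (h.app W hW)) :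
    ∃ ω, CurvedMor 𝒜 ℬ h ω := by
  choose ω hω using fun W hW => (H W hW).exists_curvedMor
  refine ⟨Form3.mk ω fun V W hV hWV τ σ => ?_, hω⟩
  have e := (hω V hV).c τ σ
  have e' := (hω W (hWV.trans hV)).c ((𝒯.res hWV).onT τ) ((𝒯.res hWV).onT σ)
  have e'' := congrArg (𝒯.res hWV).onΩ e
  simp only [map_add, map_sub, map_smul, 𝒜.res_c, ℬ.res_c, (𝒯.res _).map_pair, (𝒯.res _).map_del,
    (𝒯.res _).map_lie_Ω, h.nat, LieHom.map_lie] at e''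
  rw [e'] at e''
  linear_combination (norm := module) -e''

end

namespace Frame

variable {n m l p : ℕ}

/-- Over an open set with a frame, any two vertex algebroids become isomorphic after a twist. -/
theorem exists_curvedMor (F : 𝒯.Frame U n) (hp : (𝒯.sec U).IsPerfect) (𝒜 ℬ : 𝒯.LocVA U) :
    ∃ h ω, CurvedMor 𝒜 ℬ h ω := by
  have key : ∃ x : Fin n → (𝒯.sec U).Ω, ∀ i j, (𝒯.sec U).pair (F.basis U le_rfl i) (x j) =
      (⅟2 : k) • ((𝒜.app U le_rfl).ip (F.basis U le_rfl i) (F.basis U le_rfl j)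
        - (ℬ.app U le_rfl).ip (F.basis U le_rfl i) (F.basis U le_rfl j)) :=
    ⟨fun j => hp.dual ((F.basis U le_rfl).constr ℕ fun i => (⅟2 : k) •
      ((𝒜.app U le_rfl).ip (F.basis U le_rfl i) (F.basis U le_rfl j)
        - (ℬ.app U le_rfl).ip (F.basis U le_rfl i) (F.basis U le_rfl j))), fun i j => by
      rw [IsPerfect.pair_dual, Module.Basis.constr_basis]⟩
  obtain ⟨x, hx⟩ := key
  let h : 𝒯.LocHom U := LocHom.mk (fun W hW => VertexAlgebroid.extendMor (F.basis W hW)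
      (𝒜.app W hW) (ℬ.app W hW) fun i => (𝒯.res hW).onΩ (x i)) fun V W hV hWV τ => by
    rw [(𝒯.res hWV).onΩ_extendMor (fun a => F.nat hV hWV a) _ (𝒜.res_gam hV hWV)
      (ℬ.res_gam hV hWV)]
    simp only [res_res_Ω]
  refine ⟨h, ExtLieSheaf.exists_curvedMor fun W hW => ?_⟩
  refine VertexAlgebroid.exists_preMor_of_pair _ _ _ _ fun i j => ?_
  have e := congrArg (𝒯.res hW).onA (hx i j)
  rw [(𝒯.res hW).map_pair, map_smul, map_sub, 𝒜.res_ip le_rfl hW, ℬ.res_ip le_rfl hW,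
    F.nat le_rfl hW, F.nat le_rfl hW] at e
  exact e

theorem lie_eq_zero (F : 𝒯.Frame U n)
    (hF : ∀ a b, ⁅F.basis U le_rfl a, F.basis U le_rfl b⁆ = 0) (hW : W ≤ U) (a b : Fin n) :
    ⁅F.basis W hW a, F.basis W hW b⁆ = 0 := by
  rw [← F.nat le_rfl hW, ← F.nat le_rfl hW, ← LieHom.map_lie, hF, map_zero]

/-- The vertex algebroid of a frame of commuting vector fields. -/
noncomputable def locVA (F : 𝒯.Frame U n)
    (hF : ∀ a b, ⁅F.basis U le_rfl a, F.basis U le_rfl b⁆ = 0) : 𝒯.LocVA U where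
  app W hW := frameVA (F.basis W hW) (F.lie_eq_zero hF hW)
  res_gam hV hWV a τ := (𝒯.res hWV).onΩ_frameGam (fun a => F.nat hV hWV a) a τ
  res_ip hV hWV τ σ := (𝒯.res hWV).onA_frameIp (fun a => F.nat hV hWV a) τ σ
  res_c hV hWV τ σ := (𝒯.res hWV).onΩ_frameC (fun a => F.nat hV hWV a) τ σ

variable {V₁ V₂ V₃ V₄ : Opens X} (F₁ : 𝒯.Frame V₁ n) (F₂ : 𝒯.Frame V₂ m) (F₃ : 𝒯.Frame V₃ l)
  (F₄ : 𝒯.Frame V₄ p) (hp : ∀ W ≤ V₁, (𝒯.sec W).IsPerfect)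

/-- The Atiyah–Chern–Simons three-form of two frames, over the intersection of their domains. -/
noncomputable def beta : 𝒯.Form3 (V₁ ⊓ V₂) :=
  Form3.mk (fun W hW => acsBeta (F₁.basis W (hW.trans inf_le_left))
    (F₂.basis W (hW.trans inf_le_right)) (hp W (hW.trans inf_le_left)))
    fun _ _ hV hWV τ σ => (𝒯.res hWV).onΩ_acsBeta (fun a => F₁.nat (hV.trans inf_le_left) hWV a)
      (fun a => F₂.nat (hV.trans inf_le_right) hWV a) _ _ τ σ

/-- The Atiyah–Chern–Simons two-form of three frames. -/
noncomputable def alpha : 𝒯.Form2 (V₁ ⊓ V₂ ⊓ V₃) :=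
  Form2.mk (fun W hW => acsAlpha (F₁.basis W (hW.trans (inf_le_left.trans inf_le_left)))
    (F₂.basis W (hW.trans (inf_le_left.trans inf_le_right))) (F₃.basis W (hW.trans inf_le_right))
    (hp W (hW.trans (inf_le_left.trans inf_le_left))))
    fun _ _ hV hWV τ => (𝒯.res hWV).onΩ_acsAlpha
      (fun a => F₁.nat (hV.trans (inf_le_left.trans inf_le_left)) hWV a)
      (fun a => F₂.nat (hV.trans (inf_le_left.trans inf_le_right)) hWV a)
      (fun a => F₃.nat (hV.trans inf_le_right) hWV a) _ _ τ

/-- The isomorphism between the vertex algebroids of two commuting frames, up to a twist. -/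
noncomputable def mor : 𝒯.LocHom (V₁ ⊓ V₂) :=
  LocHom.mk (fun W hW => frameMor (F₁.basis W (hW.trans inf_le_left))
    (F₂.basis W (hW.trans inf_le_right)) (hp W (hW.trans inf_le_left)))
    fun _ _ hV hWV σ => (𝒯.res hWV).onΩ_frameMor (fun a => F₁.nat (hV.trans inf_le_left) hWV a)
      (fun a => F₂.nat (hV.trans inf_le_right) hWV a) _ _ σ

end Frame

end ExtLieSheaf

namespace ExtLieSheaf

open ExtLieAlgebroid

variable {k : Type v} [CommRing k] {X : TopCat.{u}} {𝒯 : ExtLieSheaf.{u, v} k X}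
  {ι κ : Type u} {U : ι → Opens X} {V : κ → Opens X}

/-! ### Čech cochains -/

theorem D0_eq_iff {y : 𝒯.C0 U} {z : 𝒯.C1 U} : 𝒯.D0 U y = z ↔
    (∀ (i : ι) (W : Opens X) (hi : W ≤ U i),
      (z.1 i).app W hi = (𝒯.sec W).dTwo ((y i).app W hi)) ∧
    ∀ (i j : ι) (W : Opens X) (hi : W ≤ U i) (hj : W ≤ U j),
      (z.2 i j).app W (le_inf hi hj) = (y j).app W hj - (y i).app W hi := by
  refine ⟨?_, fun h => Prod.ext (funext fun i => Form3.ext fun W hW => (h.1 i W hW).symm)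
    (funext fun i => funext fun j => Form2.ext fun W hW =>
      (h.2 i j W (le_inf_iff.1 hW).1 (le_inf_iff.1 hW).2).symm)⟩
  rintro rfl
  exact ⟨fun _ _ _ => rfl, fun _ _ _ _ _ => rfl⟩

theorem D1_eq_iff {y : 𝒯.C1 U} {z : 𝒯.C2 U} : 𝒯.D1 U y = z ↔
    (∀ (i j : ι) (W : Opens X) (hi : W ≤ U i) (hj : W ≤ U j),
      (z.1 i j).app W (le_inf hi hj) = (𝒯.sec W).dTwo ((y.2 i j).app W (le_inf hi hj))
        - ((y.1 j).app W hj - (y.1 i).app W hi)) ∧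
    ∀ (i j l : ι) (W : Opens X) (hi : W ≤ U i) (hj : W ≤ U j) (hl : W ≤ U l),
      (z.2 i j l).app W (le_inf (le_inf hi hj) hl) = (y.2 j l).app W (le_inf hj hl)
        - (y.2 i l).app W (le_inf hi hl) + (y.2 i j).app W (le_inf hi hj) := by
  refine ⟨?_, fun h => Prod.ext (funext fun i => funext fun j => Form3.ext fun W hW =>
      (h.1 i j W (le_inf_iff.1 hW).1 (le_inf_iff.1 hW).2).symm)
    (funext fun i => funext fun j => funext fun l => Form2.ext fun W hW =>
      (h.2 i j l W (hW.trans (inf_le_left.trans inf_le_left))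
        (hW.trans (inf_le_left.trans inf_le_right)) (le_inf_iff.1 hW).2).symm)⟩
  rintro rfl
  exact ⟨fun _ _ _ _ _ => rfl, fun _ _ _ _ _ _ _ => rfl⟩

theorem mem_ker_D1 {z : 𝒯.C1 U} : z ∈ LinearMap.ker (𝒯.D1 U) ↔
    (∀ (i j : ι) (W : Opens X) (hi : W ≤ U i) (hj : W ≤ U j),
      (𝒯.sec W).dTwo ((z.2 i j).app W (le_inf hi hj)) = (z.1 j).app W hj - (z.1 i).app W hi) ∧
    ∀ (i j l : ι) (W : Opens X) (hi : W ≤ U i) (hj : W ≤ U j) (hl : W ≤ U l),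
      (z.2 j l).app W (le_inf hj hl) - (z.2 i l).app W (le_inf hi hl)
        + (z.2 i j).app W (le_inf hi hj) = 0 := by
  rw [LinearMap.mem_ker, D1_eq_iff]
  refine and_congr ?_ ?_
  · refine forall₃_congr fun i j W => forall₂_congr fun hi hj => ?_
    rw [← sub_eq_zero (b := (z.1 j).app W hj - (z.1 i).app W hi)]
    exact eq_comm
  · exact forall₄_congr fun i j l W => forall₃_congr fun hi hj hl => eq_comm

theorem mem_ker_D2 {z : 𝒯.C2 U} : z ∈ LinearMap.ker (𝒯.D2 U) ↔
    (∀ (i j l : ι) (W : Opens X) (hi : W ≤ U i) (hj : W ≤ U j) (hl : W ≤ U l),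
      (𝒯.sec W).dTwo ((z.2 i j l).app W (le_inf (le_inf hi hj) hl)) =
        (z.1 j l).app W (le_inf hj hl) - (z.1 i l).app W (le_inf hi hl)
        + (z.1 i j).app W (le_inf hi hj)) ∧
    ∀ (i j l m : ι) (W : Opens X) (hi : W ≤ U i) (hj : W ≤ U j) (hl : W ≤ U l) (hm : W ≤ U m),
      (z.2 j l m).app W (le_inf (le_inf hj hl) hm) - (z.2 i l m).app W (le_inf (le_inf hi hl) hm)
        + (z.2 i j m).app W (le_inf (le_inf hi hj) hm)
        - (z.2 i j l).app W (le_inf (le_inf hi hj) hl) = 0 := by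
  rw [LinearMap.mem_ker]
  refine ⟨fun h => ⟨fun i j l W hi hj hl => ?_, fun i j l m W hi hj hl hm => ?_⟩, fun h => ?_⟩
  · have e := congrArg (fun y : 𝒯.C3 U => (y.1 i j l).app W (le_inf (le_inf hi hj) hl)) h
    exact sub_eq_zero.1 e
  · exact congrArg (fun y : 𝒯.C3 U => (y.2 i j l m).app W (le_inf (le_inf (le_inf hi hj) hl) hm)) h
  · refine Prod.ext (funext fun i => funext fun j => funext fun l => Form3.ext fun W hW => ?_)
      (funext fun i => funext fun j => funext fun l => funext fun m => Form2.ext fun W hW => ?_)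
    · exact sub_eq_zero.2 (h.1 i j l W (hW.trans (inf_le_left.trans inf_le_left))
        (hW.trans (inf_le_left.trans inf_le_right)) (le_inf_iff.1 hW).2)
    · exact h.2 i j l m W (hW.trans (inf_le_left.trans (inf_le_left.trans inf_le_left)))
        (hW.trans (inf_le_left.trans (inf_le_left.trans inf_le_right)))
        (hW.trans (inf_le_left.trans inf_le_right)) (le_inf_iff.1 hW).2

/-- Two refinement maps are homotopic in degree one. -/
theorem exists_D0_eq_pull1_sub (r₁ r₂ : κ → ι) (h₁ : ∀ a, V a ≤ U (r₁ a)) (h₂ : ∀ a, V a ≤ U (r₂ a))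
    {z : 𝒯.C1 U} (hz : z ∈ LinearMap.ker (𝒯.D1 U)) :
    ∃ y, 𝒯.D0 V y = 𝒯.pull1 r₁ h₁ z - 𝒯.pull1 r₂ h₂ z := by
  obtain ⟨hω, hη⟩ := mem_ker_D1.1 hz
  refine ⟨fun a => Form2.res (le_inf (h₂ a) (h₁ a)) (z.2 (r₂ a) (r₁ a)), D0_eq_iff.2 ⟨?_, ?_⟩⟩
  · intro a W ha
    exact (hω _ _ W _ _).symm
  · intro a b W ha hb
    have e₁ := hη (r₂ a) (r₁ a) (r₁ b) W (ha.trans (h₂ a)) (ha.trans (h₁ a)) (hb.trans (h₁ b))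
    have e₂ := hη (r₂ a) (r₂ b) (r₁ b) W (ha.trans (h₂ a)) (hb.trans (h₂ b)) (hb.trans (h₁ b))
    change (z.2 (r₁ a) (r₁ b)).app W _ - (z.2 (r₂ a) (r₂ b)).app W _ =
      (z.2 (r₂ b) (r₁ b)).app W _ - (z.2 (r₂ a) (r₁ a)).app W _
    linear_combination (norm := module) e₁ - e₂

/-- Two refinement maps are homotopic in degree two. -/
theorem exists_D1_eq_pull2_sub (r₁ r₂ : κ → ι) (h₁ : ∀ a, V a ≤ U (r₁ a)) (h₂ : ∀ a, V a ≤ U (r₂ a))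
    {z : 𝒯.C2 U} (hz : z ∈ LinearMap.ker (𝒯.D2 U)) :
    ∃ y, 𝒯.D1 V y = 𝒯.pull2 r₁ h₁ z - 𝒯.pull2 r₂ h₂ z := by
  obtain ⟨hω, hη⟩ := mem_ker_D2.1 hz
  refine ⟨(fun a => Form3.res (le_inf (h₁ a) (h₂ a)) (z.1 (r₁ a) (r₂ a)),
    fun a b => Form2.res (le_inf (le_inf (inf_le_left.trans (h₁ a)) (inf_le_right.trans (h₁ b)))
        (inf_le_right.trans (h₂ b))) (z.2 (r₁ a) (r₁ b) (r₂ b))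
      - Form2.res (le_inf (le_inf (inf_le_left.trans (h₁ a)) (inf_le_left.trans (h₂ a)))
        (inf_le_right.trans (h₂ b))) (z.2 (r₁ a) (r₂ a) (r₂ b))), D1_eq_iff.2 ⟨?_, ?_⟩⟩
  · intro a b W ha hb
    have a₁ := ha.trans (h₁ a)
    have a₂ := ha.trans (h₂ a)
    have b₁ := hb.trans (h₁ b)
    have b₂ := hb.trans (h₂ b)
    have e₁ := hω _ _ _ W a₁ b₁ b₂
    have e₂ := hω _ _ _ W a₁ a₂ b₂
    change (z.1 (r₁ a) (r₁ b)).app W _ - (z.1 (r₂ a) (r₂ b)).app W _ =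
      (𝒯.sec W).dTwo ((z.2 (r₁ a) (r₁ b) (r₂ b)).app W _ - (z.2 (r₁ a) (r₂ a) (r₂ b)).app W _)
      - ((z.1 (r₁ b) (r₂ b)).app W _ - (z.1 (r₁ a) (r₂ a)).app W _)
    rw [map_sub, e₁, e₂]
    abel
  · intro a b c W ha hb hc
    have a₁ := ha.trans (h₁ a)
    have a₂ := ha.trans (h₂ a)
    have b₁ := hb.trans (h₁ b)
    have b₂ := hb.trans (h₂ b)
    have c₁ := hc.trans (h₁ c)
    have c₂ := hc.trans (h₂ c)
    have e₁ := hη _ _ _ _ W a₁ b₁ c₁ c₂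
    have e₂ := hη _ _ _ _ W a₁ b₁ b₂ c₂
    have e₃ := hη _ _ _ _ W a₁ a₂ b₂ c₂
    change (z.2 (r₁ a) (r₁ b) (r₁ c)).app W _ - (z.2 (r₂ a) (r₂ b) (r₂ c)).app W _ =
      ((z.2 (r₁ b) (r₁ c) (r₂ c)).app W _ - (z.2 (r₁ b) (r₂ b) (r₂ c)).app W _)
      - ((z.2 (r₁ a) (r₁ c) (r₂ c)).app W _ - (z.2 (r₁ a) (r₂ a) (r₂ c)).app W _)
      + ((z.2 (r₁ a) (r₁ b) (r₂ b)).app W _ - (z.2 (r₁ a) (r₂ a) (r₂ b)).app W _)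
    linear_combination (norm := module) -e₁ + e₂ - e₃

/-! ### Classes in the limit over open covers -/

instance : IsDirectedOrder (PointCover X) :=
  ⟨fun 𝒰 𝒱 => ⟨OrderDual.toDual ⟨𝒰.ofDual.1 ⊓ 𝒱.ofDual.1, fun x => ⟨𝒰.ofDual.2 x, 𝒱.ofDual.2 x⟩⟩,
    fun _ => inf_le_left, fun _ => inf_le_right⟩⟩

instance : Nonempty (PointCover X) := ⟨OrderDual.toDual ⟨fun _ => ⊤, fun _ => trivial⟩⟩

instance : DirectedSystem (fun 𝒰 : PointCover X => 𝒯.CechH1 𝒰.ofDual.1)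
    fun 𝒰 𝒱 h => 𝒯.transH1 𝒰 𝒱 h where
  map_self 𝒰 x := by
    obtain ⟨z, rfl⟩ := Submodule.mkQ_surjective _ x
    rfl
  map_map 𝒰 𝒱 𝒲 h h' x := by
    obtain ⟨z, rfl⟩ := Submodule.mkQ_surjective _ x
    rfl

instance : DirectedSystem (fun 𝒰 : PointCover X => 𝒯.CechH2 𝒰.ofDual.1)
    fun 𝒰 𝒱 h => 𝒯.transH2 𝒰 𝒱 h where
  map_self 𝒰 x := by
    obtain ⟨z, rfl⟩ := Submodule.mkQ_surjective _ x
    rfl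
  map_map 𝒰 𝒱 𝒲 h h' x := by
    obtain ⟨z, rfl⟩ := Submodule.mkQ_surjective _ x
    rfl

theorem CechH1.mk_eq_zero {z : LinearMap.ker (𝒯.D1 U)} :
    CechH1.mk 𝒯 U z = 0 ↔ ∃ y, 𝒯.D0 U y = z.1 :=
  (Submodule.Quotient.mk_eq_zero _).trans Iff.rfl

theorem CechH1.mk_eq_mk {z z' : LinearMap.ker (𝒯.D1 U)} :
    CechH1.mk 𝒯 U z = CechH1.mk 𝒯 U z' ↔ ∃ y, 𝒯.D0 U y = z.1 - z'.1 := by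
  rw [← sub_eq_zero, ← map_sub, CechH1.mk_eq_zero]
  rfl

theorem CechH2.mk_eq_zero {z : LinearMap.ker (𝒯.D2 U)} :
    CechH2.mk 𝒯 U z = 0 ↔ ∃ y, 𝒯.D1 U y = z.1 :=
  (Submodule.Quotient.mk_eq_zero _).trans Iff.rfl

theorem CechH2.mk_eq_mk {z z' : LinearMap.ker (𝒯.D2 U)} :
    CechH2.mk 𝒯 U z = CechH2.mk 𝒯 U z' ↔ ∃ y, 𝒯.D1 U y = z.1 - z'.1 := by
  rw [← sub_eq_zero, ← map_sub, CechH2.mk_eq_zero]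
  rfl

section

variable (r : X → ι) (hr : ∀ x, x ∈ U (r x)) (s : X → κ) (hs : ∀ x, x ∈ V (s x))

open Classical in
/-- A class, computed on a refinement `N` of the cover. -/
theorem H1.mk_eq_of (z : LinearMap.ker (𝒯.D1 U)) (N : X → Opens X) (hN : ∀ x, x ∈ N x)
    (h : ∀ x, N x ≤ U (r x)) : H1.mk U r hr z =
      Module.DirectLimit.of k (PointCover X) (fun 𝒰 : PointCover X => 𝒯.CechH1 𝒰.ofDual.1) 𝒯.transH1
        (OrderDual.toDual ⟨N, hN⟩) (CechH1.mk 𝒯 N ⟨𝒯.pull1 r h z.1, 𝒯.pull1_mem r h z.2⟩) :=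
  (Module.DirectLimit.of_f (f := 𝒯.transH1) (i := OrderDual.toDual ⟨fun x => U (r x), hr⟩)
    (j := OrderDual.toDual ⟨N, hN⟩) (hij := fun x => h x)).symm

open Classical in
/-- A class, computed on a refinement `N` of the cover. -/
theorem H2.mk_eq_of (z : LinearMap.ker (𝒯.D2 U)) (N : X → Opens X) (hN : ∀ x, x ∈ N x)
    (h : ∀ x, N x ≤ U (r x)) : H2.mk U r hr z =
      Module.DirectLimit.of k (PointCover X) (fun 𝒰 : PointCover X => 𝒯.CechH2 𝒰.ofDual.1) 𝒯.transH2
        (OrderDual.toDual ⟨N, hN⟩) (CechH2.mk 𝒯 N ⟨𝒯.pull2 r h z.1, 𝒯.pull2_mem r h z.2⟩) :=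
  (Module.DirectLimit.of_f (f := 𝒯.transH2) (i := OrderDual.toDual ⟨fun x => U (r x), hr⟩)
    (j := OrderDual.toDual ⟨N, hN⟩) (hij := fun x => h x)).symm

/-- Cocycles on two covers have the same class if they are cohomologous on a common refinement. -/
theorem H1.mk_eq_mk {z : LinearMap.ker (𝒯.D1 U)} {z' : LinearMap.ker (𝒯.D1 V)}
    (N : X → Opens X) (hN : ∀ x, x ∈ N x) (h : ∀ x, N x ≤ U (r x)) (h' : ∀ x, N x ≤ V (s x))
    (y : 𝒯.C0 N) (hy : 𝒯.D0 N y = 𝒯.pull1 r h z.1 - 𝒯.pull1 s h' z'.1) :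
    H1.mk U r hr z = H1.mk V s hs z' := by
  rw [H1.mk_eq_of r hr z N hN h, H1.mk_eq_of s hs z' N hN h']
  exact congrArg _ (CechH1.mk_eq_mk.2 ⟨y, hy⟩)

/-- Cocycles on two covers have the same class if they are cohomologous on a common refinement. -/
theorem H2.mk_eq_mk {z : LinearMap.ker (𝒯.D2 U)} {z' : LinearMap.ker (𝒯.D2 V)}
    (N : X → Opens X) (hN : ∀ x, x ∈ N x) (h : ∀ x, N x ≤ U (r x)) (h' : ∀ x, N x ≤ V (s x))
    (y : 𝒯.C1 N) (hy : 𝒯.D1 N y = 𝒯.pull2 r h z.1 - 𝒯.pull2 s h' z'.1) :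
    H2.mk U r hr z = H2.mk V s hs z' := by
  rw [H2.mk_eq_of r hr z N hN h, H2.mk_eq_of s hs z' N hN h']
  exact congrArg _ (CechH2.mk_eq_mk.2 ⟨y, hy⟩)

theorem H1.mk_pull (z : LinearMap.ker (𝒯.D1 U)) (t : κ → ι) (h : ∀ a, V a ≤ U (t a)) :
    H1.mk V s hs ⟨𝒯.pull1 t h z.1, 𝒯.pull1_mem t h z.2⟩ = H1.mk U r hr z := by
  obtain ⟨y, hy⟩ := exists_D0_eq_pull1_sub (V := fun x => V (s x) ⊓ U (r x)) (fun x => t (s x)) r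
    (fun x => inf_le_left.trans (h _)) (fun _ => inf_le_right) z.2
  exact H1.mk_eq_mk s hs r hr (fun x => V (s x) ⊓ U (r x)) (fun x => ⟨hs x, hr x⟩)
    (fun _ => inf_le_left) (fun _ => inf_le_right) y hy

theorem H2.mk_pull (z : LinearMap.ker (𝒯.D2 U)) (t : κ → ι) (h : ∀ a, V a ≤ U (t a)) :
    H2.mk V s hs ⟨𝒯.pull2 t h z.1, 𝒯.pull2_mem t h z.2⟩ = H2.mk U r hr z := by
  obtain ⟨y, hy⟩ := exists_D1_eq_pull2_sub (V := fun x => V (s x) ⊓ U (r x)) (fun x => t (s x)) r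
    (fun x => inf_le_left.trans (h _)) (fun _ => inf_le_right) z.2
  exact H2.mk_eq_mk s hs r hr (fun x => V (s x) ⊓ U (r x)) (fun x => ⟨hs x, hr x⟩)
    (fun _ => inf_le_left) (fun _ => inf_le_right) y hy

/-- A cocycle with trivial class is a coboundary on a refinement of the cover. -/
theorem H1.exists_of_mk_eq_zero {z : LinearMap.ker (𝒯.D1 U)} (hz : H1.mk U r hr z = 0) :
    ∃ (N : X → Opens X) (_ : ∀ x, x ∈ N x) (h : ∀ x, N x ≤ U (r x)) (y : 𝒯.C0 N),
      𝒯.D0 N y = 𝒯.pull1 r h z.1 := by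
  classical
  obtain ⟨𝒱, h, e⟩ := Module.DirectLimit.of.zero_exact hz
  obtain ⟨y, hy⟩ := CechH1.mk_eq_zero.1 e
  exact ⟨𝒱.ofDual.1, 𝒱.ofDual.2, h, y, hy⟩

/-- A cocycle with trivial class is a coboundary on a refinement of the cover. -/
theorem H2.exists_of_mk_eq_zero {z : LinearMap.ker (𝒯.D2 U)} (hz : H2.mk U r hr z = 0) :
    ∃ (N : X → Opens X) (_ : ∀ x, x ∈ N x) (h : ∀ x, N x ≤ U (r x)) (y : 𝒯.C1 N),
      𝒯.D1 N y = 𝒯.pull2 r h z.1 := by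
  classical
  obtain ⟨𝒱, h, e⟩ := Module.DirectLimit.of.zero_exact hz
  obtain ⟨y, hy⟩ := CechH2.mk_eq_zero.1 e
  exact ⟨𝒱.ofDual.1, 𝒱.ofDual.2, h, y, hy⟩

end

theorem H1.exists_eq_mk (x : 𝒯.H1) : ∃ (N : X → Opens X) (hN : ∀ x, x ∈ N x)
    (z : LinearMap.ker (𝒯.D1 N)), x = H1.mk N id hN z := by
  classical
  obtain ⟨𝒰, c, rfl⟩ := Module.DirectLimit.exists_of x
  obtain ⟨z, rfl⟩ := Submodule.mkQ_surjective _ c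
  exact ⟨𝒰.ofDual.1, 𝒰.ofDual.2, z, rfl⟩

end ExtLieSheaf

namespace ExtLieSheaf

open ExtLieAlgebroid

variable {k : Type v} [CommRing k] [Invertible (2 : k)] {X : TopCat.{u}}
  {𝒯 : ExtLieSheaf.{u, v} k X}

/-! ### The characteristic class of the gerbe -/

/-- Locally, any two vertex algebroids over a regular sheaf become isomorphic after a twist. -/
theorem IsRegular.exists_local_curvedMor (h𝒯 : 𝒯.IsRegular) {x : X} {U V : Opens X} (hU : x ∈ U)
    (hV : x ∈ V) (𝒜 : 𝒯.LocVA U) (ℬ : 𝒯.LocVA V) :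
    ∃ (N : Opens X) (_ : x ∈ N) (h₁ : N ≤ U) (h₂ : N ≤ V) (h : 𝒯.LocHom N) (ω : 𝒯.Form3 N),
      CurvedMor (𝒜.res h₁) (ℬ.res h₂) h ω := by
  obtain ⟨W, hx, hp, n, F, -⟩ := h𝒯 x
  have l : U ⊓ V ⊓ W ≤ W := inf_le_right
  let F' : 𝒯.Frame (U ⊓ V ⊓ W) n := ⟨fun W' hW' => F.basis W' (hW'.trans l),
    fun hV hWV a => F.nat (hV.trans l) hWV a⟩
  exact ⟨U ⊓ V ⊓ W, ⟨⟨hU, hV⟩, hx⟩, inf_le_left.trans inf_le_left, inf_le_left.trans inf_le_right,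
    F'.exists_curvedMor (hp _ l) _ _⟩

namespace GerbePresentation

variable (G G' : 𝒯.GerbePresentation)

theorem curvedMor (i j : G.ι) (W : Opens X) (hi : W ≤ G.U i) (hj : W ≤ G.U j) :
    VertexAlgebroid.CurvedMor ((G.obj j).app W hj) ((G.obj i).app W hi)
      ((G.h i j).app W (le_inf hi hj)) ((G.ω i j).app W (le_inf hi hj)) :=
  VertexAlgebroid.isMor_twist.1 (G.isMor i j W hi hj)

/-- A cochain `(ω_ij, h_ij + h_jl - h_il)` is a cocycle if `dη_ijl = ω_jl - ω_il + ω_ij`. -/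
theorem isCocycle_of {z : 𝒯.C2 G.U} (hω : ∀ i j, z.1 i j = G.ω i j)
    (hη : ∀ (i j l : G.ι) (W : Opens X) (hi : W ≤ G.U i) (hj : W ≤ G.U j) (hl : W ≤ G.U l),
      toHom _ ((z.2 i j l).app W (le_inf (le_inf hi hj) hl)) =
        (G.h i j).app W (le_inf hi hj) + (G.h j l).app W (le_inf hj hl)
          - (G.h i l).app W (le_inf hi hl))
    (hd : ∀ (i j l : G.ι) (W : Opens X) (hi : W ≤ G.U i) (hj : W ≤ G.U j) (hl : W ≤ G.U l),
      (𝒯.sec W).dTwo ((z.2 i j l).app W (le_inf (le_inf hi hj) hl)) =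
        (z.1 j l).app W (le_inf hj hl) - (z.1 i l).app W (le_inf hi hl)
        + (z.1 i j).app W (le_inf hi hj)) : G.IsCocycle z where
  cocycle := mem_ker_D2.2 ⟨hd, fun i j l m W hi hj hl hm => toHom_injective _ (by
    rw [map_sub, map_add, map_sub, hη j l m W hj hl hm, hη i l m W hi hl hm, hη i j m W hi hj hm,
      hη i j l W hi hj hl, map_zero]
    abel)⟩
  omega := hω
  eta i j l W hi hj hl τ := LinearMap.congr_fun (hη i j l W hi hj hl) τ

theorem exists_isCocycle : ∃ z, G.IsCocycle z := by
  have H : ∀ i j l : G.ι, ∃ η : 𝒯.Form2 (G.U i ⊓ G.U j ⊓ G.U l),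
      η.toLocHom = (G.h j l).res (le_inf (inf_le_left.trans inf_le_right) inf_le_right)
        + (G.h i j).res inf_le_left
        - (G.h i l).res (le_inf (inf_le_left.trans inf_le_left) inf_le_right) ∧
      𝒯.d _ η = Form3.res (le_inf (inf_le_left.trans inf_le_right) inf_le_right) (G.ω j l)
        + Form3.res inf_le_left (G.ω i j)
        - Form3.res (le_inf (inf_le_left.trans inf_le_left) inf_le_right) (G.ω i l) := by
    intro i j l
    have li : G.U i ⊓ G.U j ⊓ G.U l ≤ G.U i := inf_le_left.trans inf_le_left
    have lj : G.U i ⊓ G.U j ⊓ G.U l ≤ G.U j := inf_le_left.trans inf_le_right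
    exact CurvedMor.exists_form2 (𝒜 := (G.obj l).res inf_le_right) (ℬ := (G.obj i).res li)
      (fun W hW => (G.curvedMor j l W (hW.trans lj) (hW.trans inf_le_right)).comp
        (G.curvedMor i j W (hW.trans li) (hW.trans lj)))
      (fun W hW => G.curvedMor i l W (hW.trans li) (hW.trans inf_le_right))
  choose η hη hd using H
  refine ⟨(G.ω, η), G.isCocycle_of (fun _ _ => rfl) (fun i j l W hi hj hl => ?_)
    (fun i j l W hi hj hl => ?_)⟩
  · have e := congrArg (fun t : 𝒯.LocHom _ => t.app W (le_inf (le_inf hi hj) hl)) (hη i j l)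
    refine Eq.trans e ?_
    rw [LocHom.sub_app, LocHom.add_app, add_comm]
    rfl
  · have e := congrArg (fun t : 𝒯.Form3 _ => t.app W (le_inf (le_inf hi hj) hl)) (hd i j l)
    refine Eq.trans e ?_
    rw [Form3.sub_app, Form3.add_app, add_sub_right_comm]
    rfl

variable {G G'}

theorem IsCocycle.toHom_eta {z : 𝒯.C2 G.U} (hz : G.IsCocycle z) (i j l : G.ι) (W : Opens X)
    (hi : W ≤ G.U i) (hj : W ≤ G.U j) (hl : W ≤ G.U l) :
    toHom _ ((z.2 i j l).app W (le_inf (le_inf hi hj) hl)) =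
      (G.h i j).app W (le_inf hi hj) + (G.h j l).app W (le_inf hj hl)
        - (G.h i l).app W (le_inf hi hl) :=
  LinearMap.ext (hz.eta i j l W hi hj hl)

/-- The cocycles of two presentations are cohomologous: locally there are isomorphisms
`k_x : 𝒜'_x → 𝒜_x ∔ u_x`, and the cochain `(-u_x, k_x + h'_xy - h_xy - k_y)` bounds the
difference. -/
theorem IsCocycle.mk_eq_mk (h𝒯 : 𝒯.IsRegular) {z : 𝒯.C2 G.U} (hz : G.IsCocycle z)
    {z' : 𝒯.C2 G'.U} (hz' : G'.IsCocycle z') (r : X → G.ι) (hr : ∀ x, x ∈ G.U (r x))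
    (r' : X → G'.ι) (hr' : ∀ x, x ∈ G'.U (r' x)) :
    H2.mk G'.U r' hr' ⟨z', hz'.cocycle⟩ = H2.mk G.U r hr ⟨z, hz.cocycle⟩ := by
  choose N hN h' h f u hf using fun x =>
    h𝒯.exists_local_curvedMor (hr' x) (hr x) (G'.obj (r' x)) (G.obj (r x))
  have H : ∀ x y, ∃ η : 𝒯.Form2 (N x ⊓ N y), η.toLocHom =
      (G'.h (r' x) (r' y)).res (inf_le_inf (h' x) (h' y)) + (f x).res inf_le_left
        - ((f y).res inf_le_right + (G.h (r x) (r y)).res (inf_le_inf (h x) (h y))) ∧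
      𝒯.d _ η = Form3.res (inf_le_inf (h' x) (h' y)) (G'.ω (r' x) (r' y))
        + Form3.res inf_le_left (u x)
        - (Form3.res inf_le_right (u y)
          + Form3.res (inf_le_inf (h x) (h y)) (G.ω (r x) (r y))) := by
    intro x y
    have lx : N x ⊓ N y ≤ N x := inf_le_left
    have ly : N x ⊓ N y ≤ N y := inf_le_right
    exact CurvedMor.exists_form2 (𝒜 := (G'.obj (r' y)).res (ly.trans (h' y)))
      (ℬ := (G.obj (r x)).res (lx.trans (h x)))
      (fun W hW => (G'.curvedMor _ _ W ((hW.trans lx).trans (h' x))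
        ((hW.trans ly).trans (h' y))).comp (hf x W (hW.trans lx)))
      (fun W hW => (hf y W (hW.trans ly)).comp (G.curvedMor _ _ W ((hW.trans lx).trans (h x))
        ((hW.trans ly).trans (h y))))
  choose η hη hd using H
  have hη' : ∀ x y W (hx : W ≤ N x) (hy : W ≤ N y), toHom _ ((η x y).app W (le_inf hx hy)) =
      (G'.h (r' x) (r' y)).app W (le_inf (hx.trans (h' x)) (hy.trans (h' y))) + (f x).app W hx
      - ((f y).app W hy + (G.h (r x) (r y)).app W (le_inf (hx.trans (h x)) (hy.trans (h y)))) :=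
    fun x y W hx hy => congrArg (fun t : 𝒯.LocHom _ => t.app W (le_inf hx hy)) (hη x y)
  refine H2.mk_eq_mk r' hr' r hr N hN h' h (fun x => -u x, η) (D1_eq_iff.2 ⟨?_, ?_⟩)
  · intro x y W hx hy
    have e : (𝒯.sec W).dTwo ((η x y).app W (le_inf hx hy)) =
      (G'.ω (r' x) (r' y)).app W (le_inf (hx.trans (h' x)) (hy.trans (h' y))) + (u x).app W hx
      - ((u y).app W hy + (G.ω (r x) (r y)).app W (le_inf (hx.trans (h x)) (hy.trans (h y)))) :=
      congrArg (fun t : 𝒯.Form3 _ => t.app W (le_inf hx hy)) (hd x y)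
    rw [e]
    change (z'.1 (r' x) (r' y)).app W _ - (z.1 (r x) (r y)).app W _ =
      _ - (-(u y).app W hy - -(u x).app W hx)
    rw [hz.omega, hz'.omega]
    abel
  · intro x y t W hx hy ht
    refine toHom_injective _ ?_
    change toHom _ ((z'.2 (r' x) (r' y) (r' t)).app W _ - (z.2 (r x) (r y) (r t)).app W _) =
      toHom _ ((η y t).app W _ - (η x t).app W _ + (η x y).app W _)
    rw [map_sub, map_add, map_sub, hη' y t W hy ht, hη' x t W hx ht, hη' x y W hx hy,
      hz.toHom_eta _ _ _ W (hx.trans (h x)) (hy.trans (h y)) (ht.trans (h t)),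
      hz'.toHom_eta _ _ _ W (hx.trans (h' x)) (hy.trans (h' y)) (ht.trans (h' t))]
    abel

end GerbePresentation

/-! ### The Atiyah–Chern–Simons class -/

namespace LocalFrames

variable (F F' : 𝒯.LocalFrames)

theorem algebraMap_two_mul_half (A : Type*) [CommRing A] [Algebra k A] (x : A) :
    algebraMap k A 2 * ((⅟2 : k) • x) = x := by
  rw [← Algebra.smul_def, smul_invOf_smul]

/-- The Atiyah–Chern–Simons cochain of a trivialization. -/
noncomputable def acs (h𝒯 : 𝒯.IsRegular) : 𝒯.C2 F.U :=
  (fun i j => (F.frame i).beta (F.frame j) ((F.frame i).isPerfect h𝒯),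
    fun i j l => (F.frame i).alpha (F.frame j) (F.frame l) ((F.frame i).isPerfect h𝒯))

theorem isACSCocycle_acs (h𝒯 : 𝒯.IsRegular) : F.IsACSCocycle (F.acs h𝒯) where
  cocycle := mem_ker_D2.2 ⟨fun _ _ _ _ _ _ _ => dTwo_acsAlpha _ _ _ _,
    fun _ _ _ _ _ _ _ _ _ => acsAlpha_cocycle _ _ _ _ _⟩
  beta i j W hi hj τ₁ τ₂ τ₃ := by
    refine (congrArg _ (pair_acsBeta ((F.frame i).basis W hi) ((F.frame j).basis W hj) _ τ₁ τ₂
      τ₃)).trans ((algebraMap_two_mul_half _ _).trans ?_)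
    rw [triTrace, Matrix.sub_mul]
    rfl
  alpha i j l W hi hj hl τ σ := by
    refine (congrArg _ (pair_acsAlpha ((F.frame i).basis W hi) ((F.frame j).basis W hj)
      ((F.frame l).basis W hl) _ τ σ)).trans ((algebraMap_two_mul_half _ _).trans ?_)
    rw [← Matrix.trace_sub]
    rfl

/-- The disjoint union of two trivializations. -/
def sum : 𝒯.LocalFrames where
  ι := F.ι ⊕ F'.ι
  U := Sum.elim F.U F'.U
  cover x := (F.cover x).elim fun i hi => ⟨Sum.inl i, hi⟩
  n := Sum.elim F.n F'.n
  frame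
    | Sum.inl i => F.frame i
    | Sum.inr i => F'.frame i

/-- The Atiyah–Chern–Simons class does not depend on the trivialization: the cocycles of two
trivializations are restrictions of that of their disjoint union. -/
theorem mk_acs_eq_mk (h𝒯 : 𝒯.IsRegular) (r : X → F.ι) (hr : ∀ x, x ∈ F.U (r x)) (r' : X → F'.ι)
    (hr' : ∀ x, x ∈ F'.U (r' x)) :
    H2.mk F.U r hr ⟨F.acs h𝒯, (F.isACSCocycle_acs h𝒯).cocycle⟩ =
      H2.mk F'.U r' hr' ⟨F'.acs h𝒯, (F'.isACSCocycle_acs h𝒯).cocycle⟩ := by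
  have H := (F.sum F').isACSCocycle_acs h𝒯
  have e₁ := H2.mk_pull (V := F.U) (fun x => (Sum.inl (r x) : (F.sum F').ι)) hr r hr
    ⟨_, H.cocycle⟩ Sum.inl fun _ => le_rfl
  have e₂ := H2.mk_pull (V := F'.U) (fun x => (Sum.inl (r x) : (F.sum F').ι)) hr r' hr'
    ⟨_, H.cocycle⟩ Sum.inr fun _ => le_rfl
  exact e₁.trans e₂.symm

end LocalFrames

/-! ### Comparison of the two classes -/

theorem IsRegular.exists_commuting_frames (h𝒯 : 𝒯.IsRegular) : ∃ F : 𝒯.LocalFrames,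
    ∀ i a b, ⁅(F.frame i).basis _ le_rfl a, (F.frame i).basis _ le_rfl b⁆ = 0 := by
  choose U hxU _ n F hF using h𝒯
  exact ⟨⟨X, U, fun x => ⟨x, hxU x⟩, n, F⟩, hF⟩

/-- The presentation of the gerbe by the vertex algebroids of commuting frames. -/
noncomputable def LocalFrames.presentation (F : 𝒯.LocalFrames) (h𝒯 : 𝒯.IsRegular)
    (hF : ∀ i a b, ⁅(F.frame i).basis _ le_rfl a, (F.frame i).basis _ le_rfl b⁆ = 0) :
    𝒯.GerbePresentation where
  ι := F.ι
  U := F.U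
  cover := F.cover
  obj i := (F.frame i).locVA (hF i)
  ω i j := (F.frame i).beta (F.frame j) ((F.frame i).isPerfect h𝒯)
  h i j := (F.frame i).mor (F.frame j) ((F.frame i).isPerfect h𝒯)
  isMor i j _ hi hj := VertexAlgebroid.isMor_twist.2 (curvedMor_frameMor _ _
    ((F.frame i).lie_eq_zero (hF i) hi) ((F.frame j).lie_eq_zero (hF j) hj) _)

/-- The cocycle of this presentation is the Atiyah–Chern–Simons cocycle itself. -/
theorem LocalFrames.isCocycle_acs (F : 𝒯.LocalFrames) (h𝒯 : 𝒯.IsRegular)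
    (hF : ∀ i a b, ⁅(F.frame i).basis _ le_rfl a, (F.frame i).basis _ le_rfl b⁆ = 0) :
    (F.presentation h𝒯 hF).IsCocycle (F.acs h𝒯) where
  cocycle := (F.isACSCocycle_acs h𝒯).cocycle
  omega _ _ := rfl
  eta _ _ _ _ hi hj _ τ := acsAlpha_eq_frameMor _ _ _ ((F.frame _).lie_eq_zero (hF _) hi)
    ((F.frame _).lie_eq_zero (hF _) hj) _ τ

/-- The characteristic class of the gerbe is the class of the Atiyah–Chern–Simons cocycle. -/
theorem IsRegular.exists_class (h𝒯 : 𝒯.IsRegular) :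
    ∃ c, 𝒯.IsCharacteristicClass c ∧ Nonempty 𝒯.LocalFrames ∧
      ∀ F : 𝒯.LocalFrames, F.HasClass c := by
  obtain ⟨F, hF⟩ := h𝒯.exists_commuting_frames
  choose r hr using F.cover
  refine ⟨H2.mk F.U r hr ⟨F.acs h𝒯, (F.isACSCocycle_acs h𝒯).cocycle⟩,
    ⟨⟨F.presentation h𝒯 hF⟩, fun G => ?_⟩, ⟨F⟩, fun F' => ?_⟩
  · obtain ⟨z, hz⟩ := G.exists_isCocycle
    exact ⟨z, hz, fun r' hr' => GerbePresentation.IsCocycle.mk_eq_mk h𝒯 (F.isCocycle_acs h𝒯 hF) hz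
      r hr r' hr'⟩
  · exact ⟨F'.acs h𝒯, F'.isACSCocycle_acs h𝒯, fun r' hr' => F'.mk_acs_eq_mk F h𝒯 r' hr' r hr⟩

end ExtLieSheaf

namespace ExtLieSheaf

open ExtLieAlgebroid

variable {k : Type v} [CommRing k] [Invertible (2 : k)] {X : TopCat.{u}}
  {𝒯 : ExtLieSheaf.{u, v} k X}

/-! ### Global sections of the gerbe and the characteristic class -/

/-- A presentation whose cocycle has trivial class can be corrected by a cochain `(u, η)` to glued
vertex algebroids `𝒜_x ∔ u_x` with gluing isomorphisms `h_yx - η_yx`. -/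
theorem GerbePresentation.IsCocycle.nonempty_globalVA {G : 𝒯.GerbePresentation} {z : 𝒯.C2 G.U}
    (hz : G.IsCocycle z) (r : X → G.ι) (hr : ∀ x, x ∈ G.U (r x))
    (h0 : H2.mk G.U r hr ⟨z, hz.cocycle⟩ = 0) : Nonempty 𝒯.GlobalVA := by
  obtain ⟨N, hN, h, ⟨u, η⟩, hy⟩ := H2.exists_of_mk_eq_zero r hr h0
  obtain ⟨hω, hη⟩ := D1_eq_iff.1 hy
  refine ⟨⟨X, N, fun x => ⟨x, hN x⟩, fun x => ((G.obj (r x)).res (h x)).twist (u x),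
    fun x y => (G.h (r y) (r x)).res (le_inf (inf_le_right.trans (h y)) (inf_le_left.trans (h x)))
      - ((η y x).toLocHom.res (le_inf inf_le_right inf_le_left)), fun x y W hx hy => ?_,
    fun x y t W hx hy ht => ?_⟩⟩
  · have H := (G.curvedMor (r y) (r x) W (hy.trans (h y)) (hx.trans (h x))).comp
      (VertexAlgebroid.CurvedMor.ofTwoForm _ ((η y x).app W (le_inf hy hx))).inv
    refine VertexAlgebroid.isMor_twist_twist.2 ?_
    have e := hω y x W hy hx
    have e' : (u y).app W hy - (u x).app W hx = (G.ω (r y) (r x)).app W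
        (le_inf (hy.trans (h y)) (hx.trans (h x))) +
          -(𝒯.sec W).dTwo ((η y x).app W (le_inf hy hx)) := by
      have e'' : (z.1 (r y) (r x)).app W (le_inf (hy.trans (h y)) (hx.trans (h x))) =
        (𝒯.sec W).dTwo ((η y x).app W (le_inf hy hx)) - ((u x).app W hx - (u y).app W hy) := e
      rw [hz.omega] at e''
      rw [e'']
      abel
    rw [e']
    rw [LocHom.sub_app, sub_eq_add_neg]
    exact H
  · have e := congrArg (toHom _) (hη t y x W ht hy hx)
    have e' := hz.toHom_eta _ _ _ W (ht.trans (h t)) (hy.trans (h y)) (hx.trans (h x))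
    rw [map_add, map_sub] at e
    have e'' := e'.symm.trans e
    change (G.h (r y) (r x)).app W _ - toHom _ ((η y x).app W _) + ((G.h (r t) (r y)).app W _
      - toHom _ ((η t y).app W _)) = (G.h (r t) (r x)).app W _ - toHom _ ((η t x).app W _)
    linear_combination (norm := module) e''

namespace GlobalVA

variable (D D' D'' : 𝒯.GlobalVA)

theorem curvedMor (i j : D.ι) (W : Opens X) (hi : W ≤ D.U i) (hj : W ≤ D.U j) :
    VertexAlgebroid.CurvedMor ((D.obj i).app W hi) ((D.obj j).app W hj)
      ((D.h i j).app W (le_inf hi hj)) 0 :=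
  VertexAlgebroid.isMor_iff.1 (D.isMor i j W hi hj)

/-- A global vertex algebroid as a presentation of the gerbe, with trivial three-forms. -/
def presentation : 𝒯.GerbePresentation where
  ι := D.ι
  U := D.U
  cover := D.cover
  obj := D.obj
  ω _ _ := 0
  h i j := (D.h j i).res (le_inf inf_le_right inf_le_left)
  isMor i j W hi hj := VertexAlgebroid.isMor_twist.2 (D.curvedMor j i W hj hi)

theorem eq_zero_of_isCharacteristicClass (D : 𝒯.GlobalVA) {c : 𝒯.H2}
    (hc : 𝒯.IsCharacteristicClass c) : c = 0 := by
  obtain ⟨z, hz, H⟩ := hc.2 D.presentation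
  choose r hr using D.cover
  have hz0 : z = 0 := by
    refine Prod.ext (funext fun i => funext fun j => hz.omega i j)
      (funext fun i => funext fun j => funext fun l => Form2.ext fun W hW => ?_)
    obtain ⟨hij, hl⟩ := le_inf_iff.1 hW
    obtain ⟨hi, hj⟩ := le_inf_iff.1 hij
    refine toHom_injective _ ((hz.toHom_eta i j l W hi hj hl).trans ?_)
    change (D.h j i).app W _ + (D.h l j).app W _ - (D.h l i).app W _ = 0
    rw [← D.cocycle l j i W hl hj hi]
    abel
  subst hz0
  rw [← H r hr]
  exact map_zero _

variable {D D' D''}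

theorem Hom.curvedMor (f : Hom D D') (i : D.ι) (j : D'.ι) (W : Opens X) (hi : W ≤ D.U i)
    (hj : W ≤ D'.U j) : VertexAlgebroid.CurvedMor ((D.obj i).app W hi) ((D'.obj j).app W hj)
      ((f.f i j).app W (le_inf hi hj)) 0 :=
  VertexAlgebroid.isMor_iff.1 (f.isMor i j W hi hj)

/-- Morphisms agree if they agree on local representatives. -/
theorem Hom.ext_of_cover {f g : Hom D D'} {κ : Type u} (N : κ → Opens X) (hN : ∀ x, ∃ a, x ∈ N a)
    (s : κ → D.ι) (s' : κ → D'.ι)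
    (h : ∀ a (W : Opens X) (hs : W ≤ D.U (s a)) (hs' : W ≤ D'.U (s' a)), W ≤ N a →
      (f.f (s a) (s' a)).app W (le_inf hs hs') = (g.f (s a) (s' a)).app W (le_inf hs hs'))
    (hs : ∀ a, N a ≤ D.U (s a)) (hs' : ∀ a, N a ≤ D'.U (s' a)) : f = g := by
  refine hom_ext N hN fun i j a W hi hj ha => ?_
  have e₁ := f.compat (s a) i (s' a) j W (ha.trans (hs a)) hi (ha.trans (hs' a)) hj
  have e₂ := g.compat (s a) i (s' a) j W (ha.trans (hs a)) hi (ha.trans (hs' a)) hj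
  rw [h a W (ha.trans (hs a)) (ha.trans (hs' a)) ha, ← e₂] at e₁
  exact add_left_cancel e₁

/-- Compatible local morphisms between representatives define a morphism. -/
theorem exists_hom {κ : Type u} (N : κ → Opens X) (hN : ∀ x, ∃ a, x ∈ N a)
    (s : κ → D.ι) (hs : ∀ a, N a ≤ D.U (s a)) (s' : κ → D'.ι) (hs' : ∀ a, N a ≤ D'.U (s' a))
    (g : ∀ a, 𝒯.LocHom (N a))
    (hg : ∀ a (W : Opens X) (ha : W ≤ N a), VertexAlgebroid.CurvedMor
      ((D.obj (s a)).app W (ha.trans (hs a))) ((D'.obj (s' a)).app W (ha.trans (hs' a)))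
      ((g a).app W ha) 0)
    (hc : ∀ a b (W : Opens X) (ha : W ≤ N a) (hb : W ≤ N b),
      (D.h (s a) (s b)).app W (le_inf (ha.trans (hs a)) (hb.trans (hs b))) + (g b).app W hb =
        (g a).app W ha +
          (D'.h (s' a) (s' b)).app W (le_inf (ha.trans (hs' a)) (hb.trans (hs' b)))) :
    ∃ f : Hom D D', ∀ a (W : Opens X) (ha : W ≤ N a),
      (f.f (s a) (s' a)).app W (le_inf (ha.trans (hs a)) (ha.trans (hs' a))) = (g a).app W ha := by
  have key : ∀ i j, ∃ F : 𝒯.LocHom (D.U i ⊓ D'.U j), ∀ (a : κ) (W : Opens X)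
      (hU : W ≤ D.U i ⊓ D'.U j) (ha : W ≤ N a), F.app W hU =
        (D.h i (s a)).app W (le_inf (le_inf_iff.1 hU).1 (ha.trans (hs a))) + (g a).app W ha +
          (D'.h (s' a) j).app W (le_inf (ha.trans (hs' a)) (le_inf_iff.1 hU).2) := by
    intro i j
    refine LocHom.exists_glue N (fun x _ => hN x) _ ?_ ?_
    · intro a V W hU ha hWV τ
      simp only [LinearMap.add_apply, map_add, LocHom.nat]
    · intro a b W hU ha hb
      obtain ⟨hi, hj⟩ := le_inf_iff.1 hU
      rw [← D.cocycle i (s a) (s b) W hi (ha.trans (hs a)) (hb.trans (hs b)),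
        ← D'.cocycle (s' a) (s' b) j W (ha.trans (hs' a)) (hb.trans (hs' b)) hj]
      linear_combination (norm := module) -(hc a b W ha hb)
  choose F hF using key
  have hF' : ∀ i j a W (hi : W ≤ D.U i) (hj : W ≤ D'.U j) (ha : W ≤ N a),
      (F i j).app W (le_inf hi hj) = (D.h i (s a)).app W (le_inf hi (ha.trans (hs a))) +
        (g a).app W ha + (D'.h (s' a) j).app W (le_inf (ha.trans (hs' a)) hj) :=
    fun i j a W hi hj ha => hF i j a W (le_inf hi hj) ha
  refine ⟨⟨F, fun i j W hi hj => ?_, fun i i' j j' W hi hi' hj hj' => ?_⟩, fun a W ha => ?_⟩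
  · refine isMor_of_cover N ((D.obj i).res hi) ((D'.obj j).res hj) ((F i j).res (le_inf hi hj))
      (fun x _ => hN x) fun a V hV ha => ?_
    rw [LocHom.res_app, hF' i j a V (hV.trans hi) (hV.trans hj) ha]
    exact ((D.isMor _ _ V _ _).comp (VertexAlgebroid.isMor_iff.2 (hg a V ha))).comp
      (D'.isMor _ _ V _ _)
  · refine LocHom.app_eq_of_cover (𝒯 := 𝒯) N
      (f := (D.h i i').res (le_inf hi hi') + (F i' j').res (le_inf hi' hj'))
      (g := (F i j).res (le_inf hi hj) + (D'.h j j').res (le_inf hj hj')) (fun x _ => hN x) ?_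
    intro a V hV ha
    rw [LocHom.add_app, LocHom.add_app, LocHom.res_app, LocHom.res_app, LocHom.res_app,
      LocHom.res_app, hF' i j a V (hV.trans hi) (hV.trans hj) ha,
      hF' i' j' a V (hV.trans hi') (hV.trans hj') ha,
      ← D.cocycle i i' (s a) V (hV.trans hi) (hV.trans hi') (ha.trans (hs a)),
      ← D'.cocycle (s' a) j j' V (ha.trans (hs' a)) (hV.trans hj) (hV.trans hj')]
    abel
  · rw [hF' (s a) (s' a) a W (ha.trans (hs a)) (ha.trans (hs' a)) ha,
      h_self D (s a) W (ha.trans (hs a)), h_self D' (s' a) W (ha.trans (hs' a)), zero_add, add_zero]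

/-- Every morphism is invertible. -/
theorem isIso_of_hom (f : D ⟶ D') : IsIso f := by
  let g : D' ⟶ D := Hom.mk (fun i j => -(Hom.f f j i).res (le_inf inf_le_right inf_le_left))
    (fun i j W hi hj => by
      have H := (Hom.curvedMor f j i W hj hi).inv
      rw [neg_zero] at H
      exact VertexAlgebroid.isMor_iff.2 H)
    (fun i i' j j' W hi hi' hj hj' => by
      have e := Hom.compat f j j' i i' W hj hj' hi hi'
      change (D'.h i i').app W _ + -(Hom.f f j' i').app W _ =
        -(Hom.f f j i).app W _ + (D.h j j').app W _
      linear_combination (norm := module) -e)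
  refine ⟨g, hom_ext D'.U D'.cover fun i i' j W hi hi' hj => ?_,
    hom_ext D.U D.cover fun i i' j W hi hi' hj => ?_⟩
  · refine (compHom_app f g i j i' W hi hj hi').trans ?_
    have e := Hom.compat f i i' j j W hi hi' hj hj
    rw [h_self D' j W hj] at e
    change (Hom.f f i j).app W _ + -(Hom.f f i' j).app W _ = (D.h i i').app W _
    linear_combination (norm := module) -e
  · refine (compHom_app g f i j i' W hi hj hi').trans ?_
    have e := Hom.compat f j j i i' W hj hj hi hi'
    rw [h_self D j W hj] at e
    change -(Hom.f f j i).app W _ + (Hom.f f j i').app W _ = (D'.h i i').app W _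
    linear_combination (norm := module) e

end GlobalVA

end ExtLieSheaf

/-! ### The torsor of isomorphism classes -/

/-- A group acts simply transitively on `P` if a relation `R x p q`, to be read as `q = x + p`, is
additive, and is functional in `q` and in `x`. -/
theorem exists_addTorsor_of_rel {G P : Type*} [AddCommGroup G] [Nonempty P] (R : G → P → P → Prop)
    (zero : ∀ p, R 0 p p) (add : ∀ x y p q r, R x p q → R y q r → R (y + x) p r)
    (exists_right : ∀ x p, ∃ q, R x p q) (exists_left : ∀ p q, ∃ x, R x p q)
    (eq_of_zero : ∀ p q, R 0 p q → p = q) (eq_zero : ∀ x p, R x p p → x = 0) :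
    ∃ _ : AddTorsor G P, ∀ x p q, R x p q → x +ᵥ p = q := by
  have neg : ∀ x p q, R x p q → R (-x) q p := fun x p q h => by
    obtain ⟨y, hy⟩ := exists_left q p
    rwa [neg_eq_of_add_eq_zero_left (eq_zero _ _ (add x y p q p h hy))]
  have uniq : ∀ x p q q', R x p q → R x p q' → q = q' := fun x p q q' h h' => by
    have e := add _ _ _ _ _ (neg _ _ _ h) h'
    rw [add_neg_cancel] at e
    exact eq_of_zero _ _ e
  have uniq' : ∀ x x' p q, R x p q → R x' p q → x = x' := fun x x' p q h h' => by
    have e := eq_zero _ _ (add _ _ _ _ _ h' (neg _ _ _ h))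
    exact (neg_add_eq_zero.1 e)
  choose act hact using exists_right
  choose dif hdif using exists_left
  exact ⟨{  vadd := act
            vsub := fun p q => dif q p
            zero_vadd := fun p => uniq _ _ _ _ (hact 0 p) (zero p)
            add_vadd := fun x y p =>
              uniq _ _ _ _ (hact (x + y) p) (add _ _ _ _ _ (hact y p) (hact x _))
            vsub_vadd' := fun p q => uniq _ _ _ _ (hact _ _) (hdif q p)
            vadd_vsub' := fun x p => uniq' _ _ _ _ (hdif p _) (hact x p) },
    fun x p q h => uniq _ _ _ _ (hact x p) h⟩

namespace ExtLieSheaf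

open ExtLieAlgebroid

variable {k : Type v} [CommRing k] [Invertible (2 : k)] {X : TopCat.{u}}
  {𝒯 : ExtLieSheaf.{u, v} k X}

namespace GlobalVA

/-- A comparison of two global vertex algebroids: a one-cocycle `(ω, η)` on a cover by
neighbourhoods `N a` of the points, and isomorphisms `g_a : 𝒜_{s a} ∔ ω_a → 𝒜'_{s' a}` between local
representatives which intertwine the gluing isomorphisms `h + η` and `h'`. -/
structure Comparison (D D' : 𝒯.GlobalVA) where
  N : X → Opens X
  mem : ∀ a, a ∈ N a
  s : X → D.ι
  hs : ∀ a, N a ≤ D.U (s a)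
  s' : X → D'.ι
  hs' : ∀ a, N a ≤ D'.U (s' a)
  g : ∀ a, 𝒯.LocHom (N a)
  z : LinearMap.ker (𝒯.D1 N)
  curvedMor : ∀ a (W : Opens X) (ha : W ≤ N a), VertexAlgebroid.CurvedMor
    ((D.obj (s a)).app W (ha.trans (hs a))) ((D'.obj (s' a)).app W (ha.trans (hs' a)))
    ((g a).app W ha) (-(z.1.1 a).app W ha)
  compat : ∀ a b (W : Opens X) (ha : W ≤ N a) (hb : W ≤ N b),
    (D.h (s a) (s b)).app W (le_inf (ha.trans (hs a)) (hb.trans (hs b))) +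
        toHom _ ((z.1.2 a b).app W (le_inf ha hb)) + (g b).app W hb =
      (g a).app W ha + (D'.h (s' a) (s' b)).app W (le_inf (ha.trans (hs' a)) (hb.trans (hs' b)))

variable {D D' D'' : 𝒯.GlobalVA}

/-- The class of the cocycle of a comparison. -/
noncomputable def Comparison.cls (C : Comparison D D') : 𝒯.H1 := H1.mk C.N id C.mem C.z

/-- The maps `g_a` exist locally, and `g_a + h'_ab - h_ab - g_b` is a two-form `η_ab`. -/
theorem exists_comparison (h𝒯 : 𝒯.IsRegular) (D D' : 𝒯.GlobalVA) : Nonempty (Comparison D D') := by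
  choose s hs using D.cover
  choose s' hs' using D'.cover
  choose N hN h h' g u hg using fun a =>
    h𝒯.exists_local_curvedMor (hs a) (hs' a) (D.obj (s a)) (D'.obj (s' a))
  have H : ∀ a b, ∃ η : 𝒯.Form2 (N a ⊓ N b), η.toLocHom =
      (g a).res inf_le_left + (D'.h (s' a) (s' b)).res (inf_le_inf (h' a) (h' b))
        - ((D.h (s a) (s b)).res (inf_le_inf (h a) (h b)) + (g b).res inf_le_right) ∧
      𝒯.d _ η = Form3.res inf_le_left (u a) + 0 - (0 + Form3.res inf_le_right (u b)) := by
    intro a b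
    have la : N a ⊓ N b ≤ N a := inf_le_left
    have lb : N a ⊓ N b ≤ N b := inf_le_right
    exact CurvedMor.exists_form2 (𝒜 := (D.obj (s a)).res (la.trans (h a)))
      (ℬ := (D'.obj (s' b)).res (lb.trans (h' b)))
      (fun W hW => (hg a W (hW.trans la)).comp (D'.curvedMor _ _ W ((hW.trans la).trans (h' a))
        ((hW.trans lb).trans (h' b))))
      (fun W hW => (D.curvedMor _ _ W ((hW.trans la).trans (h a))
        ((hW.trans lb).trans (h b))).comp (hg b W (hW.trans lb)))
  choose η hη hd using H
  have hη' : ∀ a b W (ha : W ≤ N a) (hb : W ≤ N b), toHom _ ((η a b).app W (le_inf ha hb)) =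
      (g a).app W ha +
        (D'.h (s' a) (s' b)).app W (le_inf (ha.trans (h' a)) (hb.trans (h' b))) -
        ((D.h (s a) (s b)).app W (le_inf (ha.trans (h a)) (hb.trans (h b))) + (g b).app W hb) :=
    fun a b W ha hb => congrArg (fun t : 𝒯.LocHom _ => t.app W (le_inf ha hb)) (hη a b)
  refine ⟨⟨N, hN, s, h, s', h', g, ⟨(fun a => -u a, η), mem_ker_D1.2 ⟨?_, ?_⟩⟩, ?_, ?_⟩⟩
  · intro a b W ha hb
    have e : (𝒯.sec W).dTwo ((η a b).app W (le_inf ha hb)) =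
      (u a).app W ha + 0 - (0 + (u b).app W hb) :=
      congrArg (fun t : 𝒯.Form3 _ => t.app W (le_inf ha hb)) (hd a b)
    refine e.trans ?_
    change _ = -(u b).app W hb - -(u a).app W ha
    abel
  · intro a b c W ha hb hc
    refine toHom_injective _ ?_
    rw [map_add, map_sub, hη' a b W ha hb, hη' b c W hb hc, hη' a c W ha hc, map_zero,
      ← D.cocycle (s a) (s b) (s c) W (ha.trans (h a)) (hb.trans (h b)) (hc.trans (h c)),
      ← D'.cocycle (s' a) (s' b) (s' c) W (ha.trans (h' a)) (hb.trans (h' b)) (hc.trans (h' c))]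
    abel
  · intro a W ha
    have e : -(-u a).app W ha = (u a).app W ha := neg_neg _
    rw [e]
    exact hg a W ha
  · intro a b W ha hb
    rw [hη' a b W ha hb]
    abel

/-- Composition of comparisons. -/
noncomputable def Comparison.comp (C : Comparison D D') (C' : Comparison D' D'') :
    Comparison D D'' where
  N a := C.N a ⊓ C'.N a
  mem a := ⟨C.mem a, C'.mem a⟩
  s := C.s
  hs a := inf_le_left.trans (C.hs a)
  s' := C'.s'
  hs' a := inf_le_right.trans (C'.hs' a)
  g a := (C.g a).res inf_le_left +
    (D'.h (C.s' a) (C'.s a)).res (le_inf (inf_le_left.trans (C.hs' a))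
      (inf_le_right.trans (C'.hs a)))
    + (C'.g a).res inf_le_right
  z := ⟨𝒯.pull1 id (fun _ => inf_le_left) C.z.1, 𝒯.pull1_mem _ _ C.z.2⟩ +
    ⟨𝒯.pull1 id (fun _ => inf_le_right) C'.z.1, 𝒯.pull1_mem _ _ C'.z.2⟩
  curvedMor a W ha := by
    have H := ((C.curvedMor a W (ha.trans inf_le_left)).comp (D'.curvedMor (C.s' a) (C'.s a) W
      ((ha.trans inf_le_left).trans (C.hs' a)) ((ha.trans inf_le_right).trans (C'.hs a)))).comp
      (C'.curvedMor a W (ha.trans inf_le_right))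
    rw [add_zero, ← neg_add] at H
    exact H
  compat a b W ha hb := by
    have a₁ := ha.trans inf_le_left
    have b₁ := hb.trans inf_le_left
    have a₂ := ha.trans inf_le_right
    have b₂ := hb.trans inf_le_right
    have e₁ := C.compat a b W a₁ b₁
    have e₂ := C'.compat a b W a₂ b₂
    have c₁ := D'.cocycle (C.s' a) (C.s' b) (C'.s b) W (a₁.trans (C.hs' a)) (b₁.trans (C.hs' b))
      (b₂.trans (C'.hs b))
    have c₂ := D'.cocycle (C.s' a) (C'.s a) (C'.s b) W (a₁.trans (C.hs' a)) (a₂.trans (C'.hs a))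
      (b₂.trans (C'.hs b))
    change (D.h (C.s a) (C.s b)).app W _ + toHom _ ((C.z.1.2 a b).app W _ + (C'.z.1.2 a b).app W _)
      + ((C.g b).app W _ + (D'.h (C.s' b) (C'.s b)).app W _ + (C'.g b).app W _) =
      (C.g a).app W _ + (D'.h (C.s' a) (C'.s a)).app W _ + (C'.g a).app W _
      + (D''.h (C'.s' a) (C'.s' b)).app W _
    rw [map_add]
    linear_combination (norm := module) e₁ + e₂ + c₁ - c₂

theorem Comparison.cls_comp (C : Comparison D D') (C' : Comparison D' D'') :
    (C.comp C').cls = C.cls + C'.cls := by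
  refine (map_add _ _ _).trans (congrArg₂ _ ?_ ?_)
  · exact H1.mk_pull id C.mem id _ C.z id _
  · exact H1.mk_pull id C'.mem id _ C'.z id _

/-- The class of a comparison of `D` with itself is trivial: the maps `g_a`, followed by gluing
isomorphisms, are two-forms whose coboundary is the cocycle. -/
theorem Comparison.cls_eq_zero (C : Comparison D D) : C.cls = 0 := by
  have H : ∀ a, ∃ ζ : 𝒯.Form2 (C.N a), ζ.toLocHom = 0 -
      ((C.g a) + (D.h (C.s' a) (C.s a)).res (le_inf (C.hs' a) (C.hs a))) ∧
      𝒯.d _ ζ = 0 - (-C.z.1.1 a + 0) := fun a =>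
    CurvedMor.exists_form2 (𝒜 := (D.obj (C.s a)).res (C.hs a))
      (fun W hW => VertexAlgebroid.CurvedMor.refl _) (fun W hW => (C.curvedMor a W hW).comp
        (D.curvedMor (C.s' a) (C.s a) W (hW.trans (C.hs' a)) (hW.trans (C.hs a))))
  choose ζ hζ hd using H
  have hζ' : ∀ a W (ha : W ≤ C.N a), toHom _ ((ζ a).app W ha) = 0 - ((C.g a).app W ha +
      (D.h (C.s' a) (C.s a)).app W (le_inf (ha.trans (C.hs' a)) (ha.trans (C.hs a)))) :=
    fun a W ha => congrArg (fun t : 𝒯.LocHom _ => t.app W ha) (hζ a)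
  refine (H1.mk_eq_mk id C.mem id C.mem (z' := 0) C.N C.mem (fun _ => le_rfl) (fun _ => le_rfl) ζ
    (D0_eq_iff.2 ⟨?_, ?_⟩)).trans (map_zero _)
  · intro a W ha
    have e : (𝒯.sec W).dTwo ((ζ a).app W ha) = 0 - (-(C.z.1.1 a).app W ha + 0) :=
      congrArg (fun t : 𝒯.Form3 _ => t.app W ha) (hd a)
    rw [e, add_zero, zero_sub, neg_neg]
    exact sub_zero _
  · intro a b W ha hb
    refine toHom_injective _ ?_
    rw [map_sub, hζ' a W ha, hζ' b W hb]
    have e := C.compat a b W ha hb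
    have c₁ := D.cocycle (C.s' a) (C.s' b) (C.s b) W (ha.trans (C.hs' a)) (hb.trans (C.hs' b))
      (hb.trans (C.hs b))
    have c₂ := D.cocycle (C.s' a) (C.s a) (C.s b) W (ha.trans (C.hs' a)) (ha.trans (C.hs a))
      (hb.trans (C.hs b))
    change toHom _ ((C.z.1.2 a b).app W _ - 0) = _
    rw [sub_zero]
    linear_combination (norm := module) e + c₁ - c₂

/-- If the class of a comparison is trivial, the maps `g_a` can be corrected by two-forms. -/
theorem Comparison.nonempty_hom (C : Comparison D D') (hC : C.cls = 0) : Nonempty (Hom D D') := by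
  obtain ⟨N, hN, h, y, hy⟩ := H1.exists_of_mk_eq_zero id C.mem hC
  obtain ⟨hω, hη⟩ := D0_eq_iff.1 hy
  obtain ⟨f, -⟩ := exists_hom N (fun x => ⟨x, hN x⟩) C.s (fun a => (h a).trans (C.hs a)) C.s'
    (fun a => (h a).trans (C.hs' a)) (fun a => (y a).toLocHom + (C.g a).res (h a)) (fun a W ha => by
      have e : (C.z.1.1 a).app W (ha.trans (h a)) = _ := hω a W ha
      have H := (VertexAlgebroid.CurvedMor.ofTwoForm _ ((y a).app W ha)).comp
        (C.curvedMor a W (ha.trans (h a)))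
      rw [e, add_neg_cancel] at H
      exact H) (fun a b W ha hb => by
      have e : (C.z.1.2 a b).app W (le_inf (ha.trans (h a)) (hb.trans (h b))) = _ := hη a b W ha hb
      have e' := C.compat a b W (ha.trans (h a)) (hb.trans (h b))
      rw [e, map_sub] at e'
      change _ + (toHom _ ((y b).app W _) + (C.g b).app W _) =
        toHom _ ((y a).app W _) + (C.g a).app W _ + _
      linear_combination (norm := module) e')
  exact ⟨f⟩

theorem exists_comparison_of_hom (f : Hom D D') : ∃ C : Comparison D D', C.cls = 0 := by
  choose s hs using D.cover
  choose s' hs' using D'.cover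
  refine ⟨⟨fun a => D.U (s a) ⊓ D'.U (s' a), fun a => ⟨hs a, hs' a⟩, s, fun _ => inf_le_left, s',
    fun _ => inf_le_right, fun a => f.f (s a) (s' a), 0, fun a W ha => ?_, fun a b W ha hb => ?_⟩,
    map_zero _⟩
  · have H := f.curvedMor (s a) (s' a) W (ha.trans inf_le_left) (ha.trans inf_le_right)
    rw [← neg_zero] at H
    exact H
  · refine Eq.trans ?_ (f.compat (s a) (s b) (s' a) (s' b) W (ha.trans inf_le_left)
      (hb.trans inf_le_left) (ha.trans inf_le_right) (hb.trans inf_le_right))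
    exact congrArg (· + _) (add_zero _)

/-- The comparison of `D` with its twist by a cocycle. -/
theorem exists_comparison_twist (D : 𝒯.GlobalVA) (z : LinearMap.ker (𝒯.D1 D.U)) (r : X → D.ι)
    (hr : ∀ x, x ∈ D.U (r x)) : ∃ C : Comparison D (D.twist z), C.cls = H1.mk D.U r hr z := by
  refine ⟨⟨fun x => D.U (r x), hr, r, fun _ => le_rfl, r, fun _ => le_rfl, 0,
    ⟨𝒯.pull1 (V := fun x => D.U (r x)) r (fun _ => le_rfl) z.1, 𝒯.pull1_mem r _ z.2⟩,
    fun a W ha => ?_, fun a b W ha hb => ?_⟩,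
    H1.mk_pull r hr id hr z r fun _ => le_rfl⟩
  · have H := (VertexAlgebroid.curvedMor_twist (ω₁ := 0) (ω₂ := (z.1.1 (r a)).app W ha)
      (ω := -(z.1.1 (r a)).app W ha)).2 (by
        rw [add_neg_cancel, sub_zero]
        exact VertexAlgebroid.CurvedMor.refl ((D.obj (r a)).app W ha))
    rw [VertexAlgebroid.twist_zero] at H
    exact H
  · exact (add_zero _).trans (zero_add _).symm

/-- Restriction of a global vertex algebroid to a refinement of its cover. -/
def refine {κ : Type u} (D : 𝒯.GlobalVA) (N : κ → Opens X) (hN : ∀ x, ∃ a, x ∈ N a) (s : κ → D.ι)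
    (hs : ∀ a, N a ≤ D.U (s a)) : 𝒯.GlobalVA where
  ι := κ
  U := N
  cover := hN
  obj a := (D.obj (s a)).res (hs a)
  h a b := (D.h (s a) (s b)).res (inf_le_inf (hs a) (hs b))
  isMor _ _ W _ _ := D.isMor _ _ W _ _
  cocycle _ _ _ W ha hb hc :=
    D.cocycle _ _ _ W (ha.trans (hs _)) (hb.trans (hs _)) (hc.trans (hs _))

theorem nonempty_hom_refine {κ : Type u} (D : 𝒯.GlobalVA) (N : κ → Opens X)
    (hN : ∀ x, ∃ a, x ∈ N a) (s : κ → D.ι) (hs : ∀ a, N a ≤ D.U (s a)) :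
    Nonempty (Hom D (D.refine N hN s hs)) :=
  ⟨⟨fun i a => (D.h i (s a)).res (inf_le_inf le_rfl (hs a)), fun _ _ W _ _ => D.isMor _ _ W _ _,
    fun i i' a b W hi hi' ha hb => (D.cocycle i i' (s b) W hi hi' (hb.trans (hs b))).trans
      (D.cocycle i (s a) (s b) W hi (ha.trans (hs a)) (hb.trans (hs b))).symm⟩⟩

theorem exists_comparison_of_class (x : 𝒯.H1) (D : 𝒯.GlobalVA) :
    ∃ (D' : 𝒯.GlobalVA) (C : Comparison D D'), C.cls = x := by
  obtain ⟨N, hN, z, rfl⟩ := H1.exists_eq_mk x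
  choose s hs using D.cover
  have hV : ∀ x, x ∈ N x ⊓ D.U (s x) := fun x => ⟨hN x, hs x⟩
  let D₁ := D.refine (fun x => N x ⊓ D.U (s x)) (fun x => ⟨x, hV x⟩) s fun _ => inf_le_right
  obtain ⟨C₁, hC₁⟩ := exists_comparison_of_hom (D.nonempty_hom_refine (fun x => N x ⊓ D.U (s x))
    (fun x => ⟨x, hV x⟩) s fun _ => inf_le_right).some
  obtain ⟨C₂, hC₂⟩ := D₁.exists_comparison_twist
    ⟨𝒯.pull1 (V := fun x => N x ⊓ D.U (s x)) id (fun _ => inf_le_left) z.1, 𝒯.pull1_mem _ _ z.2⟩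
    id hV
  exact ⟨_, C₁.comp C₂, by
    rw [Comparison.cls_comp, hC₁, hC₂, zero_add]
    exact H1.mk_pull id hN id hV z id fun _ => inf_le_left⟩

/-- Isomorphism classes of global vertex algebroids form a torsor under `H¹`, on which a cocycle
acts by twisting. -/
theorem exists_addTorsor (h𝒯 : 𝒯.IsRegular) (hne : Nonempty 𝒯.GlobalVA) :
    ∃ _ : AddTorsor 𝒯.H1 (Quotient (isIsomorphicSetoid 𝒯.GlobalVA)),
      ∀ (D : 𝒯.GlobalVA) (z : LinearMap.ker (𝒯.D1 D.U)) (r : X → D.ι) (hr : ∀ x, x ∈ D.U (r x)),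
        H1.mk D.U r hr z +ᵥ Quotient.mk (isIsomorphicSetoid 𝒯.GlobalVA) D =
          Quotient.mk (isIsomorphicSetoid 𝒯.GlobalVA) (D.twist z) := by
  have iso : ∀ {D D' : 𝒯.GlobalVA}, Nonempty (Hom D D') →
      Quotient.mk (isIsomorphicSetoid 𝒯.GlobalVA) D = Quotient.mk (isIsomorphicSetoid _) D' :=
    fun ⟨f⟩ => Quotient.sound (by
      have := isIso_of_hom f
      exact ⟨asIso (C := 𝒯.GlobalVA) f⟩)
  have iso' : ∀ {D D' : 𝒯.GlobalVA}, Quotient.mk (isIsomorphicSetoid 𝒯.GlobalVA) D =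
      Quotient.mk (isIsomorphicSetoid _) D' → Nonempty (Hom D D') := fun h =>
    (Quotient.exact h).map Iso.hom
  have : Nonempty (Quotient (isIsomorphicSetoid 𝒯.GlobalVA)) := hne.map (Quotient.mk _)
  let R : 𝒯.H1 → Quotient (isIsomorphicSetoid 𝒯.GlobalVA) →
      Quotient (isIsomorphicSetoid 𝒯.GlobalVA) → Prop := fun x p q =>
    ∃ (D D' : 𝒯.GlobalVA) (C : Comparison D D'), Quotient.mk _ D = p ∧ Quotient.mk _ D' = q ∧
      C.cls = x
  obtain ⟨t, ht⟩ : ∃ _ : AddTorsor 𝒯.H1 (Quotient (isIsomorphicSetoid 𝒯.GlobalVA)),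
      ∀ x p q, R x p q → x +ᵥ p = q := by
    refine exists_addTorsor_of_rel R ?_ ?_ ?_ ?_ ?_ ?_
    · rintro ⟨D⟩
      obtain ⟨C, hC⟩ := exists_comparison_of_hom (idHom D)
      exact ⟨D, D, C, rfl, rfl, hC⟩
    · rintro x y p q r ⟨D, D', C, rfl, rfl, rfl⟩ ⟨E, E', C', h, rfl, rfl⟩
      obtain ⟨C₁, hC₁⟩ := exists_comparison_of_hom (iso' h.symm).some
      refine ⟨D, E', (C.comp C₁).comp C', rfl, rfl, ?_⟩
      rw [Comparison.cls_comp, Comparison.cls_comp, hC₁, add_zero, add_comm]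
    · rintro x ⟨D⟩
      obtain ⟨D', C, hC⟩ := D.exists_comparison_of_class x
      exact ⟨_, D, D', C, rfl, rfl, hC⟩
    · rintro ⟨D⟩ ⟨D'⟩
      obtain ⟨C⟩ := exists_comparison h𝒯 D D'
      exact ⟨C.cls, D, D', C, rfl, rfl, rfl⟩
    · rintro p q ⟨D, D', C, rfl, rfl, hC⟩
      exact iso (C.nonempty_hom hC)
    · rintro x p ⟨D, D', C, rfl, h, rfl⟩
      obtain ⟨C₁, hC₁⟩ := exists_comparison_of_hom (iso' h).some
      have e := (C.comp C₁).cls_eq_zero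
      rwa [Comparison.cls_comp, hC₁, add_zero] at e
  refine ⟨t, fun D z r hr => ht _ _ _ ?_⟩
  obtain ⟨C, hC⟩ := D.exists_comparison_twist z r hr
  exact ⟨D, _, C, rfl, rfl, hC⟩

/-! ### Automorphisms -/

/-- A closed two-form `η` as the automorphism `h_ij + η`. -/
def autHom (D : 𝒯.GlobalVA) (η : 𝒯.H0) : Hom D D where
  f i j := D.h i j + η.1.toLocHom.res le_top
  isMor i j W hi hj := by
    have e : (𝒯.sec W).dTwo (η.1.app W le_top) = 0 :=
      congrArg (fun t : 𝒯.Form3 ⊤ => t.app W le_top) (LinearMap.mem_ker.1 η.2)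
    have H := (D.curvedMor i j W hi hj).comp
      (VertexAlgebroid.CurvedMor.ofTwoForm _ (η.1.app W le_top))
    rw [e, add_zero] at H
    exact VertexAlgebroid.isMor_iff.2 H
  compat i i' j j' W hi hi' hj hj' := by
    have e := (D.cocycle i i' j' W hi hi' hj').trans (D.cocycle i j j' W hi hj hj').symm
    change (D.h i i').app W _ + ((D.h i' j').app W _ + toHom _ (η.1.app W le_top)) =
      (D.h i j).app W _ + toHom _ (η.1.app W le_top) + (D.h j j').app W _
    linear_combination (norm := module) e

theorem autHom_app (D : 𝒯.GlobalVA) (η : 𝒯.H0) (i j : D.ι) (W : Opens X) (hi : W ≤ D.U i)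
    (hj : W ≤ D.U j) : ((D.autHom η).f i j).app W (le_inf hi hj) =
      (D.h i j).app W (le_inf hi hj) + toHom _ (η.1.app W le_top) := rfl

theorem autHom_comp (D : 𝒯.GlobalVA) (η η' : 𝒯.H0) :
    compHom (D.autHom η) (D.autHom η') = D.autHom (η + η') := by
  refine hom_ext D.U D.cover fun i j l W hi hj hl => ?_
  rw [compHom_app _ _ i l j W hi hl hj, autHom_app D η i l W hi hl, autHom_app D η' l j W hl hj,
    autHom_app D _ i j W hi hj,
    ← D.cocycle i l j W hi hl hj]
  change _ = _ + toHom _ (η.1.app W le_top + η'.1.app W le_top)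
  rw [map_add]
  abel

theorem autHom_zero (D : 𝒯.GlobalVA) : D.autHom 0 = idHom D := by
  refine hom_ext D.U D.cover fun i j l W hi hj hl => ?_
  exact add_zero _

theorem autHom_injective (D : 𝒯.GlobalVA) : Function.Injective D.autHom := by
  intro η η' h
  refine Subtype.ext (Form2.eq_of_cover D.U (fun x _ => D.cover x) fun i W _ hi => ?_)
  have e := congrArg (fun f : Hom D D => (f.f i i).app W (le_inf hi hi)) h
  exact toHom_injective _ (add_left_cancel e)

theorem autHom_surjective (D : 𝒯.GlobalVA) : Function.Surjective D.autHom := by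
  intro f
  have H : ∀ i, ∃ ζ : 𝒯.Form2 (D.U i), ζ.toLocHom = (f.f i i).res (le_inf le_rfl le_rfl) - 0 ∧
      𝒯.d _ ζ = 0 - 0 := fun i =>
    CurvedMor.exists_form2 (𝒜 := D.obj i) (ℬ := D.obj i) (fun W hW => f.curvedMor i i W hW hW)
      fun W hW => VertexAlgebroid.CurvedMor.refl _
  choose ζ hζ hd using H
  have hζ' : ∀ i W (hi : W ≤ D.U i), toHom _ ((ζ i).app W hi) = (f.f i i).app W (le_inf hi hi) :=
    fun i W hi => (congrArg (fun t : 𝒯.LocHom _ => t.app W hi) (hζ i)).trans (sub_zero _)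
  obtain ⟨η, hη⟩ := Form2.exists_glue (U := ⊤) D.U (fun x _ => D.cover x)
    (fun i W _ hi => (ζ i).app W hi) (fun i V W _ hV hWV τ => (ζ i).nat hV hWV τ)
    (fun i j W _ hi hj => toHom_injective _ (by
      have e := f.compat i j i j W hi hj hi hj
      rw [hζ' i W hi, hζ' j W hj]
      linear_combination (norm := module) -e))
  refine ⟨⟨η, LinearMap.mem_ker.2 (Form3.eq_of_cover D.U (fun x _ => D.cover x)
    fun i W hW hi => ?_)⟩, hom_ext D.U D.cover fun i j l W hi hj hl => ?_⟩
  · rw [d_app, hη i W hW hi]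
    exact (congrArg (fun t : 𝒯.Form3 _ => t.app W hi) (hd i)).trans (sub_zero _)
  · have e := f.compat i i i j W hi hi hi hj
    change (D.h i j).app W _ + toHom _ (η.app W le_top) = _
    rw [hη i W le_top hi, hζ' i W hi, add_comm, ← e, D.h_self i W hi, zero_add]

theorem exists_mulEquiv_aut (D : 𝒯.GlobalVA) : ∃ e : Multiplicative 𝒯.H0 ≃* Aut D,
    ∀ (η : 𝒯.H0) (i j : D.ι) (W : Opens X) (hi : W ≤ D.U i) (hj : W ≤ D.U j),
      ((e (Multiplicative.ofAdd η)).hom.f i j).app W (le_inf hi hj) =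
        (D.h i j).app W (le_inf hi hj) + (η.1.app W le_top).val.restrictScalars k := by
  let φ : Multiplicative 𝒯.H0 → Aut D := fun η =>
    ⟨D.autHom η.toAdd, D.autHom (-η.toAdd), by
      refine (D.autHom_comp _ _).trans ?_
      rw [add_neg_cancel]
      exact D.autHom_zero, by
      refine (D.autHom_comp _ _).trans ?_
      rw [neg_add_cancel]
      exact D.autHom_zero⟩
  have hφ : ∀ η η', φ (η * η') = φ η * φ η' := fun η η' => Iso.ext (by
    refine Eq.trans ?_ (D.autHom_comp η'.toAdd η.toAdd).symm
    rw [add_comm]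
    rfl)
  exact ⟨MulEquiv.ofBijective (MulHom.mk φ hφ) ⟨fun η η' h =>
    D.autHom_injective (congrArg Iso.hom h), fun f =>
    ⟨(D.autHom_surjective f.hom).choose, Iso.ext (D.autHom_surjective f.hom).choose_spec⟩⟩,
    fun _ _ _ _ _ _ => rfl⟩

end GlobalVA

end ExtLieSheaf

namespace ExtLieSheaf

open ExtLieAlgebroid

variable {k : Type v} [CommRing k] {X : TopCat.{u}} {𝒯 : ExtLieSheaf.{u, v} k X}

/-! ### Torsors and their morphisms -/

namespace FormTorsor

section

variable (P : 𝒯.FormTorsor) {U V W : Opens X}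

/-- Restriction of sections of a torsor. -/
def res (h : V ≤ U) (p : P.P.obj (op U)) : P.P.obj (op V) := P.P.map (homOfLE h).op p

theorem res_res (hV : V ≤ U) (hW : W ≤ V) (p : P.P.obj (op U)) :
    P.res hW (P.res hV p) = P.res (hW.trans hV) p :=
  (ConcreteCategory.congr_hom (P.P.map_comp (homOfLE hV).op (homOfLE hW).op) p).symm

theorem res_act' (h : V ≤ U) (η : 𝒯.Form2 U) (p : P.P.obj (op U)) :
    P.res h (P.act U η p) = P.act V (Form2.res h η) (P.res h p) := P.res_act h η p

theorem w_res (h : V ≤ U) (p : P.P.obj (op U)) : P.w V (P.res h p) = Form3.res h (P.w U p) :=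
  P.res_w h p

theorem exists_act (p q : P.P.obj (op U)) : ∃ η, P.act U η p = q :=
  (P.simply_transitive U p q).exists

theorem act_cancel {η η' : 𝒯.Form2 U} {p : P.P.obj (op U)} (h : P.act U η p = P.act U η' p) :
    η = η' :=
  (P.simply_transitive U p _).unique h rfl

theorem eq_of_cover {κ : Type u} (N : κ → Opens X) (hN : ∀ a, N a ≤ U)
    (cov : ∀ x ∈ U, ∃ a, x ∈ N a) {p q : P.P.obj (op U)}
    (h : ∀ a, P.res (hN a) p = P.res (hN a) q) : p = q :=
  TopCat.Sheaf.eq_of_locally_eq' ⟨P.P, P.isSheaf⟩ N U (fun a => homOfLE (hN a))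
    (le_iSup_of_cover N cov) p q h

theorem exists_glue {κ : Type u} (N : κ → Opens X) (hN : ∀ a, N a ≤ U)
    (cov : ∀ x ∈ U, ∃ a, x ∈ N a) (s : ∀ a, P.P.obj (op (N a)))
    (hs : ∀ a b, P.res (inf_le_left : N a ⊓ N b ≤ N a) (s a) =
      P.res (inf_le_right : N a ⊓ N b ≤ N b) (s b)) :
    ∃ p : P.P.obj (op U), ∀ a, P.res (hN a) p = s a := by
  let F : TopCat.Sheaf (Type u) X := ⟨P.P, P.isSheaf⟩
  have key := F.existsUnique_gluing' N U (fun a => homOfLE (hN a)) (le_iSup_of_cover N cov)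
    (sf := s) (fun a b => hs a b)
  exact key.exists

end

variable {P Q : 𝒯.FormTorsor}

theorem Hom.app_res (f : Hom P Q) {U V : Opens X} (h : V ≤ U) (p : P.P.obj (op U)) :
    f.f.app (op V) (P.res h p) = Q.res h (f.f.app (op U) p) :=
  ConcreteCategory.congr_hom (f.f.naturality (homOfLE h).op) p

variable {κ : Type u} (N : κ → Opens X) (hN : ∀ x, ∃ a, x ∈ N a)

include hN

/-- A morphism of torsors is determined by the images of local sections. -/
theorem Hom.eq_of_sections {f g : Hom P Q} (p : ∀ a, P.P.obj (op (N a)))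
    (h : ∀ a, f.f.app (op (N a)) (p a) = g.f.app (op (N a)) (p a)) : f = g := by
  refine Hom.ext (NatTrans.ext (funext fun U => ?_))
  refine ConcreteCategory.hom_ext _ _ fun t => ?_
  obtain ⟨U⟩ := U
  refine Q.eq_of_cover (fun a => U ⊓ N a) (fun _ => inf_le_left)
    (mem_of_cover (fun x _ => hN x) le_rfl) fun a => ?_
  obtain ⟨ζ, hζ⟩ := P.exists_act (P.res (inf_le_right : U ⊓ N a ≤ N a) (p a))
    (P.res (inf_le_left : U ⊓ N a ≤ U) t)
  rw [← f.app_res, ← g.app_res, ← hζ, f.map_act, g.map_act, f.app_res, g.app_res, h]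

/-- Sections `p_a` and `q_a` over the members of a cover which differ by the same two-forms, and
have the same image under `w`, are matched by a morphism of torsors. -/
theorem exists_hom (p : ∀ a, P.P.obj (op (N a))) (q : ∀ a, Q.P.obj (op (N a)))
    (hw : ∀ a, Q.w _ (q a) = P.w _ (p a))
    (hc : ∀ a b, ∃ ζ : 𝒯.Form2 (N a ⊓ N b),
      P.act _ ζ (P.res inf_le_left (p a)) = P.res inf_le_right (p b) ∧
      Q.act _ ζ (Q.res inf_le_left (q a)) = Q.res inf_le_right (q b)) :
    ∃ f : Hom P Q, ∀ a, f.f.app (op (N a)) (p a) = q a := by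
  have hc' : ∀ a b (W : Opens X) (ha : W ≤ N a) (hb : W ≤ N b), ∃ ζ : 𝒯.Form2 W,
      P.act W ζ (P.res ha (p a)) = P.res hb (p b) ∧
      Q.act W ζ (Q.res ha (q a)) = Q.res hb (q b) := by
    intro a b W ha hb
    obtain ⟨ζ, e₁, e₂⟩ := hc a b
    have e₃ := congrArg (P.res (le_inf ha hb)) e₁
    have e₄ := congrArg (Q.res (le_inf ha hb)) e₂
    rw [res_act', res_res, res_res] at e₃ e₄
    exact ⟨_, e₃, e₄⟩
  -- `M U t t'`: whenever `t = ζ + p_a` over some `W`, also `t' = ζ + q_a`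
  let M : ∀ U : Opens X, P.P.obj (op U) → Q.P.obj (op U) → Prop := fun U t t' =>
    ∀ a (W : Opens X) (hU : W ≤ U) (ha : W ≤ N a) (ζ : 𝒯.Form2 W),
      P.act W ζ (P.res ha (p a)) = P.res hU t → Q.act W ζ (Q.res ha (q a)) = Q.res hU t'
  have key : ∀ U t, ∃! t', M U t t' := by
    intro U t
    choose ζ hζ using fun a => P.exists_act (P.res (inf_le_right : U ⊓ N a ≤ N a) (p a))
      (P.res (inf_le_left : U ⊓ N a ≤ U) t)
    obtain ⟨t', ht'⟩ := Q.exists_glue (fun a => U ⊓ N a) (fun _ => inf_le_left)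
      (mem_of_cover (fun x _ => hN x) le_rfl) (fun a => Q.act _ (ζ a) (Q.res inf_le_right (q a)))
      fun a b => by
        have la : U ⊓ N a ⊓ (U ⊓ N b) ≤ U ⊓ N a := inf_le_left
        have lb : U ⊓ N a ⊓ (U ⊓ N b) ≤ U ⊓ N b := inf_le_right
        obtain ⟨ξ, e₁, e₂⟩ := hc' a b _ (la.trans inf_le_right) (lb.trans inf_le_right)
        have ea := congrArg (P.res la) (hζ a)
        have eb := congrArg (P.res lb) (hζ b)
        rw [res_act', res_res, res_res] at ea eb
        rw [← e₁, ← P.add_act, ← ea] at eb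
        rw [res_act', res_act', res_res, res_res, ← e₂, ← Q.add_act, P.act_cancel eb]
    refine ⟨t', fun a W hU ha ξ hξ => ?_, fun t'' h'' => ?_⟩
    · have e := congrArg (P.res (le_inf hU ha)) (hζ a)
      have e' := congrArg (Q.res (le_inf hU ha)) (ht' a)
      rw [res_act', res_res, res_res, ← hξ] at e
      rw [res_act', res_res, res_res, P.act_cancel e] at e'
      exact e'.symm
    · refine Q.eq_of_cover (fun a => U ⊓ N a) (fun _ => inf_le_left)
        (mem_of_cover (fun x _ => hN x) le_rfl) fun a => ?_
      rw [ht' a]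
      exact (h'' a _ _ _ _ (hζ a)).symm
  choose φ hφ using fun U t => (key U t).exists
  have uniq : ∀ U t t', M U t t' → φ U t = t' := fun U t t' h => (key U t).unique (hφ U t) h
  refine ⟨⟨{ app := fun U => ↾(φ U.unop), naturality := ?_ }, ?_, ?_⟩, fun a => ?_⟩
  · rintro ⟨U⟩ ⟨V⟩ i
    refine ConcreteCategory.hom_ext _ _ fun t => uniq V _ _ fun a W hV ha ζ h => ?_
    have e := hφ U t a W (hV.trans (leOfHom i.unop)) ha ζ (h.trans (P.res_res _ hV t))
    exact e.trans (Q.res_res _ hV _).symm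
  · intro U η t
    refine uniq U _ _ fun a W hU ha ζ h => ?_
    have e := hφ U t a W hU ha (-Form2.res hU η + ζ) (by
      rw [P.add_act, h, res_act', ← P.add_act, neg_add_cancel, P.zero_act])
    rw [res_act']
    change _ = Q.act W _ (Q.res hU (φ U t))
    rw [← e, ← Q.add_act, add_neg_cancel_left]
  · intro U t
    refine Form3.eq_of_cover N (fun x _ => hN x) fun a W hU ha => ?_
    obtain ⟨ζ, hζ⟩ := P.exists_act (P.res ha (p a)) (P.res hU t)
    have e := hφ U t a W hU ha ζ hζ
    have e₁ := congrArg (P.w W) hζ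
    have e₂ := congrArg (Q.w W) e
    rw [P.w_act, w_res, w_res] at e₁
    rw [Q.w_act, w_res, w_res, hw, e₁] at e₂
    exact (congrArg (fun t : 𝒯.Form3 W => t.app W le_rfl) e₂).symm
  · refine uniq _ _ _ fun b W ha hb ζ h => ?_
    obtain ⟨ξ, e₁, e₂⟩ := hc' b a W hb ha
    rw [← e₁] at h
    rw [P.act_cancel h, e₂]

/-- Sections which differ by the same two-forms, with the same image under `w`, are matched by an
isomorphism of torsors. -/
theorem nonempty_iso (p : ∀ a, P.P.obj (op (N a))) (q : ∀ a, Q.P.obj (op (N a)))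
    (hw : ∀ a, Q.w _ (q a) = P.w _ (p a))
    (hc : ∀ a b, ∃ ζ : 𝒯.Form2 (N a ⊓ N b),
      P.act _ ζ (P.res inf_le_left (p a)) = P.res inf_le_right (p b) ∧
      Q.act _ ζ (Q.res inf_le_left (q a)) = Q.res inf_le_right (q b)) :
    Nonempty (P ≅ Q) := by
  obtain ⟨f, hf⟩ := exists_hom N hN p q hw hc
  obtain ⟨g, hg⟩ := exists_hom N hN q p (fun a => (hw a).symm) fun a b =>
    (hc a b).imp fun _ h => h.symm
  exact ⟨⟨f, g, Hom.eq_of_sections N hN p fun a => (congrArg (g.f.app _) (hf a)).trans (hg a),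
    Hom.eq_of_sections N hN q fun a => (congrArg (f.f.app _) (hg a)).trans (hf a)⟩⟩

end FormTorsor

end ExtLieSheaf

namespace ExtLieSheaf

open ExtLieAlgebroid

variable {k : Type v} [CommRing k] [Invertible (2 : k)] {X : TopCat.{u}}
  {𝒯 : ExtLieSheaf.{u, v} k X}

namespace GlobalVA

/-! ### The torsor of isomorphisms up to a twist -/

/-- An isomorphism `D₀ ∔ ω → D` over `U`, for some closed three-form `ω` over `U`: compatible
isomorphisms between the local representatives of `D₀ ∔ ω` and `D`. -/
@[ext]
structure TwistedIso (D₀ D : 𝒯.GlobalVA) (U : Opens X) where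
  f : ∀ i j, 𝒯.LocHom (U ⊓ (D₀.U i ⊓ D.U j))
  ω : 𝒯.Form3 U
  curvedMor : ∀ (i : D₀.ι) (j : D.ι) (W : Opens X) (hU : W ≤ U) (hi : W ≤ D₀.U i) (hj : W ≤ D.U j),
    VertexAlgebroid.CurvedMor ((D₀.obj i).app W hi) ((D.obj j).app W hj)
      ((f i j).app W (le_inf hU (le_inf hi hj))) (-ω.app W hU)
  compat : ∀ (i i' : D₀.ι) (j j' : D.ι) (W : Opens X) (hU : W ≤ U) (hi : W ≤ D₀.U i)
    (hi' : W ≤ D₀.U i') (hj : W ≤ D.U j) (hj' : W ≤ D.U j'),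
    (D₀.h i i').app W (le_inf hi hi') + (f i' j').app W (le_inf hU (le_inf hi' hj')) =
      (f i j).app W (le_inf hU (le_inf hi hj)) + (D.h j j').app W (le_inf hj hj')

theorem curvedMor_of_cover {V : Opens X} (𝒜 ℬ : 𝒯.LocVA V) (h : 𝒯.LocHom V) (ω : 𝒯.Form3 V)
    {κ : Type u} (N : κ → Opens X) (hN : ∀ x ∈ V, ∃ j, x ∈ N j)
    (H : ∀ j (W : Opens X) (hW : W ≤ V), W ≤ N j →
      VertexAlgebroid.CurvedMor (𝒜.app W hW) (ℬ.app W hW) (h.app W hW) (ω.app W hW)) :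
    VertexAlgebroid.CurvedMor (𝒜.app V le_rfl) (ℬ.app V le_rfl) (h.app V le_rfl)
      (ω.app V le_rfl) :=
  VertexAlgebroid.isMor_twist.1 (isMor_of_cover N 𝒜 (ℬ.twist ω) h hN fun j W hW hj =>
    VertexAlgebroid.isMor_twist.2 (H j W hW hj))

namespace TwistedIso

variable {D₀ D D' D'' : 𝒯.GlobalVA} {U V : Opens X}

section cover

variable {κ : Type u} (N : κ → Opens X) (hN : ∀ x ∈ U, ∃ a, x ∈ N a)
  (s : κ → D₀.ι) (hs : ∀ a, N a ≤ D₀.U (s a)) (s' : κ → D.ι) (hs' : ∀ a, N a ≤ D.U (s' a))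

include hN

theorem eq_of_cover {p q : TwistedIso D₀ D U} (hω : p.ω = q.ω)
    (h : ∀ a (W : Opens X) (hU : W ≤ U) (ha : W ≤ N a),
      (p.f (s a) (s' a)).app W (le_inf hU (le_inf (ha.trans (hs a)) (ha.trans (hs' a)))) =
        (q.f (s a) (s' a)).app W (le_inf hU (le_inf (ha.trans (hs a)) (ha.trans (hs' a))))) :
    p = q := by
  refine TwistedIso.ext (funext fun i => funext fun j => ?_) hω
  refine LocHom.eq_of_cover N (fun x hx => hN x hx.1) fun a W hW ha => ?_
  obtain ⟨hU, hij⟩ := le_inf_iff.1 hW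
  obtain ⟨hi, hj⟩ := le_inf_iff.1 hij
  have e₁ := p.compat (s a) i (s' a) j W hU (ha.trans (hs a)) hi (ha.trans (hs' a)) hj
  have e₂ := q.compat (s a) i (s' a) j W hU (ha.trans (hs a)) hi (ha.trans (hs' a)) hj
  rw [h a W hU ha, ← e₂] at e₁
  exact add_left_cancel e₁

/-- Compatible local isomorphisms between representatives of `D₀ ∔ ω` and `D` define an isomorphism
`D₀ ∔ ω → D`. -/
theorem exists_of_cover (g : ∀ a, 𝒯.LocHom (U ⊓ N a)) (ω : 𝒯.Form3 U)
    (hg : ∀ a (W : Opens X) (hU : W ≤ U) (ha : W ≤ N a), VertexAlgebroid.CurvedMor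
      ((D₀.obj (s a)).app W (ha.trans (hs a))) ((D.obj (s' a)).app W (ha.trans (hs' a)))
      ((g a).app W (le_inf hU ha)) (-ω.app W hU))
    (hc : ∀ a b (W : Opens X) (hU : W ≤ U) (ha : W ≤ N a) (hb : W ≤ N b),
      (D₀.h (s a) (s b)).app W (le_inf (ha.trans (hs a)) (hb.trans (hs b))) +
          (g b).app W (le_inf hU hb) =
        (g a).app W (le_inf hU ha) +
          (D.h (s' a) (s' b)).app W (le_inf (ha.trans (hs' a)) (hb.trans (hs' b)))) :
    ∃ p : TwistedIso D₀ D U, p.ω = ω ∧ ∀ a (W : Opens X) (hU : W ≤ U) (ha : W ≤ N a),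
      (p.f (s a) (s' a)).app W (le_inf hU (le_inf (ha.trans (hs a)) (ha.trans (hs' a)))) =
        (g a).app W (le_inf hU ha) := by
  have key : ∀ i j, ∃ F : 𝒯.LocHom (U ⊓ (D₀.U i ⊓ D.U j)), ∀ (a : κ) (W : Opens X)
      (hW : W ≤ U ⊓ (D₀.U i ⊓ D.U j)) (ha : W ≤ N a), F.app W hW =
        (D₀.h i (s a)).app W (le_inf (hW.trans (inf_le_right.trans inf_le_left))
            (ha.trans (hs a))) +
          (g a).app W (le_inf (hW.trans inf_le_left) ha) +
          (D.h (s' a) j).app W (le_inf (ha.trans (hs' a))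
            (hW.trans (inf_le_right.trans inf_le_right))) := by
    intro i j
    refine LocHom.exists_glue (U := U ⊓ (D₀.U i ⊓ D.U j)) N (fun x hx => hN x hx.1) _ ?_ ?_
    · intro a V W hU ha hWV τ
      simp only [LinearMap.add_apply, map_add, LocHom.nat]
    · intro a b W hW ha hb
      obtain ⟨hU, hij⟩ := le_inf_iff.1 hW
      obtain ⟨hi, hj⟩ := le_inf_iff.1 hij
      rw [← D₀.cocycle i (s a) (s b) W hi (ha.trans (hs a)) (hb.trans (hs b)),
        ← D.cocycle (s' a) (s' b) j W (ha.trans (hs' a)) (hb.trans (hs' b)) hj]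
      linear_combination (norm := module) -(hc a b W hU ha hb)
  choose F hF using key
  have hF' : ∀ i j a W (hU : W ≤ U) (hi : W ≤ D₀.U i) (hj : W ≤ D.U j) (ha : W ≤ N a),
      (F i j).app W (le_inf hU (le_inf hi hj)) =
        (D₀.h i (s a)).app W (le_inf hi (ha.trans (hs a))) + (g a).app W (le_inf hU ha) +
          (D.h (s' a) j).app W (le_inf (ha.trans (hs' a)) hj) :=
    fun i j a W hU hi hj ha => hF i j a W (le_inf hU (le_inf hi hj)) ha
  refine ⟨⟨F, ω, fun i j W hU hi hj => ?_, fun i i' j j' W hU hi hi' hj hj' => ?_⟩, rfl,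
    fun a W hU ha => ?_⟩
  · refine curvedMor_of_cover ((D₀.obj i).res hi) ((D.obj j).res hj)
      ((F i j).res (le_inf hU (le_inf hi hj))) (Form3.res hU (-ω)) N (fun x hx => hN x (hU hx))
      fun a V hV ha => ?_
    rw [LocHom.res_app, hF' i j a V (hV.trans hU) (hV.trans hi) (hV.trans hj) ha]
    have H := ((D₀.curvedMor i (s a) V (hV.trans hi) (ha.trans (hs a))).comp
      (hg a V (hV.trans hU) ha)).comp (D.curvedMor (s' a) j V (ha.trans (hs' a)) (hV.trans hj))
    rw [zero_add, add_zero] at H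
    exact H
  · refine LocHom.app_eq_of_cover (𝒯 := 𝒯) N
      (f := (D₀.h i i').res (le_inf hi hi') + (F i' j').res (le_inf hU (le_inf hi' hj')))
      (g := (F i j).res (le_inf hU (le_inf hi hj)) + (D.h j j').res (le_inf hj hj'))
      (fun x hx => hN x (hU hx)) ?_
    intro a V hV ha
    rw [LocHom.add_app, LocHom.add_app, LocHom.res_app, LocHom.res_app, LocHom.res_app,
      LocHom.res_app, hF' i j a V (hV.trans hU) (hV.trans hi) (hV.trans hj) ha,
      hF' i' j' a V (hV.trans hU) (hV.trans hi') (hV.trans hj') ha,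
      ← D₀.cocycle i i' (s a) V (hV.trans hi) (hV.trans hi') (ha.trans (hs a)),
      ← D.cocycle (s' a) j j' V (ha.trans (hs' a)) (hV.trans hj) (hV.trans hj')]
    abel
  · rw [hF' (s a) (s' a) a W hU (ha.trans (hs a)) (ha.trans (hs' a)) ha,
      h_self D₀ (s a) W (ha.trans (hs a)), h_self D (s' a) W (ha.trans (hs' a)), zero_add, add_zero]

end cover

/-- Restriction. -/
def res (h : V ≤ U) (p : TwistedIso D₀ D U) : TwistedIso D₀ D V where
  f i j := (p.f i j).res (inf_le_inf h le_rfl)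
  ω := Form3.res h p.ω
  curvedMor i j W hV := p.curvedMor i j W (hV.trans h)
  compat i i' j j' W hV := p.compat i i' j j' W (hV.trans h)

/-- The action of two-forms: `η` sends `f : D₀ ∔ ω → D` to `f - η : D₀ ∔ (dη + ω) → D`. The
minus sign comes from `η` being a morphism `D₀ → D₀ ∔ dη`, so that `f` is composed with its inverse. -/
def act (η : 𝒯.Form2 U) (p : TwistedIso D₀ D U) : TwistedIso D₀ D U where
  f i j := p.f i j - η.toLocHom.res inf_le_left
  ω := 𝒯.d U η + p.ω
  curvedMor i j W hU hi hj := by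
    have H := (VertexAlgebroid.CurvedMor.ofTwoForm _ (η.app W hU)).inv.comp
      (p.curvedMor i j W hU hi hj)
    rw [← neg_add, ← sub_eq_neg_add] at H
    exact H
  compat i i' j j' W hU hi hi' hj hj' := by
    have e := p.compat i i' j j' W hU hi hi' hj hj'
    change (D₀.h i i').app W _ + ((p.f i' j').app W _ - toHom _ (η.app W hU)) =
      (p.f i j).app W _ - toHom _ (η.app W hU) + (D.h j j').app W _
    linear_combination (norm := module) e

theorem act_app (η : 𝒯.Form2 U) (p : TwistedIso D₀ D U) (i : D₀.ι) (j : D.ι) (W : Opens X)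
    (hU : W ≤ U) (hi : W ≤ D₀.U i) (hj : W ≤ D.U j) :
    ((act η p).f i j).app W (le_inf hU (le_inf hi hj)) =
      (p.f i j).app W (le_inf hU (le_inf hi hj)) - toHom _ (η.app W hU) := rfl

theorem act_left_cancel {η η' : 𝒯.Form2 U} {p : TwistedIso D₀ D U} (h : act η p = act η' p) :
    η = η' := by
  refine Form2.eq_of_cover (fun a : D₀.ι × D.ι => D₀.U a.1 ⊓ D.U a.2) (fun x _ => ?_)
    fun a W hU ha => toHom_injective _ ?_
  · obtain ⟨i, hi⟩ := D₀.cover x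
    obtain ⟨j, hj⟩ := D.cover x
    exact ⟨(i, j), hi, hj⟩
  · have e := congrArg (fun t : TwistedIso D₀ D U => (t.f a.1 a.2).app W (le_inf hU ha)) h
    exact sub_right_inj.1 e

/-- Two isomorphisms `D₀ ∔ ω → D` and `D₀ ∔ ω' → D` differ by a two-form. -/
theorem exists_act_eq (p q : TwistedIso D₀ D U) : ∃ η, act η p = q := by
  have cov : ∀ x ∈ U, ∃ a : D₀.ι × D.ι, x ∈ D₀.U a.1 ⊓ D.U a.2 := fun x _ => by
    obtain ⟨i, hi⟩ := D₀.cover x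
    obtain ⟨j, hj⟩ := D.cover x
    exact ⟨(i, j), hi, hj⟩
  have H : ∀ a : D₀.ι × D.ι, ∃ η : 𝒯.Form2 (U ⊓ (D₀.U a.1 ⊓ D.U a.2)),
      η.toLocHom = p.f a.1 a.2 - q.f a.1 a.2 ∧
      𝒯.d _ η = Form3.res inf_le_left (-p.ω) - Form3.res inf_le_left (-q.ω) := fun a =>
    CurvedMor.exists_form2
      (𝒜 := (D₀.obj a.1).res ((inf_le_right.trans inf_le_left : U ⊓ (D₀.U a.1 ⊓ D.U a.2) ≤ _)))
      (ℬ := (D.obj a.2).res (inf_le_right.trans inf_le_right))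
      (fun W hW => p.curvedMor _ _ W _ _ _) (fun W hW => q.curvedMor _ _ W _ _ _)
  choose η hη hd using H
  have hη' : ∀ a W (hU : W ≤ U) (ha : W ≤ D₀.U a.1 ⊓ D.U a.2),
      toHom _ ((η a).app W (le_inf hU ha)) =
        (p.f a.1 a.2).app W (le_inf hU ha) - (q.f a.1 a.2).app W (le_inf hU ha) :=
    fun a W hU ha => congrArg (fun t : 𝒯.LocHom _ => t.app W (le_inf hU ha)) (hη a)
  obtain ⟨ζ, hζ⟩ := Form2.exists_glue _ cov (fun a W hU ha => (η a).app W (le_inf hU ha))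
    (fun a V W hU hV hWV τ => (η a).nat (le_inf hU hV) hWV τ) (fun a b W hU ha hb => by
      obtain ⟨ai, aj⟩ := le_inf_iff.1 ha
      obtain ⟨bi, bj⟩ := le_inf_iff.1 hb
      have e₁ := p.compat a.1 b.1 a.2 b.2 W hU ai bi aj bj
      have e₂ := q.compat a.1 b.1 a.2 b.2 W hU ai bi aj bj
      refine toHom_injective _ ?_
      rw [hη' a W hU ha, hη' b W hU hb]
      linear_combination (norm := module) e₂ - e₁)
  refine ⟨ζ, eq_of_cover _ cov Prod.fst (fun _ => inf_le_left) Prod.snd (fun _ => inf_le_right)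
    (Form3.eq_of_cover _ cov fun a W hU ha => ?_) fun a W hU ha => ?_⟩
  · have e : (𝒯.sec W).dTwo ((η a).app W (le_inf hU ha)) = -p.ω.app W hU - -q.ω.app W hU :=
      congrArg (fun t : 𝒯.Form3 _ => t.app W (le_inf hU ha)) (hd a)
    change (𝒯.sec W).dTwo (ζ.app W hU) + p.ω.app W hU = q.ω.app W hU
    rw [hζ a W hU ha, e]
    abel
  · refine (act_app ζ p a.1 a.2 W hU (ha.trans inf_le_left) (ha.trans inf_le_right)).trans ?_
    rw [hζ a W hU ha, hη' a W hU ha]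
    abel

theorem exists_glue {κ : Type u} (N : κ → Opens X) (hU : ∀ a, N a ≤ U)
    (hN : ∀ x ∈ U, ∃ a, x ∈ N a) (p : ∀ a, TwistedIso D₀ D (N a))
    (hp : ∀ a b, res (inf_le_left : N a ⊓ N b ≤ N a) (p a) = res inf_le_right (p b)) :
    ∃! q : TwistedIso D₀ D U, ∀ a, res (hU a) q = p a := by
  have hω : ∀ a b W (ha : W ≤ N a) (hb : W ≤ N b), (p a).ω.app W ha = (p b).ω.app W hb :=
    fun a b W ha hb => congrArg (fun t => t.ω.app W (le_inf ha hb)) (hp a b)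
  have hf : ∀ a b i j W (ha : W ≤ N a) (hb : W ≤ N b) (hi : W ≤ D₀.U i) (hj : W ≤ D.U j),
      ((p a).f i j).app W (le_inf ha (le_inf hi hj)) =
        ((p b).f i j).app W (le_inf hb (le_inf hi hj)) := fun a b i j W ha hb hi hj =>
    congrArg (fun t => (t.f i j).app W (le_inf (le_inf ha hb) (le_inf hi hj))) (hp a b)
  obtain ⟨ω, h_ω⟩ := Form3.exists_glue N hN (fun a W _ ha => (p a).ω.app W ha)
    (fun a V W _ hV hWV τ σ => (p a).ω.nat hV hWV τ σ) (fun a b W _ ha hb => hω a b W ha hb)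
  have cov : ∀ x ∈ U, ∃ a : κ × D₀.ι × D.ι, x ∈ N a.1 ⊓ (D₀.U a.2.1 ⊓ D.U a.2.2) := fun x hx => by
    obtain ⟨a, ha⟩ := hN x hx
    obtain ⟨i, hi⟩ := D₀.cover x
    obtain ⟨j, hj⟩ := D.cover x
    exact ⟨(a, i, j), ha, hi, hj⟩
  obtain ⟨q, rfl, hq⟩ := exists_of_cover
    (fun a : κ × D₀.ι × D.ι => N a.1 ⊓ (D₀.U a.2.1 ⊓ D.U a.2.2)) cov (fun a => a.2.1)
    (fun _ => inf_le_right.trans inf_le_left) (fun a => a.2.2)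
    (fun _ => inf_le_right.trans inf_le_right) (fun a => ((p a.1).f a.2.1 a.2.2).res inf_le_right) ω
    (fun a W hU ha => by
      rw [h_ω a.1 W hU (ha.trans inf_le_left)]
      exact (p a.1).curvedMor _ _ W (ha.trans inf_le_left) _ _)
    (fun a b W hU ha hb => by
      obtain ⟨a₁, ha'⟩ := le_inf_iff.1 ha
      obtain ⟨b₁, hb'⟩ := le_inf_iff.1 hb
      obtain ⟨a₂, a₃⟩ := le_inf_iff.1 ha'
      obtain ⟨b₂, b₃⟩ := le_inf_iff.1 hb'
      have e := (p a.1).compat a.2.1 b.2.1 a.2.2 b.2.2 W a₁ a₂ b₂ a₃ b₃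
      rw [hf a.1 b.1 b.2.1 b.2.2 W a₁ b₁ b₂ b₃] at e
      exact e)
  have cov' : ∀ a, ∀ x ∈ N a, ∃ b : D₀.ι × D.ι, x ∈ D₀.U b.1 ⊓ D.U b.2 := fun a x _ => by
    obtain ⟨i, hi⟩ := D₀.cover x
    obtain ⟨j, hj⟩ := D.cover x
    exact ⟨(i, j), hi, hj⟩
  refine ⟨q, fun a => eq_of_cover _ (cov' a) Prod.fst (fun _ => inf_le_left) Prod.snd
    (fun _ => inf_le_right) (Form3.ext fun W hW => h_ω a W (hW.trans (hU a)) hW)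
    fun b W hW hb => hq (a, b) W (hW.trans (hU a)) (le_inf hW hb), fun q' hq' => ?_⟩
  refine eq_of_cover (fun a : κ × D₀.ι × D.ι => N a.1 ⊓ (D₀.U a.2.1 ⊓ D.U a.2.2)) cov
    (fun a => a.2.1) (fun _ => inf_le_right.trans inf_le_left)
    (fun a => a.2.2) (fun _ => inf_le_right.trans inf_le_right) ?_ fun a W hW ha => ?_
  · refine Form3.eq_of_cover N hN fun a W hW ha => ?_
    rw [h_ω a W hW ha]
    exact congrArg (fun t => t.ω.app W ha) (hq' a)
  · rw [hq a W hW ha]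
    exact congrArg (fun t => (t.f a.2.1 a.2.2).app W ha) (hq' a.1)

end TwistedIso

/-- The presheaf of isomorphisms `D₀ ∔ ω → D`. -/
def twistedIsoPresheaf (D₀ D : 𝒯.GlobalVA) : TopCat.Presheaf (Type u) X where
  obj U := TwistedIso D₀ D U.unop
  map i := ↾(TwistedIso.res (leOfHom i.unop))

theorem exists_twistedIso (h𝒯 : 𝒯.IsRegular) (D₀ D : 𝒯.GlobalVA) (x : X) :
    ∃ U : Opens X, x ∈ U ∧ Nonempty (TwistedIso D₀ D U) := by
  obtain ⟨i, hi⟩ := D₀.cover x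
  obtain ⟨j, hj⟩ := D.cover x
  obtain ⟨N, hx, h₁, h₂, g, ω, hg⟩ := h𝒯.exists_local_curvedMor hi hj (D₀.obj i) (D.obj j)
  obtain ⟨p, -, -⟩ := TwistedIso.exists_of_cover (U := N) (fun _ : PUnit.{u + 1} => N)
    (fun x hx => ⟨PUnit.unit, hx⟩) (fun _ => i) (fun _ => h₁) (fun _ => j) (fun _ => h₂)
    (fun _ => g.res inf_le_left) (-ω) (fun _ W hU ha => by
      have e : -(-ω).app W hU = ω.app W hU := neg_neg _
      rw [e]
      exact hg W hU) (fun _ _ W hU ha hb => by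
      rw [h_self D₀ i W (hU.trans h₁), h_self D j W (hU.trans h₂), zero_add, add_zero])
  exact ⟨N, hx, ⟨p⟩⟩

/-- The torsor of isomorphisms `D₀ ∔ ω → D`, with `ω` as the map `w`. The form `ω` varies with the
isomorphism. -/
def torsor (h𝒯 : 𝒯.IsRegular) (D₀ D : 𝒯.GlobalVA) : 𝒯.FormTorsor where
  P := twistedIsoPresheaf D₀ D
  isSheaf := TopCat.Presheaf.isSheaf_of_isSheafUniqueGluing_types _ fun κ N p hp =>
    TwistedIso.exists_glue N (fun a => le_iSup N a) (fun _ hx => Opens.mem_iSup.1 hx) p hp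
  act _ η p := TwistedIso.act η p
  w _ p := TwistedIso.ω p
  zero_act U p := TwistedIso.ext (funext fun i => funext fun j => sub_zero _)
    ((congrArg (· + _) (map_zero _)).trans (zero_add _))
  add_act U η η' p := TwistedIso.ext (funext fun i => funext fun j => (sub_add_eq_sub_sub_swap
      (TwistedIso.f p i j) (η.toLocHom.res inf_le_left) (η'.toLocHom.res inf_le_left)))
    ((congrArg (· + _) (map_add _ _ _)).trans (add_assoc _ _ _))
  simply_transitive U p q := by
    obtain ⟨η, hη⟩ := TwistedIso.exists_act_eq p q
    exact ⟨η, hη, fun η' h' => TwistedIso.act_left_cancel (h'.trans hη.symm)⟩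
  locally_nonempty := exists_twistedIso h𝒯 D₀ D
  res_act _ _ _ := rfl
  res_w _ _ := rfl
  w_act _ _ _ := rfl

end GlobalVA

end ExtLieSheaf

namespace ExtLieSheaf

open ExtLieAlgebroid

variable {k : Type v} [CommRing k] [Invertible (2 : k)] {X : TopCat.{u}}
  {𝒯 : ExtLieSheaf.{u, v} k X}

namespace GlobalVA

/-! ### Global vertex algebroids and torsors -/

namespace TwistedIso

variable {D₀ D D' D'' : 𝒯.GlobalVA} {U V : Opens X}

theorem exists_postcomp (p : TwistedIso D₀ D U) (g : Hom D D') : ∃ q : TwistedIso D₀ D' U,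
    q.ω = p.ω ∧ ∀ (i : D₀.ι) (l : D.ι) (j : D'.ι) (W : Opens X) (hU : W ≤ U) (hi : W ≤ D₀.U i)
      (hl : W ≤ D.U l) (hj : W ≤ D'.U j), (q.f i j).app W (le_inf hU (le_inf hi hj)) =
        (p.f i l).app W (le_inf hU (le_inf hi hl)) + (g.f l j).app W (le_inf hl hj) := by
  obtain ⟨q, hω, hq⟩ := exists_of_cover (U := U)
    (fun a : D₀.ι × D.ι × D'.ι => D₀.U a.1 ⊓ (D.U a.2.1 ⊓ D'.U a.2.2)) (fun x _ => by
      obtain ⟨i, hi⟩ := D₀.cover x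
      obtain ⟨l, hl⟩ := D.cover x
      obtain ⟨j, hj⟩ := D'.cover x
      exact ⟨(i, l, j), hi, hl, hj⟩) Prod.fst (fun _ => inf_le_left) (fun a => a.2.2)
    (fun _ => inf_le_right.trans inf_le_right)
    (fun a => (p.f a.1 a.2.1).res (le_inf inf_le_left (inf_le_right.trans (inf_le_inf_left _
        inf_le_left))) + (g.f a.2.1 a.2.2).res (inf_le_right.trans inf_le_right)) p.ω
    (fun a W hU ha => by
      obtain ⟨hi, hlj⟩ := le_inf_iff.1 ha
      obtain ⟨hl, hj⟩ := le_inf_iff.1 hlj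
      have H := (p.curvedMor a.1 a.2.1 W hU hi hl).comp (g.curvedMor a.2.1 a.2.2 W hl hj)
      rw [add_zero] at H
      exact H)
    (fun a b W hU ha hb => by
      obtain ⟨hi, hlj⟩ := le_inf_iff.1 ha
      obtain ⟨hl, hj⟩ := le_inf_iff.1 hlj
      obtain ⟨hi', hlj'⟩ := le_inf_iff.1 hb
      obtain ⟨hl', hj'⟩ := le_inf_iff.1 hlj'
      have e₁ := p.compat a.1 b.1 a.2.1 b.2.1 W hU hi hi' hl hl'
      have e₂ := g.compat a.2.1 b.2.1 a.2.2 b.2.2 W hl hl' hj hj'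
      change (D₀.h a.1 b.1).app W _ + ((p.f b.1 b.2.1).app W _ + (g.f b.2.1 b.2.2).app W _) =
        (p.f a.1 a.2.1).app W _ + (g.f a.2.1 a.2.2).app W _ + (D'.h a.2.2 b.2.2).app W _
      linear_combination (norm := module) e₁ + e₂)
  exact ⟨q, hω, fun i l j W hU hi hl hj => hq (i, l, j) W hU (le_inf hi (le_inf hl hj))⟩

/-- The composite of an isomorphism `D₀ ∔ ω → D` over `U` with a morphism `D → D'`. -/
noncomputable def postcomp (p : TwistedIso D₀ D U) (g : Hom D D') : TwistedIso D₀ D' U :=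
  (exists_postcomp p g).choose

theorem postcomp_ω (p : TwistedIso D₀ D U) (g : Hom D D') : (postcomp p g).ω = p.ω :=
  (exists_postcomp p g).choose_spec.1

theorem postcomp_app (p : TwistedIso D₀ D U) (g : Hom D D') (i : D₀.ι) (l : D.ι) (j : D'.ι)
    (W : Opens X) (hU : W ≤ U) (hi : W ≤ D₀.U i) (hl : W ≤ D.U l) (hj : W ≤ D'.U j) :
    ((postcomp p g).f i j).app W (le_inf hU (le_inf hi hj)) =
      (p.f i l).app W (le_inf hU (le_inf hi hl)) + (g.f l j).app W (le_inf hl hj) :=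
  (exists_postcomp p g).choose_spec.2 i l j W hU hi hl hj

theorem postcomp_eq {p : TwistedIso D₀ D U} {g : Hom D D'} {q : TwistedIso D₀ D' U}
    (hω : q.ω = p.ω) (h : ∀ (i : D₀.ι) (l : D.ι) (j : D'.ι) (W : Opens X) (hU : W ≤ U)
      (hi : W ≤ D₀.U i) (hl : W ≤ D.U l) (hj : W ≤ D'.U j),
      (q.f i j).app W (le_inf hU (le_inf hi hj)) =
        (p.f i l).app W (le_inf hU (le_inf hi hl)) + (g.f l j).app W (le_inf hl hj)) :
    postcomp p g = q :=
  eq_of_cover (fun a : D₀.ι × D.ι × D'.ι => D₀.U a.1 ⊓ (D.U a.2.1 ⊓ D'.U a.2.2)) (fun x _ => by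
      obtain ⟨i, hi⟩ := D₀.cover x
      obtain ⟨l, hl⟩ := D.cover x
      obtain ⟨j, hj⟩ := D'.cover x
      exact ⟨(i, l, j), hi, hl, hj⟩) Prod.fst (fun _ => inf_le_left) (fun a => a.2.2)
    (fun _ => inf_le_right.trans inf_le_right) ((postcomp_ω p g).trans hω.symm) fun a W hU ha => by
      obtain ⟨hi, hlj⟩ := le_inf_iff.1 ha
      obtain ⟨hl, hj⟩ := le_inf_iff.1 hlj
      exact (postcomp_app p g a.1 a.2.1 a.2.2 W hU hi hl hj).trans
        (h a.1 a.2.1 a.2.2 W hU hi hl hj).symm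

theorem postcomp_id (p : TwistedIso D₀ D U) : postcomp p (idHom D) = p :=
  postcomp_eq rfl fun i l j W hU hi hl hj => by
    have e := p.compat i i l j W hU hi hi hl hj
    rw [h_self D₀ i W hi, zero_add] at e
    exact e

theorem postcomp_comp (p : TwistedIso D₀ D U) (g : Hom D D') (g' : Hom D' D'') :
    postcomp p (compHom g g') = postcomp (postcomp p g) g' := by
  refine (postcomp_eq (p := postcomp p g) (g := g') (postcomp_ω p _ |>.trans
    (postcomp_ω p g).symm) fun i l j W hU hi hl hj => ?_).symm
  refine LocHom.app_eq_of_cover (𝒯 := 𝒯) D.U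
    (f := ((postcomp p (compHom g g')).f i j).res (le_inf hU (le_inf hi hj)))
    (g := ((postcomp p g).f i l).res (le_inf hU (le_inf hi hl)) + (g'.f l j).res (le_inf hl hj))
    (fun x _ => D.cover x) fun m W' hW hm => ?_
  rw [LocHom.add_app, LocHom.res_app, LocHom.res_app, LocHom.res_app,
    postcomp_app p _ i m j W' (hW.trans hU) (hW.trans hi) hm (hW.trans hj),
    postcomp_app p g i m l W' (hW.trans hU) (hW.trans hi) hm (hW.trans hl),
    compHom_app g g' m l j W' hm (hW.trans hl) (hW.trans hj), add_assoc]

theorem postcomp_act (η : 𝒯.Form2 U) (p : TwistedIso D₀ D U) (g : Hom D D') :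
    postcomp (act η p) g = act η (postcomp p g) :=
  postcomp_eq (congrArg (𝒯.d U η + ·) (postcomp_ω p g)) fun i l j W hU hi hl hj => by
    rw [act_app η p i l W hU hi hl, act_app η (postcomp p g) i j W hU hi hj,
      postcomp_app p g i l j W hU hi hl hj]
    abel

theorem postcomp_res (h : V ≤ U) (p : TwistedIso D₀ D U) (g : Hom D D') :
    postcomp (res h p) g = res h (postcomp p g) :=
  postcomp_eq (congrArg (Form3.res h) (postcomp_ω p g)) fun i l j W hU hi hl hj =>
    postcomp_app p g i l j W (hU.trans h) hi hl hj

end TwistedIso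

open TwistedIso

/-- The functor sending `D` to the torsor of isomorphisms `D₀ ∔ ω → D`. -/
noncomputable def torsorFunctor (h𝒯 : 𝒯.IsRegular) (D₀ : 𝒯.GlobalVA) :
    𝒯.GlobalVA ⥤ 𝒯.FormTorsor where
  obj D := torsor h𝒯 D₀ D
  map {D D'} g := FormTorsor.Hom.mk (P := torsor h𝒯 D₀ D) (Q := torsor h𝒯 D₀ D')
    { app U := ↾(fun p : TwistedIso D₀ D U.unop => postcomp p g)
      naturality _ _ i := ConcreteCategory.hom_ext _ _ fun p =>
        postcomp_res (leOfHom i.unop) p g }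
    (fun _ η p => postcomp_act η p g) (fun _ p => postcomp_ω p g)
  map_id D := FormTorsor.Hom.ext (NatTrans.ext (funext fun _ => ConcreteCategory.hom_ext _ _
    fun p => postcomp_id (D := D) p))
  map_comp g g' := FormTorsor.Hom.ext (NatTrans.ext (funext fun _ => ConcreteCategory.hom_ext _ _
    fun p => postcomp_comp p g g'))

theorem exists_sections (h𝒯 : 𝒯.IsRegular) (D₀ D D' : 𝒯.GlobalVA) :
    ∃ (N : X → Opens X) (s₀ : X → D₀.ι) (s : X → D.ι) (s' : X → D'.ι), (∀ x, x ∈ N x) ∧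
      (∀ x, N x ≤ D₀.U (s₀ x)) ∧ (∀ x, N x ≤ D.U (s x)) ∧ (∀ x, N x ≤ D'.U (s' x)) ∧
      Nonempty (∀ x, TwistedIso D₀ D (N x)) := by
  choose N hN p using exists_twistedIso h𝒯 D₀ D
  choose s₀ h₀ using D₀.cover
  choose s hs using D.cover
  choose s' hs' using D'.cover
  exact ⟨fun x => N x ⊓ (D₀.U (s₀ x) ⊓ (D.U (s x) ⊓ D'.U (s' x))), s₀, s, s',
    fun x => ⟨hN x, h₀ x, hs x, hs' x⟩, fun _ => inf_le_right.trans inf_le_left,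
    fun _ => inf_le_right.trans (inf_le_right.trans inf_le_left),
    fun _ => inf_le_right.trans (inf_le_right.trans inf_le_right),
    ⟨fun x => (p x).some.res inf_le_left⟩⟩

/-- A morphism `g` is determined by the composite `p + g` with a local section `p` of the torsor. -/
theorem torsorFunctor_faithful (h𝒯 : 𝒯.IsRegular) (D₀ : 𝒯.GlobalVA) :
    (torsorFunctor h𝒯 D₀).Faithful where
  map_injective {D D'} g g' h := by
    obtain ⟨N, s₀, s, s', hN, h₀, hs, hs', ⟨p⟩⟩ := exists_sections h𝒯 D₀ D D'
    refine Hom.ext_of_cover N (fun x => ⟨x, hN x⟩) s s' (fun x W hW hW' hx => ?_) hs hs'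
    have e : postcomp (p x) g = postcomp (p x) g' := congrArg
      (fun f : FormTorsor.Hom (torsor h𝒯 D₀ D) (torsor h𝒯 D₀ D') => f.f.app (op (N x)) (p x)) h
    have e₁ := congrArg (fun t => (t.f (s₀ x) (s' x)).app W
      (le_inf hx (le_inf (hx.trans (h₀ x)) hW'))) e
    have e₂ := postcomp_app (p x) g (s₀ x) (s x) (s' x) W hx (hx.trans (h₀ x)) hW hW'
    have e₃ := postcomp_app (p x) g' (s₀ x) (s x) (s' x) W hx (hx.trans (h₀ x)) hW hW'
    exact add_left_cancel (e₂.symm.trans (e₁.trans e₃))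

/-- A map `φ` of torsors is composition with the morphism given locally by `φ(p) - p`, for any local
section `p`; equivariance makes this independent of `p`. -/
theorem torsorFunctor_full (h𝒯 : 𝒯.IsRegular) (D₀ : 𝒯.GlobalVA) :
    (torsorFunctor h𝒯 D₀).Full where
  map_surjective {D D'} φ := by
    let F : FormTorsor.Hom (torsor h𝒯 D₀ D) (torsor h𝒯 D₀ D') := φ
    obtain ⟨N, s₀, s, s', hN, h₀, hs, hs', ⟨p⟩⟩ := exists_sections h𝒯 D₀ D D'
    let q : ∀ x, TwistedIso D₀ D' (N x) := fun x => F.f.app (op (N x)) (p x)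
    have hq : ∀ x, (q x).ω = (p x).ω := fun x => F.map_w _ (p x)
    obtain ⟨g, hg⟩ := exists_hom (D := D) (D' := D') N (fun x => ⟨x, hN x⟩) s hs s' hs'
      (fun x => ((q x).f (s₀ x) (s' x)).res (le_inf le_rfl (le_inf (h₀ x) (hs' x))) -
        ((p x).f (s₀ x) (s x)).res (le_inf le_rfl (le_inf (h₀ x) (hs x))))
      (fun x W hx => by
        have H := ((p x).curvedMor (s₀ x) (s x) W hx (hx.trans (h₀ x)) (hx.trans (hs x))).inv.comp
          ((q x).curvedMor (s₀ x) (s' x) W hx (hx.trans (h₀ x)) (hx.trans (hs' x)))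
        rw [hq x, neg_add_cancel, ← sub_eq_neg_add] at H
        exact H)
      (fun x y W hx hy => by
        obtain ⟨η, hη⟩ := exists_act_eq (TwistedIso.res (inf_le_left : N x ⊓ N y ≤ N x) (p x))
          (TwistedIso.res inf_le_right (p y))
        -- equivariance of `φ`: the sections `q` differ by the same two-form as the sections `p`
        have hη' : act η (TwistedIso.res inf_le_left (q x)) =
            TwistedIso.res inf_le_right (q y) := by
          have e := congrArg (F.f.app (op (N x ⊓ N y))) hη
          have e₁ : F.f.app (op (N x ⊓ N y)) (act η (TwistedIso.res inf_le_left (p x))) =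
            act η (F.f.app (op (N x ⊓ N y)) (TwistedIso.res inf_le_left (p x))) := F.map_act _ η _
          have e₂ : F.f.app (op (N x ⊓ N y)) (TwistedIso.res inf_le_left (p x)) =
            TwistedIso.res inf_le_left (q x) :=
            F.app_res inf_le_left (p x)
          have e₃ : F.f.app (op (N x ⊓ N y)) (TwistedIso.res inf_le_right (p y)) =
            TwistedIso.res inf_le_right (q y) :=
            F.app_res inf_le_right (p y)
          rw [e₁, e₂, e₃] at e
          exact e
        have x₀ := hx.trans (h₀ x)
        have y₀ := hy.trans (h₀ y)
        have x₁ := hx.trans (hs x)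
        have y₁ := hy.trans (hs y)
        have x₂ := hx.trans (hs' x)
        have y₂ := hy.trans (hs' y)
        have e₁ : ((p x).f (s₀ y) (s y)).app W (le_inf hx (le_inf y₀ y₁)) -
            toHom _ (η.app W (le_inf hx hy)) =
              ((p y).f (s₀ y) (s y)).app W (le_inf hy (le_inf y₀ y₁)) :=
          congrArg (fun t => (t.f (s₀ y) (s y)).app W (le_inf (le_inf hx hy) (le_inf y₀ y₁))) hη
        have e₂ : ((q x).f (s₀ y) (s' y)).app W (le_inf hx (le_inf y₀ y₂)) -
            toHom _ (η.app W (le_inf hx hy)) =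
              ((q y).f (s₀ y) (s' y)).app W (le_inf hy (le_inf y₀ y₂)) :=
          congrArg (fun t => (t.f (s₀ y) (s' y)).app W (le_inf (le_inf hx hy) (le_inf y₀ y₂))) hη'
        have e₃ := (p x).compat (s₀ x) (s₀ y) (s x) (s y) W hx x₀ y₀ x₁ y₁
        have e₄ := (q x).compat (s₀ x) (s₀ y) (s' x) (s' y) W hx x₀ y₀ x₂ y₂
        change (D.h (s x) (s y)).app W _ +
            (((q y).f (s₀ y) (s' y)).app W _ - ((p y).f (s₀ y) (s y)).app W _) =
          ((q x).f (s₀ x) (s' x)).app W _ - ((p x).f (s₀ x) (s x)).app W _ +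
            (D'.h (s' x) (s' y)).app W _
        linear_combination (norm := module) e₁ - e₂ - e₃ + e₄)
    refine ⟨g, FormTorsor.Hom.eq_of_sections (P := torsor h𝒯 D₀ D) (Q := torsor h𝒯 D₀ D') N
      (fun x => ⟨x, hN x⟩) p fun x => ?_⟩
    change postcomp (p x) g = q x
    refine eq_of_cover (fun _ : PUnit.{u + 1} => N x) (fun x hx => ⟨PUnit.unit, hx⟩)
      (fun _ => s₀ x) (fun _ => h₀ x) (fun _ => s' x) (fun _ => hs' x)
      ((postcomp_ω _ _).trans (hq x).symm) fun _ W hx _ => ?_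
    rw [postcomp_app (p x) g (s₀ x) (s x) (s' x) W hx (hx.trans (h₀ x)) (hx.trans (hs x))
      (hx.trans (hs' x)), hg x W hx]
    exact add_sub_cancel _ _

/-- Local sections `p_x` of a torsor, with differences `η_xy` and images `ω_x` under `w`, form a
one-cocycle `(ω, η)`. The torsor is that of the twist of `D₀` by this cocycle, in which `p_x`
corresponds to the isomorphisms `h + η_xy`. -/
theorem torsorFunctor_essSurj (h𝒯 : 𝒯.IsRegular) (D₀ : 𝒯.GlobalVA) :
    (torsorFunctor h𝒯 D₀).EssSurj where
  mem_essImage P := by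
    choose M hM t using P.locally_nonempty
    choose s hs using D₀.cover
    let N : X → Opens X := fun x => M x ⊓ D₀.U (s x)
    have hN : ∀ x, x ∈ N x := fun x => ⟨hM x, hs x⟩
    have hNs : ∀ x, N x ≤ D₀.U (s x) := fun x => inf_le_right
    obtain ⟨p⟩ : Nonempty (∀ x, P.P.obj (op (N x))) := ⟨fun x => P.res inf_le_left (t x).some⟩
    choose η hη using fun x y => P.exists_act (P.res (inf_le_left : N x ⊓ N y ≤ N x) (p x))
      (P.res (inf_le_right : N x ⊓ N y ≤ N y) (p y))
    have hη' : ∀ x y W (hx : W ≤ N x) (hy : W ≤ N y),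
        P.act W (Form2.res (le_inf hx hy) (η x y)) (P.res hx (p x)) = P.res hy (p y) := by
      intro x y W hx hy
      have e := congrArg (P.res (le_inf hx hy)) (hη x y)
      rwa [P.res_act', P.res_res, P.res_res] at e
    have hd : ∀ x y W (hx : W ≤ N x) (hy : W ≤ N y),
        (𝒯.sec W).dTwo ((η x y).app W (le_inf hx hy)) =
          (P.w _ (p y)).app W hy - (P.w _ (p x)).app W hx := by
      intro x y W hx hy
      have e := congrArg (P.w W) (hη' x y W hx hy)
      rw [P.w_act, P.w_res, P.w_res, ← eq_sub_iff_add_eq] at e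
      exact congrArg (fun t : 𝒯.Form3 W => t.app W le_rfl) e
    have hz : ∀ x y z W (hx : W ≤ N x) (hy : W ≤ N y) (hz : W ≤ N z),
        (η y z).app W (le_inf hy hz) + (η x y).app W (le_inf hx hy) =
          (η x z).app W (le_inf hx hz) := by
      intro x y z W hx hy hz
      have e := hη' y z W hy hz
      rw [← hη' x y W hx hy, ← hη' x z W hx hz, ← P.add_act] at e
      exact congrArg (fun t : 𝒯.Form2 W => t.app W le_rfl) (P.act_cancel e)
    have hker : ((fun x => P.w _ (p x), η) : 𝒯.C1 N) ∈ LinearMap.ker (𝒯.D1 N) :=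
      mem_ker_D1.2 ⟨fun x y W hx hy => hd x y W hx hy, fun x y z W hx hy hl => by
        rw [← hz x y z W hx hy hl]
        abel⟩
    -- `D₀` is first restricted to the cover over which the sections `p_x` live
    let D := (D₀.refine N (fun x => ⟨x, hN x⟩) s hNs).twist ⟨_, hker⟩
    have hq : ∀ x, ∃ q : TwistedIso D₀ D (N x), q.ω = P.w _ (p x) ∧
        ∀ i y (W : Opens X) (hx : W ≤ N x) (hi : W ≤ D₀.U i) (hy : W ≤ N y),
          (q.f i y).app W (le_inf hx (le_inf hi hy)) =
            (D₀.h i (s y)).app W (le_inf hi (hy.trans (hNs y))) +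
              toHom _ ((η x y).app W (le_inf hx hy)) := fun x =>
      ⟨{  f := fun i y => (D₀.h i (s y)).res (inf_le_right.trans (inf_le_inf_left _ (hNs y))) +
            (η x y).toLocHom.res (inf_le_inf_left _ inf_le_right)
          ω := P.w _ (p x)
          curvedMor := fun i y W hx hi hy => by
            have H := (VertexAlgebroid.curvedMor_twist (ω₁ := 0) (ω₂ := (P.w _ (p y)).app W hy)
              (ω := -(P.w _ (p x)).app W hx)).2 (by
                have H := (D₀.curvedMor i (s y) W hi (hy.trans (hNs y))).comp
                  (VertexAlgebroid.CurvedMor.ofTwoForm _ ((η x y).app W (le_inf hx hy)))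
                rw [zero_add, hd x y W hx hy, sub_eq_add_neg] at H
                rw [sub_zero]
                exact H)
            rw [VertexAlgebroid.twist_zero] at H
            exact H
          compat := fun i i' y y' W hx hi hi' hy hy' => by
            have e := congrArg (toHom (𝒯.sec W)) (hz x y y' W hx hy hy')
            have e' := D₀.cocycle i i' (s y') W hi hi' (hy'.trans (hNs y'))
            have e'' := D₀.cocycle i (s y) (s y') W hi (hy.trans (hNs y)) (hy'.trans (hNs y'))
            rw [map_add] at e
            change (D₀.h i i').app W _ + ((D₀.h i' (s y')).app W _ +
                toHom _ ((η x y').app W (le_inf hx hy'))) =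
              (D₀.h i (s y)).app W _ + toHom _ ((η x y).app W (le_inf hx hy)) +
                ((D₀.h (s y) (s y')).app W _ + toHom _ ((η y y').app W (le_inf hy hy')))
            linear_combination (norm := module) e' - e'' - e },
        rfl, fun i y W hx hi hy => rfl⟩
    choose q hqω hqf using hq
    obtain ⟨e⟩ := FormTorsor.nonempty_iso (P := torsor h𝒯 D₀ D) (Q := P) N (fun x => ⟨x, hN x⟩)
      q p (fun x => (hqω x).symm) fun x y => ⟨η x y, by
        change act (η x y) (TwistedIso.res inf_le_left (q x)) = TwistedIso.res inf_le_right (q y)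
        refine eq_of_cover (fun a : D₀.ι × X => D₀.U a.1 ⊓ N a.2) (fun z _ => ?_) Prod.fst
          (fun _ => inf_le_left) Prod.snd (fun _ => inf_le_right)
          (Form3.ext fun W hW => ?_) fun a W hW ha => ?_
        · obtain ⟨i, hi⟩ := D₀.cover z
          exact ⟨(i, z), hi, hN z⟩
        · obtain ⟨hx, hy⟩ := le_inf_iff.1 hW
          change (𝒯.sec W).dTwo ((η x y).app W (le_inf hx hy)) + (q x).ω.app W hx =
            (q y).ω.app W hy
          rw [hqω, hqω, hd x y W hx hy, sub_add_cancel]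
        · obtain ⟨hx, hy⟩ := le_inf_iff.1 hW
          obtain ⟨hi, ha⟩ := le_inf_iff.1 ha
          change ((q x).f a.1 a.2).app W (le_inf hx (le_inf hi ha)) -
            toHom _ ((η x y).app W (le_inf hx hy)) =
              ((q y).f a.1 a.2).app W (le_inf hy (le_inf hi ha))
          rw [hqf x a.1 a.2 W hx hi ha, hqf y a.1 a.2 W hy hi ha, ← hz x y a.2 W hx hy ha, map_add]
          abel, hη x y⟩
    exact ⟨D, ⟨e⟩⟩

/-- The groupoid of global vertex algebroids is equivalent to the groupoid of torsors. -/
theorem nonempty_equivalence (h𝒯 : 𝒯.IsRegular) (D₀ : 𝒯.GlobalVA) :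
    Nonempty (𝒯.GlobalVA ≌ 𝒯.FormTorsor) := by
  have := torsorFunctor_faithful h𝒯 D₀
  have := torsorFunctor_full h𝒯 D₀
  have := torsorFunctor_essSurj h𝒯 D₀
  have : (torsorFunctor h𝒯 D₀).IsEquivalence := {}
  exact ⟨(torsorFunctor h𝒯 D₀).asEquivalence⟩

end GlobalVA

end ExtLieSheaf

theorem theorem7p5 {k : Type v} [CommRing k] [Invertible (2 : k)] {X : TopCat.{u}}
    (𝒯 : ExtLieSheaf.{u, v} k X) (h𝒯 : 𝒯.IsRegular) :
    ∃ c ch₂ : 𝒯.H2,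
      𝒯.IsCharacteristicClass c ∧ 𝒯.IsCh2 ch₂ ∧ c = (2 : k) • ch₂ ∧
      (Nonempty 𝒯.GlobalVA ↔ ch₂ = 0) ∧
      (Nonempty 𝒯.GlobalVA →
        Nonempty (𝒯.GlobalVA ≌ 𝒯.FormTorsor) ∧
        (∃ _ : AddTorsor 𝒯.H1 (Quotient (isIsomorphicSetoid 𝒯.GlobalVA)),
          ∀ (D : 𝒯.GlobalVA) (z : LinearMap.ker (𝒯.D1 D.U)) (r : X → D.ι)
            (hr : ∀ x, x ∈ D.U (r x)),
            ExtLieSheaf.H1.mk D.U r hr z +ᵥ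
                (Quotient.mk (isIsomorphicSetoid 𝒯.GlobalVA) D) =
              Quotient.mk (isIsomorphicSetoid 𝒯.GlobalVA) (D.twist z)) ∧
        ∀ D : 𝒯.GlobalVA, ∃ e : Multiplicative 𝒯.H0 ≃* Aut D,
          ∀ (η : 𝒯.H0) (i j : D.ι) (W : TopologicalSpace.Opens X) (hi : W ≤ D.U i)
            (hj : W ≤ D.U j),
            ((e (Multiplicative.ofAdd η)).hom.f i j).app W (le_inf hi hj) =
              (D.h i j).app W (le_inf hi hj) + (η.1.app W le_top).val.restrictScalars k) := by
  obtain ⟨c, hc, ⟨F₀⟩, hF⟩ := h𝒯.exists_class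
  have h2 : (2 : k) • (⅟2 : k) • c = c := smul_invOf_smul 2 c
  have h0 : Nonempty 𝒯.GlobalVA ↔ c = 0 := by
    refine ⟨fun ⟨D⟩ => D.eq_zero_of_isCharacteristicClass hc, ?_⟩
    rintro rfl
    obtain ⟨G⟩ := hc.1
    obtain ⟨z, hz, H⟩ := hc.2 G
    choose r hr using G.cover
    exact hz.nonempty_globalVA r hr (H r hr)
  -- twice `ch₂` is the Atiyah–Chern–Simons class `c`
  refine ⟨c, (⅟2 : k) • c, hc, ⟨⟨F₀⟩, fun F => ?_⟩, h2.symm, h0.trans ⟨fun h => ?_, fun h => ?_⟩,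
    fun hne => ⟨?_, ?_, ?_⟩⟩
  · rw [h2]
    exact hF F
  · rw [h, smul_zero]
  · rw [← h2, h, smul_zero]
  · exact ExtLieSheaf.GlobalVA.nonempty_equivalence h𝒯 hne.some
  · exact ExtLieSheaf.GlobalVA.exists_addTorsor h𝒯 hne
  · exact ExtLieSheaf.GlobalVA.exists_mulEquiv_aut
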